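/- Let $k$ be an algebraically closed field of characteristic $0$ and let $U$ be a unipotent affine algebraic group over $k$, with coordinate Hopf algebra $\mathcal{O}(U)$ (so $\mathcal{O}(U)$ is a finitely generated commutative Hopf algebra, and every nonzero finite-dimensional representation of $U$ has a nonzero fixed vector). Let $\mathfrak{u}=\mathrm{Lie}(U)\subset \mathcal{O}(U)^*$ be its Lie algebra. For a commutative Hopf algebra $H$ over $k$ with multiplication $m$ and counit $\varepsilon$, an invertible $J\in (H\otimes H)^*$ (for the convolution product $*$) is a *Hopf $2$-cocycle* if $\sum J(a_1b_1,c)J(a_2,b_2)=\sum J(a,b_1c_1)J(b_2,c_2)$ and $J(a,1)=\varepsilon(a)=J(1,a)$; it is *invariant* if $J*m=m*J$. The invariant Hopf $2$-cocycles form a group $Z^2_{\rm inv}(H)$, the elements $\partial(x)(a,b)=\sum x(a_1b_1)x^{-1}(a_2)x^{-1}(b_2)$ of $Z^2_{\rm inv}(H)$, with $x\in H^*$ invertible and central, form a central subgroup $B^2_{\rm inv}(H)$, and $H^2_{\rm inv}(H):=Z^2_{\rm inv}(H)/B^2_{\rm inv}(H)$. Put $H^2_{\rm inv}(U):=H^2_{\rm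 inv}(\mathcal{O}(U))$. It underlies a group functor on commutative $k$-algebras $R$, given by the same construction with $R$-valued linear forms, that is, $H^2_{\rm inv}(U)(R):=H^2_{\rm inv}(R\otimes\mathcal{O}(U))$ over $R$. For a Hopf $2$-cocycle $J$ set $R^J:=J_{21}^{-1}*J$; $J$ is *minimal* if the form $R^J$ is nondegenerate. Let $\mathcal{B}(U)$ be the set of pairs $(A,R)$ where $A$ is a closed normal commutative subgroup of $U$ and $R\in(\mathcal{O}(A)\otimes\mathcal{O}(A))^*$ is a nondegenerate $U$-invariant cotriangular structure on $\mathcal{O}(A)$ with trivial Drinfeld element. 1. There is exactly one map $\Theta:H^2_{\rm inv}(U)\to\mathcal{B}(U)$ such that, for every $J\in Z^2_{\rm inv}(\mathcal{O}(U))$, $\Theta([J])=(A,R)$ where $A$ is a support of $J$ (that is, there are a minimal Hopf $2$-cocycle $\bar J$ for $\mathcal{O}(A)$ and an invertible $x\in\mathcal{O}(U)^*$ such that $J=(x\circ m)*\bar J*(x^{-1}\otimes x^{-1})$, with $\bar J$ lifted to $\mathcal{O}(U)$) and $R$ lifts to $R^J$. This map $\Theta$ is bijective. 2. The space $(\wedge^2\mathfrak{u})^{\mathfrak{u}}$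 of $\mathfrak{u}$-invariant skew-symmetric tensors in $\mathfrak{u}\otimes\mathfrak{u}$ (with $x\wedge y=x\otimes y-y\otimes x$) is finite dimensional, and, regarded as a vector group, it is isomorphic to $H^2_{\rm inv}(U)$ as affine algebraic groups via $r\mapsto[\exp(r/2)]$. That is, for every commutative $k$-algebra $R$ and every $r\in R\otimes(\wedge^2\mathfrak{u})^{\mathfrak{u}}$ the convolution exponential $\exp(r/2)$ exists (its series is a finite sum on each element of $\mathcal{O}(U)\otimes\mathcal{O}(U)$) and is an $R$-valued invariant Hopf $2$-cocycle, and $r\mapsto[\exp(r/2)]$ is a group isomorphism $R\otimes(\wedge^2\mathfrak{u})^{\mathfrak{u}}\to H^2_{\rm inv}(U)(R)$, natural in $R$. 3. In particular, the group $H^2_{\rm inv}(U)$ is commutative. -/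

import Mathlib

open scoped TensorProduct
open WithConv Coalgebra

universe u v w w'

noncomputable section

namespace InvCoh

/-! ### Convolution algebras -/

section Conv

/-- `Conv k C A` is the space `Hom_k(C, A)` of linear maps from a coalgebra `C` to an algebra `A`,
with its convolution product. In particular `Conv k C k` is the dual algebra `C^*`, and for a
commutative `k`-algebra `R`, `Conv k C R` is the `R`-linear dual of the `R`-coalgebra `R ⊗ C`. -/
abbrev Conv (k : Type u) (C : Type v) (A : Type w) [CommSemiring k] [AddCommMonoid C] [Module k C]
    [AddCommMonoid A] [Module k A] : Type (max v w) :=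
  WithConv (C →ₗ[k] A)

variable {k : Type u} [Field k]
variable {C : Type v} [AddCommGroup C] [Module k C] [Coalgebra k C]
variable {D : Type w} [AddCommGroup D] [Module k D] [Coalgebra k D]

/-- Precomposition with a coalgebra homomorphism is a ring homomorphism of convolution algebras. -/
def pre (A : Type w') [Ring A] [Algebra k A] (g : D →ₗc[k] C) : Conv k C A →+* Conv k D A where
  toFun f := toConv (f.ofConv ∘ₗ g.toLinearMap)
  map_one' := by
    apply WithConv.ext; ext d; simp [LinearMap.convOne_def]
  map_mul' f f' := by
    apply WithConv.ext
    exact LinearMap.convMul_comp_coalgHom_distrib f f' g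
  map_zero' := by apply WithConv.ext; ext d; simp
  map_add' f f' := by apply WithConv.ext; ext d; simp

/-- Postcomposition with an algebra homomorphism is a ring homomorphism of convolution algebras. -/
def post (C : Type v) [AddCommGroup C] [Module k C] [Coalgebra k C]
    {A : Type w} [Ring A] [Algebra k A] {B : Type w'} [Ring B] [Algebra k B] (f : A →ₐ[k] B) :
    Conv k C A →+* Conv k C B where
  toFun x := toConv (f.toLinearMap ∘ₗ x.ofConv)
  map_one' := by
    apply WithConv.ext; ext d; simp [LinearMap.convOne_def]
  map_mul' x y := by
    apply WithConv.ext
    exact LinearMap.algHom_comp_convMul_distrib f x y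
  map_zero' := by apply WithConv.ext; ext d; simp
  map_add' x y := by apply WithConv.ext; ext d; simp

@[simp] lemma pre_apply (A : Type w') [Ring A] [Algebra k A] (g : D →ₗc[k] C) (f : Conv k C A)
    (d : D) : (pre A g f) d = f (g d) := rfl

@[simp] lemma post_apply {A : Type w} [Ring A] [Algebra k A] {B : Type w'} [Ring B] [Algebra k B]
    (f : A →ₐ[k] B) (x : Conv k C A) (c : C) : (post C f x) c = f (x c) := rfl

/-- Precomposition on units. -/
def preU (A : Type w') [Ring A] [Algebra k A] (g : D →ₗc[k] C) :
    (Conv k C A)ˣ →* (Conv k D A)ˣ := Units.map (pre A g).toMonoidHom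

/-- Postcomposition on units. -/
def postU (C : Type v) [AddCommGroup C] [Module k C] [Coalgebra k C]
    {A : Type w} [Ring A] [Algebra k A] {B : Type w'} [Ring B] [Algebra k B] (f : A →ₐ[k] B) :
    (Conv k C A)ˣ →* (Conv k C B)ˣ := Units.map (post C f).toMonoidHom

/-- `e` is the exponential of `f` in the convolution algebra: for every `c` the partial sums of
`∑ fⁱ(c) / i!` are eventually constant, with value `e c`. -/
def IsExp {A : Type w'} [Ring A] [Algebra k A] (f e : Conv k C A) : Prop :=
  ∀ c : C, ∀ᶠ n : ℕ in Filter.atTop,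
    (∑ i ∈ Finset.range n, ((i.factorial : k)⁻¹ • f ^ i)) c = e c

end Conv

/-! ### Structure maps of a commutative Hopf algebra -/

section Maps

variable (k : Type u) [Field k] (H : Type v) [CommRing H] [HopfAlgebra k H]

/-- `a ⊗ b ↦ a ε(b)` -/
def fst : H ⊗[k] H →ₗc[k] H :=
  (Coalgebra.TensorProduct.rid k k H).toCoalgHom.comp
    (Coalgebra.TensorProduct.map (CoalgHom.id k H) (Coalgebra.counitCoalgHom k H))

/-- `a ⊗ b ↦ ε(a) b` -/
def snd : H ⊗[k] H →ₗc[k] H :=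
  (Coalgebra.TensorProduct.lid k H).toCoalgHom.comp
    (Coalgebra.TensorProduct.map (Coalgebra.counitCoalgHom k H) (CoalgHom.id k H))

/-- `a ⊗ b ↦ b ⊗ a` -/
def swap : H ⊗[k] H →ₗc[k] H ⊗[k] H :=
  ((Bialgebra.TensorProduct.comm k H H : H ⊗[k] H →ₐc[k] H ⊗[k] H) : H ⊗[k] H →ₗc[k] H ⊗[k] H)

/-- `a ⊗ b ⊗ c ↦ ab ⊗ c` -/
def mul12 : H ⊗[k] (H ⊗[k] H) →ₗc[k] H ⊗[k] H :=
  (Coalgebra.TensorProduct.map (Bialgebra.mulCoalgHom k H) (CoalgHom.id k H)).comp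
    (Coalgebra.TensorProduct.assoc k k H H H).symm.toCoalgHom

/-- `a ⊗ b ⊗ c ↦ a ⊗ bc` -/
def mul23 : H ⊗[k] (H ⊗[k] H) →ₗc[k] H ⊗[k] H :=
  Coalgebra.TensorProduct.map (CoalgHom.id k H) (Bialgebra.mulCoalgHom k H)

/-- `a ⊗ b ⊗ c ↦ (a ⊗ b) ε(c)` -/
def proj12 : H ⊗[k] (H ⊗[k] H) →ₗc[k] H ⊗[k] H :=
  Coalgebra.TensorProduct.map (CoalgHom.id k H) (fst k H)

/-- `a ⊗ b ⊗ c ↦ ε(a) (b ⊗ c)` -/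
def proj23 : H ⊗[k] (H ⊗[k] H) →ₗc[k] H ⊗[k] H :=
  (Coalgebra.TensorProduct.lid k (H ⊗[k] H)).toCoalgHom.comp
    (Coalgebra.TensorProduct.map (Coalgebra.counitCoalgHom k H) (CoalgHom.id k (H ⊗[k] H)))

@[simp] lemma fst_tmul (a b : H) : fst k H (a ⊗ₜ b) = counit (R := k) b • a := rfl
@[simp] lemma snd_tmul (a b : H) : snd k H (a ⊗ₜ b) = counit (R := k) a • b := rfl
@[simp] lemma swap_tmul (a b : H) : swap k H (a ⊗ₜ b) = b ⊗ₜ a := rfl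
@[simp] lemma mul12_tmul (a b c : H) : mul12 k H (a ⊗ₜ (b ⊗ₜ c)) = (a * b) ⊗ₜ c := rfl
@[simp] lemma mul23_tmul (a b c : H) : mul23 k H (a ⊗ₜ (b ⊗ₜ c)) = a ⊗ₜ (b * c) := rfl
@[simp] lemma proj12_tmul (a b c : H) :
    proj12 k H (a ⊗ₜ (b ⊗ₜ c)) = a ⊗ₜ (counit (R := k) c • b) := rfl
@[simp] lemma proj23_tmul (a b c : H) :
    proj23 k H (a ⊗ₜ (b ⊗ₜ c)) = counit (R := k) a • (b ⊗ₜ c) := rfl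

end Maps

/-! ### Invariant Hopf 2-cocycles with values in a commutative algebra `R`

Taking `R = k` gives Hopf `2`-cocycles for `H`; for general `R` these are the Hopf `2`-cocycles of
the `R`-Hopf algebra `R ⊗ H`, i.e. the `R`-points of the corresponding group schemes. -/

section Cocycles

variable {k : Type u} [Field k] {H : Type v} [CommRing H] [HopfAlgebra k H]
variable {R : Type w} [CommRing R] [Algebra k R]

/-- `x ∘ m`, i.e. `a ⊗ b ↦ x(ab)`. -/
abbrev copr : Conv k H R →+* Conv k (H ⊗[k] H) R := pre R (Bialgebra.mulCoalgHom k H)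

/-- `x ⊗ y`, i.e. `a ⊗ b ↦ x(a) y(b)`. -/
abbrev tens (x y : Conv k H R) : Conv k (H ⊗[k] H) R := pre R (fst k H) x * pre R (snd k H) y

/-- `J` is a Hopf `2`-cocycle:
`∑ J(a₁b₁, c) J(a₂, b₂) = ∑ J(a, b₁c₁) J(b₂, c₂)` and `J(a, 1) = ε(a) = J(1, a)`. -/
structure IsHopfCocycle (J : Conv k (H ⊗[k] H) R) : Prop where
  isUnit : IsUnit J
  cocycle : pre R (mul12 k H) J * pre R (proj12 k H) J =
    pre R (mul23 k H) J * pre R (proj23 k H) J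
  right_one : ∀ a : H, J (a ⊗ₜ 1) = algebraMap k R (counit a)
  one_left : ∀ a : H, J (1 ⊗ₜ a) = algebraMap k R (counit a)

variable (k H R) in
/-- The multiplication of `H`, as an element of the convolution algebra
`Hom_k(H ⊗ H, R ⊗ H)`. -/
def mulR : Conv k (H ⊗[k] H) (R ⊗[k] H) :=
  toConv ((Algebra.TensorProduct.includeRight : H →ₐ[k] R ⊗[k] H).toLinearMap ∘ₗ
    LinearMap.mul' k H)

/-- `J` viewed in the convolution algebra `Hom_k(H ⊗ H, R ⊗ H)`. -/
abbrev toR (J : Conv k (H ⊗[k] H) R) : Conv k (H ⊗[k] H) (R ⊗[k] H) :=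
  post _ (Algebra.TensorProduct.includeLeft : R →ₐ[k] R ⊗[k] H) J

/-- `J` is invariant (lazy): `J * m = m * J`. -/
def IsInvariant (J : Conv k (H ⊗[k] H) R) : Prop := toR J * mulR k H R = mulR k H R * toR J

/-- `r ⊗ h ↦ r * y(h)` -/
def evalR (y : Conv k H R) : R ⊗[k] H →ₗ[k] R :=
  TensorProduct.lift ((LinearMap.mul k R).compl₂ y.ofConv)

lemma evalR_mul_left (y : Conv k H R) (r : R) (t : R ⊗[k] H) :
    evalR y ((r ⊗ₜ 1) * t) = r * evalR y t := by
  induction t with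
  | zero => simp
  | add a b ha hb => simp [mul_add, ha, hb]
  | tmul s h => simp [evalR, mul_assoc]

lemma evalR_mul_right (y : Conv k H R) (r : R) (t : R ⊗[k] H) :
    evalR y (t * (r ⊗ₜ 1)) = evalR y t * r := by
  rw [mul_comm, evalR_mul_left, mul_comm]

/-- An invariant `J` commutes with every `y ∘ m`. -/
lemma IsInvariant.commute_copr {J : Conv k (H ⊗[k] H) R} (hJ : IsInvariant J) (y : Conv k H R) :
    Commute J (copr y) := by
  apply WithConv.ext
  apply LinearMap.ext
  intro t
  have h := congrArg (fun f : Conv k (H ⊗[k] H) (R ⊗[k] H) => evalR y (f t)) hJ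
  simp only [(ℛ k t).convMul_apply, map_sum] at h
  change (J * copr y) t = (copr y * J) t
  simp only [(ℛ k t).convMul_apply]
  simp only [post_apply, Algebra.TensorProduct.includeLeft_apply, evalR_mul_left,
    evalR_mul_right] at h
  simpa [mulR, evalR] using h

lemma IsInvariant.inv {J : (Conv k (H ⊗[k] H) R)ˣ} (hJ : IsInvariant J.1) :
    IsInvariant (J⁻¹).1 := by
  have h : Commute (postU (k := k) (H ⊗[k] H)
    (Algebra.TensorProduct.includeLeft : R →ₐ[k] R ⊗[k] H) J).1 (mulR k H R) := hJ
  exact h.units_inv_left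

lemma sum_smul_counit (a : H) :
    ∑ i ∈ (ℛ k a).index, counit (R := k) ((ℛ k a).right i) • (ℛ k a).left i = a := by
  simpa only [map_sum, TensorProduct.rid_tmul, one_smul] using
    congr(TensorProduct.rid k H $(sum_tmul_counit_eq (R := k) (ℛ k a)))

lemma tens_tmul (x y : Conv k H R) (a b : H) : (tens x y) (a ⊗ₜ b) = x a * y b := by
  conv_rhs => rw [← sum_smul_counit (k := k) a, ← sum_counit_smul (ℛ k b)]
  simp only [((ℛ k a).tmul (ℛ k b)).convMul_apply]
  rw [map_sum, map_sum, Finset.sum_mul_sum, ← Finset.sum_product']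
  refine Finset.sum_congr rfl fun i _ => ?_
  simp [smul_smul, mul_comm]

lemma tens_tmul' (x y : Conv k H R) (a b : H) :
    (pre R (snd k H) y * pre R (fst k H) x) (a ⊗ₜ b) = x a * y b := by
  conv_rhs => rw [← sum_counit_smul (ℛ k a), ← sum_smul_counit (k := k) b]
  simp only [((ℛ k a).tmul (ℛ k b)).convMul_apply]
  rw [map_sum, map_sum, Finset.sum_mul_sum, ← Finset.sum_product']
  refine Finset.sum_congr rfl fun i _ => ?_
  simp [smul_smul, mul_comm]

lemma commute_fst_snd (x y : Conv k H R) :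
    Commute (pre R (fst k H) x) (pre R (snd k H) y) := by
  apply WithConv.ext
  apply TensorProduct.ext'
  intro a b
  exact (tens_tmul x y a b).trans (tens_tmul' x y a b).symm

lemma pre_fst_mul_apply (x : Conv k H R) (J : Conv k (H ⊗[k] H) R) (a b : H) :
    (pre R (fst k H) x * J) (a ⊗ₜ b) =
      (x * toConv (J.ofConv ∘ₗ (TensorProduct.mk k H H).flip b)) a := by
  rw [(ℛ k a).convMul_apply]
  simp only [((ℛ k a).tmul (ℛ k b)).convMul_apply, Coalgebra.Repr.tmul_index,
    Finset.sum_product]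
  refine Finset.sum_congr rfl fun i _ => ?_
  conv_rhs => rw [← sum_counit_smul (ℛ k b)]
  simp [Finset.mul_sum]

lemma mul_pre_fst_apply (x : Conv k H R) (J : Conv k (H ⊗[k] H) R) (a b : H) :
    (J * pre R (fst k H) x) (a ⊗ₜ b) =
      (toConv (J.ofConv ∘ₗ (TensorProduct.mk k H H).flip b) * x) a := by
  rw [(ℛ k a).convMul_apply]
  simp only [((ℛ k a).tmul (ℛ k b)).convMul_apply, Coalgebra.Repr.tmul_index,
    Finset.sum_product]
  refine Finset.sum_congr rfl fun i _ => ?_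
  conv_rhs => rw [← sum_smul_counit (k := k) b]
  simp [Finset.sum_mul]

lemma pre_snd_mul_apply (x : Conv k H R) (J : Conv k (H ⊗[k] H) R) (a b : H) :
    (pre R (snd k H) x * J) (a ⊗ₜ b) =
      (x * toConv (J.ofConv ∘ₗ TensorProduct.mk k H H a)) b := by
  rw [(ℛ k b).convMul_apply]
  simp only [((ℛ k a).tmul (ℛ k b)).convMul_apply, Coalgebra.Repr.tmul_index,
    Finset.sum_product_right]
  refine Finset.sum_congr rfl fun i _ => ?_
  conv_rhs => rw [← sum_counit_smul (ℛ k a)]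
  simp [Finset.mul_sum]

lemma mul_pre_snd_apply (x : Conv k H R) (J : Conv k (H ⊗[k] H) R) (a b : H) :
    (J * pre R (snd k H) x) (a ⊗ₜ b) =
      (toConv (J.ofConv ∘ₗ TensorProduct.mk k H H a) * x) b := by
  rw [(ℛ k b).convMul_apply]
  simp only [((ℛ k a).tmul (ℛ k b)).convMul_apply, Coalgebra.Repr.tmul_index,
    Finset.sum_product_right]
  refine Finset.sum_congr rfl fun i _ => ?_
  conv_rhs => rw [← sum_smul_counit (k := k) a]
  simp [Finset.sum_mul]

lemma central_commute_fst {x : Conv k H R} (hx : ∀ y, Commute x y) (J : Conv k (H ⊗[k] H) R) :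
    Commute (pre R (fst k H) x) J := by
  apply WithConv.ext
  apply TensorProduct.ext'
  intro a b
  refine (pre_fst_mul_apply x J a b).trans (Eq.trans ?_ (mul_pre_fst_apply x J a b).symm)
  rw [(hx _).eq]

lemma central_commute_snd {x : Conv k H R} (hx : ∀ y, Commute x y) (J : Conv k (H ⊗[k] H) R) :
    Commute (pre R (snd k H) x) J := by
  apply WithConv.ext
  apply TensorProduct.ext'
  intro a b
  refine (pre_snd_mul_apply x J a b).trans (Eq.trans ?_ (mul_pre_snd_apply x J a b).symm)
  rw [(hx _).eq]

/-- A central element of `Hom_k(H, R)` commutes with the identity of `H`. -/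
lemma central_commute_id {x : Conv k H R} (hx : ∀ y, Commute x y) :
    post H (Algebra.TensorProduct.includeLeft : R →ₐ[k] R ⊗[k] H) x *
        toConv (Algebra.TensorProduct.includeRight : H →ₐ[k] R ⊗[k] H).toLinearMap =
      toConv (Algebra.TensorProduct.includeRight : H →ₐ[k] R ⊗[k] H).toLinearMap *
        post H (Algebra.TensorProduct.includeLeft : R →ₐ[k] R ⊗[k] H) x := by
  apply WithConv.ext
  apply LinearMap.ext
  intro a
  let b := Module.Free.chooseBasis k H
  apply (b.baseChange R).ext_elem
  intro i
  let y : Conv k H R := toConv (Algebra.linearMap k R ∘ₗ b.coord i)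
  have key : ∀ t : R ⊗[k] H, (b.baseChange R).repr t i = evalR y t := by
    intro t
    induction t with
    | zero => simp
    | add s t hs ht => simp [hs, ht]
    | tmul r h => simp [evalR, y, Algebra.smul_def, mul_comm]
  rw [key, key]
  have h := congrArg (fun f : Conv k H R => f a) (hx y).eq
  simp only [(ℛ k a).convMul_apply] at h ⊢
  simp only [map_sum]
  simpa [evalR, post, mul_comm] using h

/-- Centrality is preserved by change of the coefficient algebra. -/
lemma central_post {S : Type w'} [CommRing S] [Algebra k S] (f : R →ₐ[k] S) {x : Conv k H R}
    (hx : ∀ y, Commute x y) (y : Conv k H S) : Commute (post H f x) y := by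
  let F : R ⊗[k] H →ₗ[k] S := TensorProduct.lift ((LinearMap.mul k S).compl₁₂ f.toLinearMap y.ofConv)
  apply WithConv.ext
  apply LinearMap.ext
  intro a
  have h := congrArg (fun g : Conv k H (R ⊗[k] H) => F (g a)) (central_commute_id hx)
  simp only [(ℛ k a).convMul_apply, map_sum] at h
  change (post H f x * y) a = (y * post H f x) a
  simp only [(ℛ k a).convMul_apply]
  simpa [F, post, mul_comm] using h

lemma isHopfCocycle_one : IsHopfCocycle (1 : Conv k (H ⊗[k] H) R) where
  isUnit := isUnit_one
  cocycle := by simp only [map_one]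
  right_one a := by simp
  one_left a := by simp

lemma proj12_commute {J : Conv k (H ⊗[k] H) R} (hJ : IsInvariant J) (F : Conv k (H ⊗[k] H) R) :
    Commute (pre R (proj12 k H) J) (pre R (mul12 k H) F) := by
  have key : ∀ a b c : H, (pre R (proj12 k H) J * pre R (mul12 k H) F) (a ⊗ₜ (b ⊗ₜ c)) =
      (J * copr (toConv (F.ofConv ∘ₗ (TensorProduct.mk k H H).flip c))) (a ⊗ₜ b) := by
    intro a b c
    simp only [((ℛ k a).tmul ((ℛ k b).tmul (ℛ k c))).convMul_apply,
      ((ℛ k a).tmul (ℛ k b)).convMul_apply, Coalgebra.Repr.tmul_index, Finset.sum_product]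
    refine Finset.sum_congr rfl fun i _ => Finset.sum_congr rfl fun j _ => ?_
    conv_rhs => rw [← sum_counit_smul (ℛ k c)]
    simp [Finset.mul_sum]
  have key' : ∀ a b c : H, (pre R (mul12 k H) F * pre R (proj12 k H) J) (a ⊗ₜ (b ⊗ₜ c)) =
      (copr (toConv (F.ofConv ∘ₗ (TensorProduct.mk k H H).flip c)) * J) (a ⊗ₜ b) := by
    intro a b c
    simp only [((ℛ k a).tmul ((ℛ k b).tmul (ℛ k c))).convMul_apply,
      ((ℛ k a).tmul (ℛ k b)).convMul_apply, Coalgebra.Repr.tmul_index, Finset.sum_product]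
    refine Finset.sum_congr rfl fun i _ => Finset.sum_congr rfl fun j _ => ?_
    conv_rhs => rw [← sum_smul_counit (k := k) c]
    simp [Finset.sum_mul]
  apply WithConv.ext
  apply TensorProduct.ext_threefold'
  intro a b c
  refine (key a b c).trans (Eq.trans ?_ (key' a b c).symm)
  rw [(hJ.commute_copr _).eq]

lemma proj23_commute {J : Conv k (H ⊗[k] H) R} (hJ : IsInvariant J) (F : Conv k (H ⊗[k] H) R) :
    Commute (pre R (proj23 k H) J) (pre R (mul23 k H) F) := by
  have key : ∀ a b c : H, (pre R (proj23 k H) J * pre R (mul23 k H) F) (a ⊗ₜ (b ⊗ₜ c)) =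
      (J * copr (toConv (F.ofConv ∘ₗ TensorProduct.mk k H H a))) (b ⊗ₜ c) := by
    intro a b c
    simp only [((ℛ k a).tmul ((ℛ k b).tmul (ℛ k c))).convMul_apply,
      ((ℛ k b).tmul (ℛ k c)).convMul_apply, Coalgebra.Repr.tmul_index, Finset.sum_product_right]
    refine Finset.sum_congr rfl fun i _ => Finset.sum_congr rfl fun j _ => ?_
    conv_rhs => rw [← sum_counit_smul (ℛ k a)]
    simp [Finset.mul_sum]
  have key' : ∀ a b c : H, (pre R (mul23 k H) F * pre R (proj23 k H) J) (a ⊗ₜ (b ⊗ₜ c)) =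
      (copr (toConv (F.ofConv ∘ₗ TensorProduct.mk k H H a)) * J) (b ⊗ₜ c) := by
    intro a b c
    simp only [((ℛ k a).tmul ((ℛ k b).tmul (ℛ k c))).convMul_apply,
      ((ℛ k b).tmul (ℛ k c)).convMul_apply, Coalgebra.Repr.tmul_index, Finset.sum_product_right]
    refine Finset.sum_congr rfl fun i _ => Finset.sum_congr rfl fun j _ => ?_
    conv_rhs => rw [← sum_smul_counit (k := k) a]
    simp [Finset.sum_mul]
  apply WithConv.ext
  apply TensorProduct.ext_threefold'
  intro a b c
  refine (key a b c).trans (Eq.trans ?_ (key' a b c).symm)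
  rw [(hJ.commute_copr _).eq]

lemma conv_mul_tmul_one {J F : Conv k (H ⊗[k] H) R} (a : H) :
    (J * F) (a ⊗ₜ 1) = (toConv (J.ofConv ∘ₗ (TensorProduct.mk k H H).flip 1) *
      toConv (F.ofConv ∘ₗ (TensorProduct.mk k H H).flip 1)) a := by
  simp only [(ℛ k a).convMul_apply]
  rw [LinearMap.convMul_apply, TensorProduct.comul_tmul, Bialgebra.comul_one, ← (ℛ k a).eq]
  simp [TensorProduct.sum_tmul, Algebra.TensorProduct.one_def]

lemma conv_mul_one_tmul {J F : Conv k (H ⊗[k] H) R} (a : H) :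
    (J * F) (1 ⊗ₜ a) = (toConv (J.ofConv ∘ₗ TensorProduct.mk k H H 1) *
      toConv (F.ofConv ∘ₗ TensorProduct.mk k H H 1)) a := by
  simp only [(ℛ k a).convMul_apply]
  rw [LinearMap.convMul_apply, TensorProduct.comul_tmul, Bialgebra.comul_one, ← (ℛ k a).eq]
  simp [TensorProduct.tmul_sum, Algebra.TensorProduct.one_def]

lemma IsHopfCocycle.right_one' {J : Conv k (H ⊗[k] H) R} (h : IsHopfCocycle J) :
    (toConv (J.ofConv ∘ₗ (TensorProduct.mk k H H).flip 1) : Conv k H R) = 1 := by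
  apply WithConv.ext; ext a; exact h.right_one a

lemma IsHopfCocycle.one_left' {J : Conv k (H ⊗[k] H) R} (h : IsHopfCocycle J) :
    (toConv (J.ofConv ∘ₗ TensorProduct.mk k H H 1) : Conv k H R) = 1 := by
  apply WithConv.ext; ext a; exact h.one_left a

lemma IsHopfCocycle.mul {J F : Conv k (H ⊗[k] H) R} (hJ : IsHopfCocycle J) (hJ' : IsInvariant J)
    (hF : IsHopfCocycle F) : IsHopfCocycle (J * F) where
  isUnit := hJ.isUnit.mul hF.isUnit
  cocycle := by
    simp only [map_mul]
    calc _ = pre R (mul12 k H) J * (pre R (mul12 k H) F * pre R (proj12 k H) J) *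
          pre R (proj12 k H) F := by simp only [mul_assoc]
      _ = (pre R (mul12 k H) J * pre R (proj12 k H) J) *
          (pre R (mul12 k H) F * pre R (proj12 k H) F) := by
        rw [← (proj12_commute hJ' F).eq]; simp only [mul_assoc]
      _ = pre R (mul23 k H) J * (pre R (proj23 k H) J * pre R (mul23 k H) F) *
          pre R (proj23 k H) F := by rw [hJ.cocycle, hF.cocycle]; simp only [mul_assoc]
      _ = _ := by rw [(proj23_commute hJ' F).eq]; simp only [mul_assoc]
  right_one a := by
    rw [conv_mul_tmul_one, hJ.right_one', hF.right_one', mul_one]; rfl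
  one_left a := by
    rw [conv_mul_one_tmul, hJ.one_left', hF.one_left', mul_one]; rfl

lemma IsHopfCocycle.inv {J : (Conv k (H ⊗[k] H) R)ˣ} (hJ : IsHopfCocycle J.1)
    (hJ' : IsInvariant J.1) : IsHopfCocycle (J⁻¹).1 where
  isUnit := (J⁻¹).isUnit
  cocycle := by
    have h := hJ.cocycle
    rw [← (proj12_commute hJ' J.1).eq, ← (proj23_commute hJ' J.1).eq] at h
    have h' : preU R (proj12 k H) J * preU R (mul12 k H) J =
        preU R (proj23 k H) J * preU R (mul23 k H) J := Units.ext h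
    have h'' : preU R (mul12 k H) J⁻¹ * preU R (proj12 k H) J⁻¹ =
        preU R (mul23 k H) J⁻¹ * preU R (proj23 k H) J⁻¹ := by
      rw [map_inv, map_inv, map_inv, map_inv, ← mul_inv_rev, ← mul_inv_rev, h']
    exact congrArg Units.val h''
  right_one a := by
    have h : (1 : Conv k H R) = _ := (hJ.right_one').symm
    have h2 : (toConv ((J⁻¹).1.ofConv ∘ₗ (TensorProduct.mk k H H).flip 1) : Conv k H R) = 1 := by
      rw [← one_mul (toConv _ : Conv k H R), h]
      apply WithConv.ext; ext a
      refine (conv_mul_tmul_one (J := J.1) (F := (J⁻¹).1) a).symm.trans ?_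
      rw [Units.mul_inv, ← h]; simp
    exact congrArg (fun f : Conv k H R => f a) h2
  one_left a := by
    have h : (1 : Conv k H R) = _ := (hJ.one_left').symm
    have h2 : (toConv ((J⁻¹).1.ofConv ∘ₗ TensorProduct.mk k H H 1) : Conv k H R) = 1 := by
      rw [← one_mul (toConv _ : Conv k H R), h]
      apply WithConv.ext; ext a
      refine (conv_mul_one_tmul (J := J.1) (F := (J⁻¹).1) a).symm.trans ?_
      rw [Units.mul_inv, ← h]; simp
    exact congrArg (fun f : Conv k H R => f a) h2

lemma IsInvariant.mul {J F : Conv k (H ⊗[k] H) R} (hJ : IsInvariant J) (hF : IsInvariant F) :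
    IsInvariant (J * F) := by
  have h : Commute (toR J * toR F) (mulR k H R) := Commute.mul_left hJ hF
  rw [IsInvariant, toR, map_mul]
  exact h

lemma isInvariant_one : IsInvariant (1 : Conv k (H ⊗[k] H) R) := by
  rw [IsInvariant, toR, map_one, one_mul, mul_one]

variable (k H R) in
/-- The group of (`R`-valued) invariant Hopf `2`-cocycles. -/
def Z2inv : Subgroup (Conv k (H ⊗[k] H) R)ˣ where
  carrier := {J | IsHopfCocycle J.1 ∧ IsInvariant J.1}
  mul_mem' hJ hF := ⟨hJ.1.mul hJ.2 hF.1, hJ.2.mul hF.2⟩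
  one_mem' := ⟨isHopfCocycle_one, isInvariant_one⟩
  inv_mem' hJ := ⟨hJ.1.inv hJ.2, hJ.2.inv⟩

/-- The gauge transform `J^x = (x ∘ m) * J * (x⁻¹ ⊗ x⁻¹)`. -/
def gauge (x : (Conv k H R)ˣ) (J : Conv k (H ⊗[k] H) R) : Conv k (H ⊗[k] H) R :=
  copr x.1 * J * tens (x⁻¹).1 (x⁻¹).1

/-- The coboundary `∂(x) = (x ∘ m) * (x⁻¹ ⊗ x⁻¹)`. -/
def coboundary (x : (Conv k H R)ˣ) : Conv k (H ⊗[k] H) R :=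
  copr x.1 * tens (x⁻¹).1 (x⁻¹).1

lemma coboundary_one : coboundary (1 : (Conv k H R)ˣ) = 1 := by
  simp [coboundary, tens]

lemma coboundary_mul {x y : (Conv k H R)ˣ} (hx : ∀ z, Commute x.1 z) :
    coboundary (x * y) = coboundary x * coboundary y := by
  have hx' : ∀ z, Commute (x⁻¹).1 z := fun z => (hx z).units_inv_left
  have h1 := central_commute_fst hx'
  have h2 := central_commute_snd hx'
  simp only [coboundary, tens, mul_inv_rev, Units.val_mul, map_mul]
  set X := copr x.1
  set Y := copr y.1
  set a := pre R (fst k H) (x⁻¹).1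
  set b := pre R (snd k H) (x⁻¹).1
  set c := pre R (fst k H) (y⁻¹).1
  set d := pre R (snd k H) (y⁻¹).1
  calc X * Y * (c * a * (d * b)) = X * Y * (c * (a * (d * b))) := by simp only [mul_assoc]
    _ = X * Y * (c * (d * b) * a) := by rw [(h1 (d * b)).eq]; simp only [mul_assoc]
    _ = X * ((Y * (c * d)) * (b * a)) := by simp only [mul_assoc]
    _ = X * ((b * a) * (Y * (c * d))) := by rw [((h2 _).mul_left (h1 _)).eq]
    _ = X * (b * a) * (Y * (c * d)) := by simp only [mul_assoc]
    _ = _ := by rw [← (h1 b).eq]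

lemma coboundary_commute {x : (Conv k H R)ˣ} (hx : ∀ z, Commute x.1 z)
    {J : Conv k (H ⊗[k] H) R} (hJ : IsInvariant J) : Commute (coboundary x) J := by
  have hx' : ∀ z, Commute (x⁻¹).1 z := fun z => (hx z).units_inv_left
  exact ((hJ.commute_copr _).symm).mul_left
    ((central_commute_fst hx' J).mul_left (central_commute_snd hx' J))

variable (k H R) in
/-- The subgroup of `Z2inv` of all invariant Hopf `2`-cocycles of the form `∂(x)`, where `x` is
invertible and central in the convolution algebra. -/
def B2inv : Subgroup (Z2inv k H R) where
  carrier := {J | ∃ x : (Conv k H R)ˣ, (∀ y, Commute x.1 y) ∧ J.1.1 = coboundary x}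
  mul_mem' := by
    rintro _ _ ⟨x, hx, h⟩ ⟨y, hy, h'⟩
    exact ⟨x * y, fun z => (hx z).mul_left (hy z), by
      rw [coboundary_mul hx, ← h, ← h']; rfl⟩
  one_mem' := ⟨1, fun z => Commute.one_left z, coboundary_one.symm⟩
  inv_mem' := by
    rintro J ⟨x, hx, h⟩
    refine ⟨x⁻¹, fun z => (hx z).units_inv_left, ?_⟩
    change (J.1⁻¹).1 = _
    rw [Units.inv_eq_of_mul_eq_one_right]
    rw [h, ← coboundary_mul hx, mul_inv_cancel, coboundary_one]

instance : (B2inv k H R).Normal where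
  conj_mem := by
    rintro J ⟨x, hx, h⟩ g
    refine ⟨x, hx, ?_⟩
    change g.1.1 * J.1.1 * (g.1⁻¹).1 = _
    rw [h, ← (coboundary_commute hx g.2.2).eq, mul_assoc, Units.mul_inv, mul_one]

variable (k H R) in
/-- The second invariant (lazy) cohomology group, with coefficients in `R`. The functor
`R ↦ H2inv k H R` is the second invariant cohomology as a group functor on commutative
`k`-algebras; its group of `k`-points is `H2inv k H k`. -/
abbrev H2inv : Type _ := Z2inv k H R ⧸ B2inv k H R

/-- The class of an invariant Hopf `2`-cocycle. -/
abbrev cls (J : Z2inv k H R) : H2inv k H R := QuotientGroup.mk J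

section Functoriality

variable {S : Type w'} [CommRing S] [Algebra k S] (f : R →ₐ[k] S)

lemma IsHopfCocycle.post {J : Conv k (H ⊗[k] H) R} (hJ : IsHopfCocycle J) :
    IsHopfCocycle (InvCoh.post (H ⊗[k] H) f J) where
  isUnit := hJ.isUnit.map _
  cocycle := by
    have h := congrArg (InvCoh.post (H ⊗[k] (H ⊗[k] H)) f) hJ.cocycle
    rw [map_mul, map_mul] at h
    exact h
  right_one a := by rw [post_apply, hJ.right_one]; simp
  one_left a := by rw [post_apply, hJ.one_left]; simp

lemma IsInvariant.post {J : Conv k (H ⊗[k] H) R} (hJ : IsInvariant J) :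
    IsInvariant (InvCoh.post (H ⊗[k] H) f J) := by
  have h := congrArg (InvCoh.post (H ⊗[k] H)
    (Algebra.TensorProduct.map f (AlgHom.id k H))) hJ
  rw [map_mul, map_mul] at h
  have h1 : InvCoh.post (H ⊗[k] H) (Algebra.TensorProduct.map f (AlgHom.id k H)) (toR J) =
      toR (InvCoh.post (H ⊗[k] H) f J) := by
    apply WithConv.ext; apply LinearMap.ext; intro t
    simp
  have h2 : InvCoh.post (H ⊗[k] H) (Algebra.TensorProduct.map f (AlgHom.id k H)) (mulR k H R) =
      mulR k H S := by
    apply WithConv.ext; apply LinearMap.ext; intro t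
    simp [mulR]
  rw [h1, h2] at h
  exact h

/-- Functoriality of `Z2inv` in the coefficient algebra. -/
def Z2inv.map : Z2inv k H R →* Z2inv k H S :=
  ((postU (H ⊗[k] H) f).comp (Z2inv k H R).subtype).codRestrict
    (Z2inv k H S) fun J => ⟨J.2.1.post f, J.2.2.post f⟩

lemma post_coboundary (x : (Conv k H R)ˣ) :
    post (H ⊗[k] H) f (coboundary x) =
      coboundary (postU H f x) := by
  simp only [coboundary, tens, map_mul]
  rfl

/-- Functoriality of `H2inv` in the coefficient algebra. -/
def H2inv.map : H2inv k H R →* H2inv k H S :=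
  QuotientGroup.map _ _ (Z2inv.map f) (by
    rintro J ⟨x, hx, h⟩
    refine ⟨postU H f x, central_post f hx, ?_⟩
    rw [← post_coboundary, ← h]
    rfl)

end Functoriality

end Cocycles

/-! ### The Lie algebra and invariant bivectors -/

section Lie

variable (k : Type u) [Field k] (H : Type v) [CommRing H] [HopfAlgebra k H]

variable {k H} in
lemma leibniz_iff (d : Conv k H k) :
    (∀ a b : H, d (a * b) = counit (R := k) a * d b + d a * counit (R := k) b) ↔
      copr d = pre k (fst k H) d + pre k (snd k H) d := by
  constructor
  · intro h
    apply WithConv.ext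
    apply TensorProduct.ext'
    intro a b
    change d (a * b) = d (counit (R := k) b • a) + d (counit (R := k) a • b)
    rw [h, map_smul, map_smul, smul_eq_mul, smul_eq_mul]
    ring
  · intro h a b
    have h' := congrArg (fun f : Conv k (H ⊗[k] H) k => f (a ⊗ₜ b)) h
    change d (a * b) = d (counit (R := k) b • a) + d (counit (R := k) a • b) at h'
    rw [h', map_smul, map_smul, smul_eq_mul, smul_eq_mul]
    ring

/-- The commutator bracket of the convolution algebra `H^*`. -/
instance : LieRing (Conv k H k) := LieRing.ofAssociativeRing

instance : LieAlgebra k (Conv k H k) := LieAlgebra.ofAssociativeAlgebra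

/-- The Lie algebra of the affine group scheme with coordinate algebra `H`: the point derivations
at the identity, with the commutator bracket of the convolution algebra `H^*`. -/
def lieAlg : LieSubalgebra k (Conv k H k) where
  carrier := {d | ∀ a b : H, d (a * b) = counit (R := k) a * d b + d a * counit (R := k) b}
  zero_mem' a b := by simp
  add_mem' {d d'} hd hd' := by
    rw [Set.mem_ofPred_eq, leibniz_iff] at *
    rw [map_add, map_add, map_add, hd, hd']; abel
  smul_mem' c d hd a b := by
    have := hd a b
    simp only [WithConv.ofConv_smul, LinearMap.smul_apply, smul_eq_mul, this]
    ring
  lie_mem' {d d'} hd hd' := by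
    change ∀ a b : H, (⁅d, d'⁆ : Conv k H k) (a * b) = counit (R := k) a * (⁅d, d'⁆ : Conv k H k) b
      + (⁅d, d'⁆ : Conv k H k) a * counit (R := k) b
    replace hd := (leibniz_iff d).1 hd
    replace hd' := (leibniz_iff d').1 hd'
    rw [leibniz_iff, Ring.lie_def, map_sub, map_sub, map_sub, map_mul, map_mul, hd, hd',
      map_mul, map_mul, map_mul, map_mul, mul_add, mul_add, add_mul, add_mul, add_mul, add_mul,
      (commute_fst_snd d d').eq, (commute_fst_snd d' d).eq]
    abel

/-- `(∧²𝔲)^𝔲`: the skew-symmetric tensors in `𝔲 ⊗ 𝔲` that are killed by the (diagonal) adjoint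
action of `𝔲`. Here `x ∧ y` is the tensor `x ⊗ y - y ⊗ x`. -/
def wedgeInv : Submodule k (lieAlg k H ⊗[k] lieAlg k H) :=
  LinearMap.ker ((TensorProduct.comm k (lieAlg k H) (lieAlg k H)).toLinearMap + LinearMap.id) ⊓
    (LieModule.maxTrivSubmodule k (lieAlg k H) (lieAlg k H ⊗[k] lieAlg k H)).toSubmodule

/-- A tensor in `𝔲 ⊗ 𝔲` viewed in `(H ⊗ H)^*`: `x ⊗ y` is `a ⊗ b ↦ x(a) y(b)`. -/
def toDual : lieAlg k H ⊗[k] lieAlg k H →ₗ[k] Conv k (H ⊗[k] H) k :=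
  (WithConv.linearEquiv k (H ⊗[k] H →ₗ[k] k)).symm.toLinearMap ∘ₗ
    TensorProduct.dualDistrib k H H ∘ₗ
      TensorProduct.map
        ((WithConv.linearEquiv k (H →ₗ[k] k)).toLinearMap ∘ₗ (lieAlg k H).toSubmodule.subtype)
        ((WithConv.linearEquiv k (H →ₗ[k] k)).toLinearMap ∘ₗ (lieAlg k H).toSubmodule.subtype)

/-- The `R`-points version of `toDual` on `(∧²𝔲)^𝔲`: the map
`R ⊗ (∧²𝔲)^𝔲 → Hom_k(H ⊗ H, R)`. -/
def toDualR (R : Type w) [CommRing R] [Algebra k R] :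
    R ⊗[k] wedgeInv k H →ₗ[k] Conv k (H ⊗[k] H) R :=
  TensorProduct.lift (LinearMap.mk₂ k
    (fun (c : R) (r : wedgeInv k H) => c • post (H ⊗[k] H) (Algebra.ofId k R) (toDual k H r.1))
    (fun c c' r => add_smul _ _ _)
    (fun a c r => by
      apply WithConv.ext; apply LinearMap.ext; intro t
      simp)
    (fun c r r' => by rw [Submodule.coe_add, map_add, map_add, smul_add])
    (fun a c r => by
      apply WithConv.ext; apply LinearMap.ext; intro t
      have h : toDual k H (a • r).1 = a • toDual k H r.1 := by
        rw [Submodule.coe_smul, map_smul]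
      change c * algebraMap k R ((toDual k H (a • r).1) t) =
        a • (c * algebraMap k R ((toDual k H r.1) t))
      rw [h, WithConv.ofConv_smul, LinearMap.smul_apply, smul_eq_mul, map_mul, Algebra.smul_def]
      ring))

/-- The affine group scheme with coordinate algebra `H` is unipotent: every nonzero
finite-dimensional representation has a nonzero fixed vector. A representation on `k^n` is given
by its matrix of coefficients `a`, with `Δ(a_{ij}) = ∑ a_{il} ⊗ a_{lj}` and `ε(a_{ij}) = δ_{ij}`. -/
def IsUnipotent : Prop :=
  ∀ (n : ℕ) (a : Matrix (Fin n) (Fin n) H), 0 < n →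
    (∀ i j, comul (R := k) (a i j) = ∑ l, a i l ⊗ₜ[k] a l j) →
    (∀ i j, counit (R := k) (a i j) = (1 : Matrix (Fin n) (Fin n) k) i j) →
    ∃ v : Fin n → k, v ≠ 0 ∧ ∀ i, ∑ j, v j • a i j = algebraMap k H (v i)

end Lie

/-! ### Cotriangular structures, supports, the set `𝓑(G)` and the map `Θ` -/

section Theta

variable {k : Type u} [Field k]

section General

variable {H : Type v} [CommRing H] [HopfAlgebra k H]

/-- `R` is a cotriangular structure on the commutative Hopf algebra `H`:
`R⁻¹ = R₂₁`, `R(h, gl) = ∑ R(h₁, g) R(h₂, l)`, `R(hg, l) = ∑ R(g, l₁) R(h, l₂)` and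
`∑ R(h₁, g₁) g₂ h₂ = ∑ h₁ g₁ R(h₂, g₂)`. -/
structure IsCotriangular (R : Conv k (H ⊗[k] H) k) : Prop where
  isUnit : IsUnit R
  mul_swap : R * pre k (swap k H) R = 1
  map_mul_right : ∀ h g l : H, R (h ⊗ₜ (g * l)) =
    (toConv (R.ofConv ∘ₗ (TensorProduct.mk k H H).flip g) *
      toConv (R.ofConv ∘ₗ (TensorProduct.mk k H H).flip l) : Conv k H k) h
  map_mul_left : ∀ h g l : H, R ((h * g) ⊗ₜ l) =
    (toConv (R.ofConv ∘ₗ TensorProduct.mk k H H g) *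
      toConv (R.ofConv ∘ₗ TensorProduct.mk k H H h) : Conv k H k) l
  comm : post (H ⊗[k] H) (Algebra.ofId k H) R *
      pre H (swap k H) (toConv (LinearMap.mul' k H)) =
    toConv (LinearMap.mul' k H) * post (H ⊗[k] H) (Algebra.ofId k H) R

/-- The form `R` has trivial right radical. -/
def IsNondegenerate (R : Conv k (H ⊗[k] H) k) : Prop :=
  ∀ a : H, (∀ b : H, R (b ⊗ₜ a) = 0) → a = 0

/-- The Drinfeld element `u(h) = ∑ R(S(h₂), h₁)`. -/
def drinfeld (R : Conv k (H ⊗[k] H) k) : Conv k H k :=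
  toConv (R.ofConv ∘ₗ TensorProduct.map (HopfAlgebra.antipode k) LinearMap.id ∘ₗ
    (TensorProduct.comm k H H).toLinearMap ∘ₗ comul)

/-- `R^J = J₂₁⁻¹ * J`. -/
def rMatrix (J : (Conv k (H ⊗[k] H) k)ˣ) : Conv k (H ⊗[k] H) k :=
  ((preU k (swap k H) J)⁻¹).1 * J.1

/-- The Hopf `2`-cocycle `J` is minimal, i.e. the cotriangular Hopf algebra `(H^J, R^J)` is
minimal, i.e. the form `R^J` is nondegenerate. -/
def IsMinimalCocycle (J : (Conv k (H ⊗[k] H) k)ˣ) : Prop :=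
  IsHopfCocycle J.1 ∧ IsNondegenerate (rMatrix J)

/-- A `k`-point `g` of the group, as a grouplike element of `H^*`. -/
def pt (g : H →ₐ[k] k) : Conv k H k := toConv g.toLinearMap

/-- The inverse of the `k`-point `g`. -/
def ptInv (g : H →ₐ[k] k) : Conv k H k := toConv (g.toLinearMap ∘ₗ HopfAlgebra.antipode k)

/-- `f ↦ (a ↦ f(g a g⁻¹))`, i.e. `f ↦ ∑ g(f₁) f₂ g⁻¹(f₃)`. -/
def conj (g : H →ₐ[k] k) : Conv k H H :=
  post H (Algebra.ofId k H) (pt g) * toConv LinearMap.id * post H (Algebra.ofId k H) (ptInv g)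

variable (k) in
/-- The closed subgroup cut out by the Hopf ideal `I` is normal. -/
def IsNormal (I : Ideal H) : Prop := ∀ (g : H →ₐ[k] k), ∀ f ∈ I, conj g f ∈ I

variable (I : Ideal H) [I.IsHopfIdeal k]

/-- The projection `O(G) → O(A)`, where `O(A) = O(G) / I`, applied to both tensor factors. -/
def quot2 : H ⊗[k] H →ₗc[k] (H ⧸ I) ⊗[k] (H ⧸ I) :=
  Coalgebra.TensorProduct.map (Bialgebra.Quotient.mkBialgHom (R := k) I).toCoalgHom
    (Bialgebra.Quotient.mkBialgHom (R := k) I).toCoalgHom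

/-- The lifting to `O(G)` of a form on `O(A)`. -/
abbrev lif : Conv k ((H ⧸ I) ⊗[k] (H ⧸ I)) k →+* Conv k (H ⊗[k] H) k := pre k (quot2 I)

/-- The closed subgroup `A` with ideal `I` is a support of `J`: there is a minimal Hopf
`2`-cocycle for `A` whose lifting to `G` is gauge equivalent to `J`. -/
def IsSupport (J : Conv k (H ⊗[k] H) k) : Prop :=
  ∃ L : (Conv k ((H ⧸ I) ⊗[k] (H ⧸ I)) k)ˣ, IsMinimalCocycle L ∧
    ∃ x : (Conv k H k)ˣ, J = gauge x (lif I L.1)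

end General

variable (k) (H : Type v) [CommRing H] [HopfAlgebra k H]

/-- The set `𝓑(G)` of pairs `(A, R)`, where `A` is a closed normal commutative subgroup of `G`
(given by its Hopf ideal `I`, so that `O(A) = H ⧸ I`), and `R` is a `G`-invariant minimal
cotriangular structure on `O(A)` with trivial Drinfeld element. -/
@[ext] structure BSet where
  I : Ideal H
  [isHopfIdeal : I.IsHopfIdeal k]
  R : Conv k ((H ⧸ I) ⊗[k] (H ⧸ I)) k
  normal : IsNormal k I
  comm : Coalgebra.IsCocomm k (H ⧸ I)
  cotriangular : IsCotriangular R
  minimal : IsNondegenerate R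
  drinfeld_eq : drinfeld R = 1
  invariant : ∀ g : H →ₐ[k] k,
    tens (pt g) (pt g) * lif I R * tens (ptInv g) (ptInv g) = lif I R

attribute [instance] BSet.isHopfIdeal

variable {k H} in
/-- `Θ` is the map `[J] ↦ (Supp(J), R^J)`, where `R^J` is viewed on `O(A) ⊗ O(A)` for
`A = Supp(J)`. Since the form on `O(A)` is nondegenerate, this determines `Θ`. -/
def IsTheta (Θ : H2inv k H k → BSet k H) : Prop :=
  ∀ J : Z2inv k H k, IsSupport (Θ (cls J)).I J.1.1 ∧
    lif (Θ (cls J)).I (Θ (cls J)).R = rMatrix J.1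

end Theta

end InvCoh

end

/-!
Let `𝔲` be the Lie algebra of the unipotent group `U` with coordinate algebra `H = O(U)`, in
characteristic `0`. By unipotency a form on `H` that vanishes at `1`, or on `H ⊗ H` that vanishes on
`1 ⊗ H`, is locally nilpotent for the convolution product (`locNil_of_apply_one`,
`locNil_of_one_tmul`), so that exponentials and logarithms of forms are finite sums on each element.

*The cohomology group.* The two factors on either side of the cocycle equation of an invariant
cocycle `J` commute. Hence `log J` is an invariant solution of the additive (Hochschild) cocycle
equation, and conversely (`isAddCocycle_clog`, `isHopfCocycle_cexp`). Such a solution is the sum of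
its skew-symmetric and its symmetric part. A skew-symmetric one is a biderivation at the identity,
that is, an element of `(∧²𝔲)^𝔲` (`exists_toDualR_eq`). A symmetric one, `σ`, defines a commutative
square-zero extension of `H`, which splits by means of the logarithm of the identity map of `H`, so
that `σ` is the additive coboundary of a linear form. As infinitesimal conjugations lift to the
extension, this form is central (`exists_central_of_symm`), and `exp σ` is the coboundary of an
invertible central form. So `r ↦ [exp(r/2)]` is surjective. It is a homomorphism by the
Baker-Campbell-Hausdorff formula for a central commutator (`cexp_mul_cexp_of_commutator`), since
the commutator of two skew-symmetric invariant cocycles is a symmetric one (`cls_expCocycle_add`).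
It is injective since coboundaries are symmetric, whereas interchanging the arguments inverts
`exp(r/2)`.

*The map `Θ`.* A cocycle in the class of `exp(r/2)` has the `R`-matrix `exp(r)` (`rMatrix_eq`).
Invariance and skew-symmetry force `r₁₂` and `r₁₃` to commute (`IsInvBivector.commute`), so that
`exp(r)` is a bicharacter. Its radical is then a Hopf ideal, which defines a commutative normal
subgroup `A`, the forms `exp(r)` and `exp(r/2)` descend to `A`, and `A` with the form `exp(r)` is an
element of `𝓑(U)` (`IsInvBivector.exists_bset`). Conversely, the logarithm of the form of an element
of `𝓑(U)` is an invariant bivector (`BSet.exists_bivector`). Since an element of `𝓑(U)` is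
determined by the lift of its form to `U` (`bset_ext`), this shows that `Θ` exists, is unique and is
bijective.
-/

set_option linter.unusedSectionVars false

noncomputable section

namespace InvCoh

/-! ### Locally finite sums and power series in convolution algebras -/

section Sums

variable {k : Type u} [Field k]
variable {C : Type v} [AddCommGroup C] [Module k C] [Coalgebra k C]
variable {D : Type v} [AddCommGroup D] [Module k D] [Coalgebra k D]
variable {A : Type w} [Ring A] [Algebra k A]
variable {B : Type w'} [Ring B] [Algebra k B]

/-- The series `∑ aᵢ` is a finite sum on each element of the coalgebra, with value `s`. -/
def SumsTo (a : ℕ → Conv k C A) (s : Conv k C A) : Prop :=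
  ∀ c : C, ∀ᶠ n : ℕ in Filter.atTop, a n c = 0 ∧ (∑ i ∈ Finset.range n, a i c) = s c

/-- `x` is locally nilpotent: each element of the coalgebra is killed by almost all powers
of `x`. -/
def LocNil (x : Conv k C A) : Prop := ∀ c : C, ∀ᶠ n : ℕ in Filter.atTop, (x ^ n) c = 0

lemma sum_conv_apply {ι : Type*} (s : Finset ι) (f : ι → Conv k C A) (c : C) :
    (∑ i ∈ s, f i) c = ∑ i ∈ s, f i c := by
  rw [WithConv.ofConv_sum, LinearMap.sum_apply]

lemma conv_ext {x y : Conv k C A} (h : ∀ c, x c = y c) : x = y :=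
  WithConv.ext (LinearMap.ext h)

lemma SumsTo.unique {a : ℕ → Conv k C A} {s t : Conv k C A} (hs : SumsTo a s)
    (ht : SumsTo a t) : s = t := by
  refine conv_ext fun c => ?_
  obtain ⟨n, h1, h2⟩ := ((hs c).and (ht c)).exists
  rw [← h1.2, h2.2]

lemma sumsTo_of_stable {a : ℕ → Conv k C A} {s : Conv k C A}
    (h : ∀ c : C, ∃ N : ℕ, ∀ n ≥ N, a n c = 0 ∧ (∑ i ∈ Finset.range n, a i c) = s c) :
    SumsTo a s := fun c => Filter.eventually_atTop.2 (h c)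

lemma exists_sumsTo {a : ℕ → Conv k C A} (h : ∀ c : C, ∀ᶠ n in Filter.atTop, a n c = 0) :
    ∃ s, SumsTo a s := by
  have key : ∀ c : C, ∃ t : A, ∀ᶠ n : ℕ in Filter.atTop,
      a n c = 0 ∧ (∑ i ∈ Finset.range n, a i c) = t := by
    intro c
    obtain ⟨N, hN⟩ := Filter.eventually_atTop.1 (h c)
    refine ⟨∑ i ∈ Finset.range N, a i c, Filter.eventually_atTop.2 ⟨N, fun n hn => ⟨hN n hn, ?_⟩⟩⟩
    refine (Finset.sum_subset (Finset.range_mono hn) fun i _ hi => hN i ?_).symm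
    simpa using hi
  choose t ht using key
  refine ⟨toConv { toFun := t, map_add' := fun c d => ?_, map_smul' := fun r c => ?_ }, ht⟩
  · obtain ⟨n, h1, h2, h3⟩ := ((ht c).and ((ht d).and (ht (c + d)))).exists
    rw [← h1.2, ← h2.2, ← h3.2, ← Finset.sum_add_distrib]
    exact Finset.sum_congr rfl fun i _ => map_add _ _ _
  · obtain ⟨n, h1, h2⟩ := ((ht c).and (ht (r • c))).exists
    rw [← h1.2, ← h2.2, RingHom.id_apply, Finset.smul_sum]
    exact Finset.sum_congr rfl fun i _ => map_smul _ _ _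

lemma SumsTo.pre {a : ℕ → Conv k C A} {s : Conv k C A} (h : SumsTo a s) (g : D →ₗc[k] C) :
    SumsTo (fun n => pre A g (a n)) (pre A g s) := fun d => h (g d)

lemma SumsTo.comp {a : ℕ → Conv k C A} {s : Conv k C A} (h : SumsTo a s) (g : A →ₗ[k] B) :
    SumsTo (fun n => (toConv (g ∘ₗ (a n).ofConv) : Conv k C B)) (toConv (g ∘ₗ s.ofConv)) := by
  intro c
  filter_upwards [h c] with n hn
  refine ⟨?_, ?_⟩
  · change g (a n c) = 0
    rw [hn.1, map_zero]
  · change ∑ i ∈ Finset.range n, g (a i c) = g (s c)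
    rw [← hn.2, map_sum]

lemma SumsTo.post {a : ℕ → Conv k C A} {s : Conv k C A} (h : SumsTo a s) (g : A →ₐ[k] B) :
    SumsTo (fun n => InvCoh.post C g (a n)) (InvCoh.post C g s) := h.comp g.toLinearMap

lemma SumsTo.mul_const {a : ℕ → Conv k C A} {s : Conv k C A} (h : SumsTo a s) (y : Conv k C A) :
    SumsTo (fun n => a n * y) (s * y) := by
  intro c
  have h' : ∀ᶠ n : ℕ in Filter.atTop, ∀ l ∈ (ℛ k c).index,
      a n ((ℛ k c).left l) = 0 ∧
        (∑ i ∈ Finset.range n, a i ((ℛ k c).left l)) = s ((ℛ k c).left l) :=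
    (Filter.eventually_all_finset _).2 fun l _ => h _
  filter_upwards [h'] with n hn
  refine ⟨?_, ?_⟩
  · rw [(ℛ k c).convMul_apply]
    exact Finset.sum_eq_zero fun l hl => by rw [(hn l hl).1, zero_mul]
  · simp only [(ℛ k c).convMul_apply]
    rw [Finset.sum_comm]
    exact Finset.sum_congr rfl fun l hl => by rw [← Finset.sum_mul, (hn l hl).2]

lemma SumsTo.const_mul {a : ℕ → Conv k C A} {s : Conv k C A} (h : SumsTo a s) (y : Conv k C A) :
    SumsTo (fun n => y * a n) (y * s) := by
  intro c
  have h' : ∀ᶠ n : ℕ in Filter.atTop, ∀ l ∈ (ℛ k c).index,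
      a n ((ℛ k c).right l) = 0 ∧
        (∑ i ∈ Finset.range n, a i ((ℛ k c).right l)) = s ((ℛ k c).right l) :=
    (Filter.eventually_all_finset _).2 fun l _ => h _
  filter_upwards [h'] with n hn
  refine ⟨?_, ?_⟩
  · rw [(ℛ k c).convMul_apply]
    exact Finset.sum_eq_zero fun l hl => by rw [(hn l hl).1, mul_zero]
  · simp only [(ℛ k c).convMul_apply]
    rw [Finset.sum_comm]
    exact Finset.sum_congr rfl fun l hl => by rw [← Finset.mul_sum, (hn l hl).2]

lemma SumsTo.add {a b : ℕ → Conv k C A} {s t : Conv k C A} (ha : SumsTo a s) (hb : SumsTo b t) :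
    SumsTo (fun n => a n + b n) (s + t) := by
  intro c
  filter_upwards [ha c, hb c] with n h1 h2
  refine ⟨?_, ?_⟩
  · change a n c + b n c = 0
    rw [h1.1, h2.1, add_zero]
  · change ∑ i ∈ Finset.range n, (a i c + b i c) = s c + t c
    rw [Finset.sum_add_distrib, h1.2, h2.2]

lemma SumsTo.sub {a b : ℕ → Conv k C A} {s t : Conv k C A} (ha : SumsTo a s) (hb : SumsTo b t) :
    SumsTo (fun n => a n - b n) (s - t) := by
  intro c
  filter_upwards [ha c, hb c] with n h1 h2
  refine ⟨?_, ?_⟩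
  · change a n c - b n c = 0
    rw [h1.1, h2.1, sub_zero]
  · change ∑ i ∈ Finset.range n, (a i c - b i c) = s c - t c
    rw [Finset.sum_sub_distrib, h1.2, h2.2]

/-- The Cauchy product of two locally finite series. -/
lemma SumsTo.mul {a b : ℕ → Conv k C A} {s t : Conv k C A} (ha : SumsTo a s) (hb : SumsTo b t) :
    SumsTo (fun n => ∑ p ∈ Finset.HasAntidiagonal.antidiagonal n, a p.1 * b p.2) (s * t) := by
  refine sumsTo_of_stable fun c => ?_
  set ρ := ℛ k c
  have h1 : ∀ᶠ n : ℕ in Filter.atTop, ∀ l ∈ ρ.index, ∀ m ≥ n, a m (ρ.left l) = 0 ∧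
      (∑ i ∈ Finset.range m, a i (ρ.left l)) = s (ρ.left l) :=
    (Filter.eventually_all_finset _).2 fun l _ => Filter.eventually_forall_ge_atTop.2 (ha _)
  have h2 : ∀ᶠ n : ℕ in Filter.atTop, ∀ l ∈ ρ.index, ∀ m ≥ n, b m (ρ.right l) = 0 ∧
      (∑ i ∈ Finset.range m, b i (ρ.right l)) = t (ρ.right l) :=
    (Filter.eventually_all_finset _).2 fun l _ => Filter.eventually_forall_ge_atTop.2 (hb _)
  obtain ⟨N, hN1, hN2⟩ := (h1.and h2).exists
  have hz : ∀ i j : ℕ, ¬ (i < N ∧ j < N) → (a i * b j) c = 0 := by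
    intro i j hij
    rw [ρ.convMul_apply]
    refine Finset.sum_eq_zero fun l hl => ?_
    rcases not_and_or.1 hij with h | h
    · rw [(hN1 l hl i (not_lt.1 h)).1, zero_mul]
    · rw [(hN2 l hl j (not_lt.1 h)).1, mul_zero]
  refine ⟨2 * N, fun n hn => ⟨?_, ?_⟩⟩
  · rw [sum_conv_apply]
    refine Finset.sum_eq_zero fun p hp => hz _ _ ?_
    rw [Finset.HasAntidiagonal.mem_antidiagonal] at hp
    omega
  · simp only [sum_conv_apply]
    have e1 : ∑ m ∈ Finset.range n, ∑ p ∈ Finset.HasAntidiagonal.antidiagonal m, (a p.1 * b p.2) c =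
        ∑ p ∈ (Finset.range n ×ˢ Finset.range n).filter (fun p => p.1 + p.2 < n),
          (a p.1 * b p.2) c := by
      rw [← Finset.sum_fiberwise_of_maps_to (s := (Finset.range n ×ˢ Finset.range n).filter
        (fun p => p.1 + p.2 < n)) (t := Finset.range n) (g := fun p => p.1 + p.2)]
      · refine Finset.sum_congr rfl fun m hm => Finset.sum_congr ?_ fun _ _ => rfl
        ext ⟨i, j⟩
        simp only [Finset.HasAntidiagonal.mem_antidiagonal, Finset.mem_filter, Finset.mem_product,
          Finset.mem_range] at hm ⊢
        omega
      · intro p hp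
        simp only [Finset.mem_filter, Finset.mem_range] at hp ⊢
        exact hp.2
    have e2 : ∑ p ∈ Finset.range N ×ˢ Finset.range N, (a p.1 * b p.2) c =
        ∑ p ∈ (Finset.range n ×ˢ Finset.range n).filter (fun p => p.1 + p.2 < n),
          (a p.1 * b p.2) c := by
      refine Finset.sum_subset ?_ ?_
      · intro p hp
        simp only [Finset.mem_filter, Finset.mem_product, Finset.mem_range] at hp ⊢
        omega
      · intro p _ hp
        refine hz _ _ ?_
        simpa only [Finset.mem_product, Finset.mem_range] using hp
    rw [e1, ← e2, Finset.sum_product, ρ.convMul_apply]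
    simp only [ρ.convMul_apply]
    rw [Finset.sum_congr rfl fun i _ => Finset.sum_comm, Finset.sum_comm]
    refine Finset.sum_congr rfl fun l hl => ?_
    rw [← (hN1 l hl N le_rfl).2, ← (hN2 l hl N le_rfl).2, Finset.sum_mul_sum]

/-! ### Power series of locally nilpotent elements -/

open PowerSeries in
/-- The value `f(x) = ∑ fᵢ xⁱ` of a power series `f` at a locally nilpotent `x`
(and `0` at other `x`). -/
def ev (x : Conv k C A) (f : k⟦X⟧) : Conv k C A :=
  open Classical in
  if h : ∃ s, SumsTo (fun n => coeff n f • x ^ n) s then h.choose else 0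

open PowerSeries in
lemma sumsTo_ev {x : Conv k C A} (hx : LocNil x) (f : k⟦X⟧) :
    SumsTo (fun n => coeff n f • x ^ n) (ev x f) := by
  have h : ∃ s, SumsTo (fun n => coeff n f • x ^ n) s := by
    refine exists_sumsTo fun c => ?_
    filter_upwards [hx c] with n hn
    change coeff n f • (x ^ n) c = 0
    rw [hn, smul_zero]
  rw [ev, dif_pos h]
  exact h.choose_spec

open PowerSeries in
lemma ev_eq {x : Conv k C A} (hx : LocNil x) {f : k⟦X⟧} {s : Conv k C A}
    (h : SumsTo (fun n => coeff n f • x ^ n) s) : ev x f = s :=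
  (sumsTo_ev hx f).unique h

lemma ev_mul {x : Conv k C A} (hx : LocNil x) (f g : PowerSeries k) :
    ev x (f * g) = ev x f * ev x g := by
  refine ev_eq hx ?_
  convert (sumsTo_ev hx f).mul (sumsTo_ev hx g) using 2 with n
  rw [PowerSeries.coeff_mul, Finset.sum_smul]
  refine Finset.sum_congr rfl fun p hp => ?_
  rw [smul_mul_smul_comm, ← pow_add, Finset.HasAntidiagonal.mem_antidiagonal.1 hp]

lemma ev_add {x : Conv k C A} (hx : LocNil x) (f g : PowerSeries k) :
    ev x (f + g) = ev x f + ev x g := by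
  refine ev_eq hx ?_
  convert (sumsTo_ev hx f).add (sumsTo_ev hx g) using 2 with n
  rw [map_add, add_smul]

/-- A series with a single nonzero term. -/
lemma sumsTo_single (i : ℕ) {a : ℕ → Conv k C A} (h : ∀ n, n ≠ i → a n = 0) : SumsTo a (a i) := by
  refine sumsTo_of_stable fun c => ⟨i + 1, fun n hn => ⟨?_, ?_⟩⟩
  · rw [h n (by omega)]; rfl
  · refine Finset.sum_eq_single i (fun j _ hj => by rw [h j hj]; rfl) fun hi => ?_
    exact absurd (Finset.mem_range.2 (by omega)) hi

lemma ev_one {x : Conv k C A} (hx : LocNil x) : ev x (1 : PowerSeries k) = 1 := by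
  refine ev_eq hx ?_
  convert sumsTo_single (k := k) (C := C) (A := A) 0
    (a := fun n => PowerSeries.coeff n (1 : PowerSeries k) • x ^ n) ?_
  · simp
  · intro n hn
    simp [PowerSeries.coeff_one, hn]

lemma ev_X {x : Conv k C A} (hx : LocNil x) : ev x (PowerSeries.X : PowerSeries k) = x := by
  refine ev_eq hx ?_
  convert sumsTo_single (k := k) (C := C) (A := A) 1
    (a := fun n => PowerSeries.coeff n (PowerSeries.X : PowerSeries k) • x ^ n) ?_
  · simp
  · intro n hn
    simp [PowerSeries.coeff_X, hn]

lemma ev_sub {x : Conv k C A} (hx : LocNil x) (f g : PowerSeries k) :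
    ev x (f - g) = ev x f - ev x g := by
  rw [eq_sub_iff_add_eq, ← ev_add hx, sub_add_cancel]

lemma ev_smul {x : Conv k C A} (hx : LocNil x) (r : k) (f : PowerSeries k) :
    ev x (r • f) = r • ev x f := by
  refine ev_eq hx ?_
  intro c
  filter_upwards [sumsTo_ev hx f c] with n hn
  simp only [map_smul, smul_assoc]
  refine ⟨?_, ?_⟩
  · rw [WithConv.ofConv_smul, LinearMap.smul_apply, hn.1, smul_zero]
  · rw [WithConv.ofConv_smul, LinearMap.smul_apply, ← hn.2, Finset.smul_sum]
    rfl

lemma ev_pow {x : Conv k C A} (hx : LocNil x) (f : PowerSeries k) (n : ℕ) :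
    ev x (f ^ n) = ev x f ^ n := by
  induction n with
  | zero => simp [ev_one hx]
  | succ n ih => rw [pow_succ, ev_mul hx, ih, pow_succ]

lemma ev_sum {x : Conv k C A} (hx : LocNil x) {ι : Type*} (s : Finset ι)
    (f : ι → PowerSeries k) : ev x (∑ i ∈ s, f i) = ∑ i ∈ s, ev x (f i) := by
  have h0 : ev x (0 : PowerSeries k) = 0 := by
    have := ev_sub hx (0 : PowerSeries k) 0
    rwa [sub_self, sub_self] at this
  classical
  induction s using Finset.induction_on with
  | empty => simp [h0]
  | insert a s ha ih => rw [Finset.sum_insert ha, Finset.sum_insert ha, ev_add hx, ih]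

/-- If the powers of `x` from the `N`-th on kill `c`, then `f(x)(c)` depends on `f`
modulo `t^N` only. -/
lemma ev_apply_congr {x : Conv k C A} (hx : LocNil x) {c : C} {N : ℕ}
    (hN : ∀ n ≥ N, (x ^ n) c = 0) {f g : PowerSeries k}
    (h : ∀ i < N, PowerSeries.coeff i f = PowerSeries.coeff i g) : ev x f c = ev x g c := by
  obtain ⟨n, h1, h2⟩ := ((sumsTo_ev hx f c).and (sumsTo_ev hx g c)).exists
  rw [← h1.2, ← h2.2]
  refine Finset.sum_congr rfl fun i _ => ?_
  rcases lt_or_ge i N with hi | hi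
  · change (PowerSeries.coeff i f • x ^ i) c = (PowerSeries.coeff i g • x ^ i) c
    rw [h i hi]
  · change PowerSeries.coeff i f • (x ^ i) c = PowerSeries.coeff i g • (x ^ i) c
    rw [hN i hi, smul_zero, smul_zero]

lemma LocNil.exists_forall {x : Conv k C A} (hx : LocNil x) (c : C) :
    ∃ N : ℕ, ∀ n ≥ N, (x ^ n) c = 0 := Filter.eventually_atTop.1 (hx c)

lemma ev_zero {x : Conv k C A} (hx : LocNil x) : ev x (0 : PowerSeries k) = 0 := by
  simpa using ev_sum hx (∅ : Finset ℕ) (fun _ => (0 : PowerSeries k))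

lemma ev_pow_apply_eq_zero {x : Conv k C A} (hx : LocNil x) {f : PowerSeries k}
    (hf : PowerSeries.constantCoeff f = 0) {c : C} {N : ℕ} (hN : ∀ n ≥ N, (x ^ n) c = 0)
    {n : ℕ} (hn : N ≤ n) : (ev x f ^ n) c = 0 := by
  rw [← ev_pow hx, ev_apply_congr hx hN (g := 0), ev_zero hx]
  · rfl
  · intro i hi
    rw [map_zero]
    exact PowerSeries.coeff_of_lt_order _ (lt_of_lt_of_le (by exact_mod_cast lt_of_lt_of_le hi hn)
      (PowerSeries.le_order_pow_of_constantCoeff_eq_zero n hf))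

lemma LocNil.ev {x : Conv k C A} (hx : LocNil x) {f : PowerSeries k}
    (hf : PowerSeries.constantCoeff f = 0) : LocNil (ev x f) := by
  intro c
  obtain ⟨N, hN⟩ := hx.exists_forall c
  filter_upwards [Filter.eventually_ge_atTop N] with n hn
  exact ev_pow_apply_eq_zero hx hf hN hn

/-- Evaluation is compatible with substitution of power series. -/
lemma ev_ev {x : Conv k C A} (hx : LocNil x) {f : PowerSeries k}
    (hf : PowerSeries.constantCoeff f = 0) (g : PowerSeries k) :
    ev (ev x f) g = ev x (g.subst f) := by
  refine conv_ext fun c => ?_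
  obtain ⟨N, hN⟩ := hx.exists_forall c
  have hy : ∀ n ≥ N, (ev x f ^ n) c = 0 := fun n hn => ev_pow_apply_eq_zero hx hf hN hn
  obtain ⟨n, h1, h2⟩ :=
    ((sumsTo_ev (hx.ev hf) g c).and (Filter.eventually_ge_atTop N)).exists
  rw [← h1.2]
  have e : ∑ i ∈ Finset.range n, (PowerSeries.coeff i g • ev x f ^ i) c =
      (ev x (∑ i ∈ Finset.range n, PowerSeries.coeff i g • f ^ i)) c := by
    rw [ev_sum hx, sum_conv_apply]
    refine Finset.sum_congr rfl fun i _ => ?_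
    rw [ev_smul hx, ev_pow hx]
  rw [e]
  refine ev_apply_congr hx hN fun j hj => ?_
  have hs : PowerSeries.HasSubst f := PowerSeries.HasSubst.of_constantCoeff_zero' hf
  rw [PowerSeries.coeff_subst' hs, map_sum, finsum_eq_sum_of_support_subset (s := Finset.range n)]
  · refine Finset.sum_congr rfl fun i _ => by simp
  · intro i hi
    rw [Function.mem_support] at hi
    rw [Finset.mem_coe, Finset.mem_range]
    by_contra hni
    refine hi ?_
    rw [PowerSeries.coeff_of_lt_order (n := j) (φ := f ^ i), smul_zero]
    refine lt_of_lt_of_le ?_ (PowerSeries.le_order_pow_of_constantCoeff_eq_zero i hf)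
    exact_mod_cast (by omega : j < i)

lemma ev_commute {x y : Conv k C A} (hx : LocNil x) (h : Commute y x) (f : PowerSeries k) :
    Commute y (ev x f) := by
  refine ((sumsTo_ev hx f).const_mul y).unique ?_
  convert (sumsTo_ev hx f).mul_const y using 2 with n
  rw [mul_smul_comm, smul_mul_assoc, (h.pow_right n).eq]

lemma LocNil.pre {x : Conv k C A} (hx : LocNil x) (g : D →ₗc[k] C) : LocNil (pre A g x) := by
  intro d
  filter_upwards [hx (g d)] with n hn
  rw [← map_pow]
  exact hn

lemma LocNil.post {x : Conv k C A} (hx : LocNil x) (g : A →ₐ[k] B) :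
    LocNil (InvCoh.post C g x) := by
  intro c
  filter_upwards [hx c] with n hn
  rw [← map_pow, post_apply, hn, map_zero]

lemma LocNil.smul {x : Conv k C A} (hx : LocNil x) (r : k) : LocNil (r • x) := by
  intro c
  filter_upwards [hx c] with n hn
  rw [smul_pow, WithConv.ofConv_smul, LinearMap.smul_apply, hn, smul_zero]

lemma LocNil.neg {x : Conv k C A} (hx : LocNil x) : LocNil (-x) := by
  simpa using hx.smul (-1)

lemma pre_ev {x : Conv k C A} (hx : LocNil x) (g : D →ₗc[k] C) (f : PowerSeries k) :
    pre A g (ev x f) = ev (pre A g x) f := by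
  refine (ev_eq (hx.pre g) ?_).symm
  convert (sumsTo_ev hx f).pre g using 2 with n
  rw [← map_pow]; rfl

lemma post_ev {x : Conv k C A} (hx : LocNil x) (g : A →ₐ[k] B) (f : PowerSeries k) :
    post C g (ev x f) = ev (post C g x) f := by
  refine (ev_eq (hx.post g) ?_).symm
  convert (sumsTo_ev hx f).post g using 2 with n
  rw [← map_pow]
  refine conv_ext fun c => ?_
  exact (map_smul g _ _).symm

lemma comp_convMul_of_leibniz {Δ : A →ₗ[k] A} (hΔ : ∀ a b, Δ (a * b) = Δ a * b + a * Δ b)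
    (x y : Conv k C A) : (toConv (Δ ∘ₗ (x * y).ofConv) : Conv k C A) =
      toConv (Δ ∘ₗ x.ofConv) * y + x * toConv (Δ ∘ₗ y.ofConv) := by
  refine conv_ext fun c => ?_
  change Δ ((x * y) c) = (toConv (Δ ∘ₗ x.ofConv) * y) c + (x * toConv (Δ ∘ₗ y.ofConv)) c
  simp only [(ℛ k c).convMul_apply, map_sum, hΔ, Finset.sum_add_distrib]
  rfl

/-- If a derivation of the target algebra acts on `x` as the commutator with a fixed element,
then it does so on every power series in `x`. -/
lemma comp_ev_of_leibniz {Δ : A →ₗ[k] A} (hΔ : ∀ a b, Δ (a * b) = Δ a * b + a * Δ b)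
    {x z : Conv k C A} (hx : LocNil x)
    (h : (toConv (Δ ∘ₗ x.ofConv) : Conv k C A) = z * x - x * z) (f : PowerSeries k) :
    (toConv (Δ ∘ₗ (ev x f).ofConv) : Conv k C A) = z * ev x f - ev x f * z := by
  have h1 : Δ 1 = 0 := by simpa using hΔ 1 1
  have hp : ∀ n : ℕ, (toConv (Δ ∘ₗ (x ^ n).ofConv) : Conv k C A) = z * x ^ n - x ^ n * z := by
    intro n
    induction n with
    | zero =>
      rw [pow_zero, mul_one, one_mul, sub_self]
      refine conv_ext fun c => ?_
      change Δ (algebraMap k A (counit c)) = 0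
      rw [Algebra.algebraMap_eq_smul_one, map_smul, h1, smul_zero]
    | succ n ih => rw [pow_succ, comp_convMul_of_leibniz hΔ, ih, h]; noncomm_ring
  refine ((sumsTo_ev hx f).comp Δ).unique ?_
  convert ((sumsTo_ev hx f).const_mul z).sub ((sumsTo_ev hx f).mul_const z) using 2 with n
  rw [mul_smul_comm, smul_mul_assoc, ← smul_sub, ← hp]
  refine conv_ext fun c => ?_
  exact map_smul Δ _ _

end Sums

/-! ### Exponential and logarithm -/

section ExpLog

variable {k : Type u} [Field k] [CharZero k]
variable {C : Type v} [AddCommGroup C] [Module k C] [Coalgebra k C]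
variable {D : Type v} [AddCommGroup D] [Module k D] [Coalgebra k D]
variable {A : Type w} [Ring A] [Algebra k A]
variable {B : Type w'} [Ring B] [Algebra k B]

variable (k) in
lemma constantCoeff_exp_sub_one : PowerSeries.constantCoeff (PowerSeries.exp k - 1) = 0 := by
  simp

variable (k) in
lemma isUnit_coeff_one_exp_sub_one : IsUnit (PowerSeries.coeff 1 (PowerSeries.exp k - 1)) := by
  simp [PowerSeries.coeff_exp, PowerSeries.coeff_one]

variable (k) in
/-- The power series `log(1 + t)`, as the compositional inverse of `exp(t) - 1`. -/
def logSeries : PowerSeries k :=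
  (PowerSeries.exp k - 1).substInvOfIsUnit (isUnit_coeff_one_exp_sub_one k)

variable (k) in
lemma constantCoeff_logSeries : PowerSeries.constantCoeff (logSeries k) = 0 :=
  PowerSeries.constantCoeff_substInvOfIsUnit _ _

/-- The exponential in the convolution algebra. -/
def cexp (x : Conv k C A) : Conv k C A := ev x (PowerSeries.exp k)

/-- The logarithm in the convolution algebra. -/
def clog (x : Conv k C A) : Conv k C A := ev (x - 1) (logSeries k)

variable (k) in
/-- The divided power `xⁿ / n!`. -/
def dpow {M : Type*} [Ring M] [Algebra k M] (x : M) (n : ℕ) : M := ((n.factorial : k)⁻¹) • x ^ n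

lemma smul_coeff_exp (x : Conv k C A) (n : ℕ) :
    PowerSeries.coeff n (PowerSeries.exp k) • x ^ n = dpow k x n := by
  rw [PowerSeries.coeff_exp, dpow]
  simp

lemma sumsTo_cexp {x : Conv k C A} (hx : LocNil x) :
    SumsTo (dpow k x) (cexp x) := by
  have h := sumsTo_ev hx (PowerSeries.exp k)
  simp only [smul_coeff_exp] at h
  exact h

lemma isExp_cexp {x : Conv k C A} (hx : LocNil x) : IsExp x (cexp x) := by
  intro c
  filter_upwards [sumsTo_cexp hx c] with n hn
  rw [sum_conv_apply]
  exact hn.2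

lemma cexp_sub_one {x : Conv k C A} (hx : LocNil x) :
    cexp x - 1 = ev x (PowerSeries.exp k - 1) := by
  rw [ev_sub hx, ev_one hx, cexp]

lemma locNil_cexp_sub_one {x : Conv k C A} (hx : LocNil x) : LocNil (cexp x - 1) := by
  rw [cexp_sub_one hx]
  exact hx.ev (constantCoeff_exp_sub_one k)

lemma clog_cexp {x : Conv k C A} (hx : LocNil x) : clog (cexp x) = x := by
  rw [clog, cexp_sub_one hx, ev_ev hx (constantCoeff_exp_sub_one k), logSeries,
    PowerSeries.subst_substInvOfIsUnit_left _ (constantCoeff_exp_sub_one k), ev_X hx]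

lemma locNil_clog {x : Conv k C A} (hx : LocNil (x - 1)) : LocNil (clog x) :=
  hx.ev (constantCoeff_logSeries k)

lemma cexp_clog {x : Conv k C A} (hx : LocNil (x - 1)) : cexp (clog x) = x := by
  have hs : PowerSeries.HasSubst (logSeries k) :=
    PowerSeries.HasSubst.of_constantCoeff_zero' (constantCoeff_logSeries k)
  have h1 : (PowerSeries.exp k).subst (logSeries k) = PowerSeries.X + 1 := by
    have h2 := PowerSeries.subst_substInvOfIsUnit_right (PowerSeries.exp k - 1)
      (constantCoeff_exp_sub_one k) (isUnit_coeff_one_exp_sub_one k)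
    change (PowerSeries.exp k - 1).subst (logSeries k) = _ at h2
    rw [← h2, PowerSeries.subst_sub hs]
    have h3 : (1 : PowerSeries k).subst (logSeries k) = (1 : PowerSeries k) := by
      rw [← PowerSeries.coe_substAlgHom hs, map_one]
    rw [h3, sub_add_cancel]
  rw [clog, cexp, ev_ev hx (constantCoeff_logSeries k), h1, ev_add hx, ev_X hx, ev_one hx,
    sub_add_cancel]

lemma cexp_injective {x y : Conv k C A} (hx : LocNil x) (hy : LocNil y) (h : cexp x = cexp y) :
    x = y := by
  rw [← clog_cexp hx, h, clog_cexp hy]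

lemma locNil_zero : LocNil (0 : Conv k C A) := by
  intro c
  filter_upwards [Filter.eventually_gt_atTop 0] with n hn
  rw [zero_pow hn.ne']; rfl

lemma cexp_zero : cexp (0 : Conv k C A) = 1 := by
  refine (sumsTo_cexp locNil_zero).unique ?_
  convert sumsTo_single (k := k) (C := C) (A := A) 0
    (a := dpow k 0) ?_
  · simp [dpow]
  · intro n hn
    simp [dpow, hn]

lemma pre_cexp {x : Conv k C A} (hx : LocNil x) (g : D →ₗc[k] C) :
    pre A g (cexp x) = cexp (pre A g x) := pre_ev hx g _

lemma post_cexp {x : Conv k C A} (hx : LocNil x) (g : A →ₐ[k] B) :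
    post C g (cexp x) = cexp (post C g x) := post_ev hx g _

lemma cexp_commute {x y : Conv k C A} (hx : LocNil x) (h : Commute y x) : Commute y (cexp x) :=
  ev_commute hx h _

/-- An element that commutes with an exponential commutes with the exponent. -/
lemma commute_of_commute_cexp {x y : Conv k C A} (hx : LocNil x) (h : Commute y (cexp x)) :
    Commute y x := by
  have h1 := ev_commute (locNil_cexp_sub_one hx) (h.sub_right (Commute.one_right y)) (logSeries k)
  rwa [show ev (cexp x - 1) (logSeries k) = x from clog_cexp hx] at h1

/-- The terms of degree `n` of `exp(x) exp(y)`. -/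
lemma sumsTo_cexp_mul_cexp {x y : Conv k C A} (hx : LocNil x) (hy : LocNil y) :
    SumsTo (fun n => ∑ p ∈ Finset.HasAntidiagonal.antidiagonal n,
      dpow k x p.1 * dpow k y p.2)
      (cexp x * cexp y) := (sumsTo_cexp hx).mul (sumsTo_cexp hy)

lemma add_pow_div_factorial {M : Type*} [Ring M] [Algebra k M] {x y : M} (h : Commute x y)
    (n : ℕ) : ∑ p ∈ Finset.HasAntidiagonal.antidiagonal n,
      dpow k x p.1 * dpow k y p.2 =
      dpow k (x + y) n := by
  rw [dpow, h.add_pow', Finset.smul_sum]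
  refine Finset.sum_congr rfl fun p hp => ?_
  rw [Finset.HasAntidiagonal.mem_antidiagonal] at hp
  rw [dpow, dpow, smul_mul_smul_comm, ← Nat.cast_smul_eq_nsmul k, smul_smul]
  congr 1
  have h0 := Nat.add_choose_mul_factorial_mul_factorial p.1 p.2
  have h1 : (p.1.factorial : k) ≠ 0 := Nat.cast_ne_zero.2 (Nat.factorial_ne_zero _)
  have h2 : (p.2.factorial : k) ≠ 0 := Nat.cast_ne_zero.2 (Nat.factorial_ne_zero _)
  have h3 : ((p.1 + p.2).factorial : k) ≠ 0 := Nat.cast_ne_zero.2 (Nat.factorial_ne_zero _)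
  rw [← hp]
  field_simp
  rw [← h0, show (p.1 + p.2).choose p.1 = (p.1 + p.2).choose p.2 from Nat.choose_symm_add]
  push_cast
  ring

lemma LocNil.add {x y : Conv k C A} (hx : LocNil x) (hy : LocNil y) (h : Commute x y) :
    LocNil (x + y) := by
  intro c
  filter_upwards [sumsTo_cexp_mul_cexp hx hy c] with n hn
  have h1 := hn.1
  rw [add_pow_div_factorial h] at h1
  change ((n.factorial : k)⁻¹) • (((x + y) ^ n) c) = 0 at h1
  exact (smul_eq_zero.1 h1).resolve_left
    (inv_ne_zero (Nat.cast_ne_zero.2 (Nat.factorial_ne_zero n)))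

lemma cexp_add {x y : Conv k C A} (hx : LocNil x) (hy : LocNil y) (h : Commute x y) :
    cexp (x + y) = cexp x * cexp y := by
  refine (sumsTo_cexp (hx.add hy h)).unique ?_
  convert sumsTo_cexp_mul_cexp hx hy using 2 with n
  exact (add_pow_div_factorial h n).symm

lemma cexp_mul_cexp_neg {x : Conv k C A} (hx : LocNil x) : cexp x * cexp (-x) = 1 := by
  rw [← cexp_add hx hx.neg (Commute.refl x).neg_right, add_neg_cancel, cexp_zero]

lemma cexp_neg_mul_cexp {x : Conv k C A} (hx : LocNil x) : cexp (-x) * cexp x = 1 := by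
  simpa using cexp_mul_cexp_neg hx.neg

/-- The exponential as a unit. -/
def cexpU (x : Conv k C A) (hx : LocNil x) : (Conv k C A)ˣ :=
  ⟨cexp x, cexp (-x), cexp_mul_cexp_neg hx, cexp_neg_mul_cexp hx⟩

/-! ### The Baker-Campbell-Hausdorff formula for a central commutator -/

section BCH

variable {M : Type*} [Ring M] [Algebra k M]

/-- A sequence with `(n+2) u_{n+2} = a u_{n+1} + c u_n` is determined by its first two terms. -/
lemma eq_of_recursion {a c : M} {f g : ℕ → M} (h0 : f 0 = g 0) (h1 : f 1 = g 1)
    (hf : ∀ n, ((n + 2 : ℕ) : k) • f (n + 2) = a * f (n + 1) + c * f n)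
    (hg : ∀ n, ((n + 2 : ℕ) : k) • g (n + 2) = a * g (n + 1) + c * g n) (n : ℕ) : f n = g n := by
  induction n using Nat.strong_induction_on with
  | _ n ih =>
    match n, ih with
    | 0, _ => exact h0
    | 1, _ => exact h1
    | n + 2, ih =>
      have hne : ((n + 2 : ℕ) : k) ≠ 0 := Nat.cast_ne_zero.2 (by omega)
      refine smul_right_injective M hne ?_
      change ((n + 2 : ℕ) : k) • f (n + 2) = ((n + 2 : ℕ) : k) • g (n + 2)
      rw [hf, hg, ih (n + 1) (by omega), ih n (by omega)]

lemma dpow_zero (x : M) : dpow k x 0 = 1 := by simp [dpow]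

lemma dpow_one (x : M) : dpow k x 1 = x := by simp [dpow]

lemma succ_smul_dpow (x : M) (n : ℕ) : ((n + 1 : ℕ) : k) • dpow k x (n + 1) = x * dpow k x n := by
  rw [dpow, dpow, smul_smul, mul_smul_comm, ← pow_succ', Nat.factorial_succ]
  congr 1
  have h1 : ((n + 1 : ℕ) : k) ≠ 0 := Nat.cast_ne_zero.2 (by omega)
  have h2 : (n.factorial : k) ≠ 0 := Nat.cast_ne_zero.2 (Nat.factorial_ne_zero n)
  rw [Nat.cast_mul, mul_inv, ← mul_assoc, mul_inv_cancel₀ h1, one_mul]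

lemma succ_smul_dpow' (x : M) (n : ℕ) : ((n + 1 : ℕ) : k) • dpow k x (n + 1) = dpow k x n * x := by
  rw [succ_smul_dpow, dpow, mul_smul_comm, smul_mul_assoc, ← pow_succ', pow_succ]

lemma dpow_mul_of_commutator {x y c : M} (hc : x * y - y * x = c) (hx : Commute c x) (n : ℕ) :
    dpow k x (n + 1) * y = y * dpow k x (n + 1) + c * dpow k x n := by
  have hp : ∀ m : ℕ, x ^ (m + 1) * y = y * x ^ (m + 1) + ((m + 1 : ℕ) : k) • (c * x ^ m) := by
    intro m
    have hxy : x * y = y * x + c := by rw [← hc]; abel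
    induction m with
    | zero => simp [hxy]
    | succ m ih =>
      have e : x * (c * x ^ m) = c * x ^ (m + 1) := by
        rw [← mul_assoc, ← hx.eq, mul_assoc, ← pow_succ']
      rw [pow_succ' x (m + 1), mul_assoc, ih, mul_add, mul_smul_comm, e, ← mul_assoc, hxy,
        add_mul, mul_assoc, add_assoc]
      congr 1
      push_cast
      rw [add_smul ((m : k) + 1) 1, one_smul, add_comm]
  rw [← smul_right_injective M (Nat.cast_ne_zero (R := k).2 (Nat.factorial_ne_zero (n + 1)))
    |>.eq_iff]
  have h2 : ((n + 1).factorial : k) ≠ 0 := Nat.cast_ne_zero.2 (Nat.factorial_ne_zero (n + 1))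
  have h3 : (n.factorial : k) ≠ 0 := Nat.cast_ne_zero.2 (Nat.factorial_ne_zero n)
  simp only [dpow, smul_add, smul_mul_assoc, mul_smul_comm, smul_smul, mul_inv_cancel₀ h2,
    one_smul]
  rw [hp, Nat.factorial_succ, Nat.cast_mul, mul_assoc, mul_inv_cancel₀ h3, mul_one]

variable (k) in
/-- The coefficients of `exp(t²d)` as a power series in `t`. -/
def sqExpCoeff (d : M) (n : ℕ) : M := if Even n then dpow k d (n / 2) else 0

lemma smul_sqExpCoeff (d : M) (n : ℕ) :
    ((n + 2 : ℕ) : k) • sqExpCoeff k d (n + 2) = (2 : k) • (d * sqExpCoeff k d n) := by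
  rcases Nat.even_or_odd n with ⟨m, rfl⟩ | h
  · have e1 : Even (m + m + 2) := ⟨m + 1, by ring⟩
    have e2 : (m + m + 2) / 2 = m + 1 := by omega
    have e3 : (m + m) / 2 = m := by omega
    rw [sqExpCoeff, sqExpCoeff, if_pos e1, if_pos ⟨m, rfl⟩, e2, e3, ← succ_smul_dpow, smul_smul]
    congr 1
    push_cast
    ring
  · have h' : ¬ Even (n + 2) := by
      rw [Nat.not_even_iff_odd]
      exact h.add_even even_two
    rw [sqExpCoeff, sqExpCoeff, if_neg h', if_neg (Nat.not_even_iff_odd.2 h), mul_zero,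
      smul_zero, smul_zero]

open Finset.HasAntidiagonal in
/-- The BCH formula for a commutator `c` commuting with `x` and `y`, in each degree. -/
lemma dpow_mul_dpow_eq {x y c : M} (hc : x * y - y * x = c) (hx : Commute c x)
    (hy : Commute c y) (n : ℕ) :
    ∑ p ∈ antidiagonal n, dpow k x p.1 * dpow k y p.2 =
      ∑ p ∈ antidiagonal n, dpow k (x + y) p.1 * sqExpCoeff k ((2⁻¹ : k) • c) p.2 := by
  have hcd : ∀ m, Commute c (dpow k x m) := fun m => (hx.pow_right m).smul_right _
  have hcs : ∀ m, Commute c (dpow k (x + y) m) := fun m =>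
    ((hx.add_right hy).pow_right m).smul_right _
  -- both sides satisfy the recursion `(n+2) u_{n+2} = (x+y) u_{n+1} + c u_n`
  refine eq_of_recursion (k := k) (a := x + y) (c := c)
    (f := fun n => ∑ p ∈ antidiagonal n, dpow k x p.1 * dpow k y p.2)
    (g := fun n => ∑ p ∈ antidiagonal n, dpow k (x + y) p.1 * sqExpCoeff k ((2⁻¹ : k) • c) p.2)
    ?_ ?_ ?_ ?_ n
  · simp [dpow_zero, sqExpCoeff]
  · simp [Finset.Nat.antidiagonal_succ, dpow_zero, dpow_one, sqExpCoeff, add_comm]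
  · intro n
    have e1 : ((n + 2 : ℕ) : k) • ∑ p ∈ antidiagonal (n + 2), dpow k x p.1 * dpow k y p.2 =
        x * (∑ p ∈ antidiagonal (n + 1), dpow k x p.1 * dpow k y p.2) +
          (∑ p ∈ antidiagonal (n + 1), dpow k x p.1 * dpow k y p.2) * y := by
      have : ((n + 2 : ℕ) : k) • ∑ p ∈ antidiagonal (n + 2), dpow k x p.1 * dpow k y p.2 =
          ∑ p ∈ antidiagonal (n + 2), ((p.1 : k) • dpow k x p.1) * dpow k y p.2 +
          ∑ p ∈ antidiagonal (n + 2), dpow k x p.1 * ((p.2 : k) • dpow k y p.2) := by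
        rw [← Finset.sum_add_distrib, Finset.smul_sum]
        refine Finset.sum_congr rfl fun p hp => ?_
        rw [mem_antidiagonal] at hp
        rw [smul_mul_assoc, mul_smul_comm, ← add_smul, ← Nat.cast_add, hp]
      rw [this]
      congr 1
      · rw [Finset.Nat.sum_antidiagonal_succ]
        simp only [Nat.cast_zero, zero_smul, zero_mul, zero_add, succ_smul_dpow x,
          Finset.mul_sum, mul_assoc]
      · rw [Finset.Nat.sum_antidiagonal_succ']
        simp only [Nat.cast_zero, zero_smul, mul_zero, zero_add, succ_smul_dpow' y,
          Finset.sum_mul, mul_assoc]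
    have e2 : (∑ p ∈ antidiagonal (n + 1), dpow k x p.1 * dpow k y p.2) * y =
        y * (∑ p ∈ antidiagonal (n + 1), dpow k x p.1 * dpow k y p.2) +
          c * (∑ p ∈ antidiagonal n, dpow k x p.1 * dpow k y p.2) := by
      have hyy : ∀ m, Commute y (dpow k y m) := fun m =>
        ((Commute.refl y).pow_right m).smul_right _
      rw [Finset.Nat.sum_antidiagonal_succ]
      simp only [add_mul, mul_add, Finset.sum_mul, Finset.mul_sum, dpow_zero, one_mul,
        (hyy _).eq, mul_assoc, add_assoc]
      congr 1
      rw [← Finset.sum_add_distrib]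
      refine Finset.sum_congr rfl fun p _ => ?_
      rw [← (hyy p.2).eq, ← mul_assoc, dpow_mul_of_commutator hc hx, add_mul, mul_assoc, mul_assoc]
    simp only [e1, e2]
    rw [add_mul, add_assoc]
  · intro n
    have : ((n + 2 : ℕ) : k) • ∑ p ∈ antidiagonal (n + 2),
          dpow k (x + y) p.1 * sqExpCoeff k ((2⁻¹ : k) • c) p.2 =
        ∑ p ∈ antidiagonal (n + 2),
          ((p.1 : k) • dpow k (x + y) p.1) * sqExpCoeff k ((2⁻¹ : k) • c) p.2 +
        ∑ p ∈ antidiagonal (n + 2),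
          dpow k (x + y) p.1 * ((p.2 : k) • sqExpCoeff k ((2⁻¹ : k) • c) p.2) := by
      rw [← Finset.sum_add_distrib, Finset.smul_sum]
      refine Finset.sum_congr rfl fun p hp => ?_
      rw [mem_antidiagonal] at hp
      rw [smul_mul_assoc, mul_smul_comm, ← add_smul, ← Nat.cast_add, hp]
    simp only [this]
    congr 1
    · rw [Finset.Nat.sum_antidiagonal_succ]
      simp only [Nat.cast_zero, zero_smul, zero_mul, zero_add, succ_smul_dpow, Finset.mul_sum,
        mul_assoc]
    · rw [Finset.Nat.sum_antidiagonal_succ', Finset.Nat.sum_antidiagonal_succ']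
      have h1 : sqExpCoeff k ((2⁻¹ : k) • c) (0 + 1) = 0 := by simp [sqExpCoeff]
      simp only [Nat.cast_zero, zero_smul, mul_zero, h1, smul_zero, zero_add]
      rw [Finset.mul_sum]
      refine Finset.sum_congr rfl fun p _ => ?_
      rw [show p.2 + 1 + 1 = p.2 + 2 from rfl, smul_sqExpCoeff, smul_mul_assoc, smul_smul,
        mul_inv_cancel₀ two_ne_zero, one_smul, ← mul_assoc, ← (hcs p.1).eq, mul_assoc]

end BCH

lemma sumsTo_sqExpCoeff {x : Conv k C A} (hx : LocNil x) :
    SumsTo (fun n => sqExpCoeff k x n) (cexp x) := by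
  refine sumsTo_of_stable fun c => ?_
  obtain ⟨N, hN⟩ := Filter.eventually_atTop.1 (sumsTo_cexp hx c)
  have hev : ∀ m, ∑ i ∈ Finset.range (2 * m), sqExpCoeff k x i c =
      ∑ i ∈ Finset.range m, dpow k x i c := by
    intro m
    induction m with
    | zero => simp
    | succ m ih =>
      have h1 : sqExpCoeff k x (2 * m) = dpow k x m := by
        rw [sqExpCoeff, if_pos (even_two_mul m), Nat.mul_div_cancel_left m two_pos]
      have h2 : sqExpCoeff k x (2 * m + 1) = 0 := by
        rw [sqExpCoeff, if_neg (Nat.not_even_iff_odd.2 ⟨m, rfl⟩)]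
      rw [show 2 * (m + 1) = 2 * m + 1 + 1 by ring, Finset.sum_range_succ, Finset.sum_range_succ,
        ih, Finset.sum_range_succ, h1, h2]
      change _ + (0 : A) = _
      rw [add_zero]
  have hz : ∀ n ≥ 2 * N, sqExpCoeff k x n c = 0 := by
    intro n hn
    rw [sqExpCoeff]
    split_ifs
    · exact (hN (n / 2) (by omega)).1
    · rfl
  refine ⟨2 * N, fun n hn => ⟨hz n hn, ?_⟩⟩
  rw [← (hN N le_rfl).2]
  refine Eq.trans ?_ (hev N)
  refine (Finset.sum_subset (Finset.range_mono hn) fun i _ hi => hz i ?_).symm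
  simpa using hi

/-- The Baker-Campbell-Hausdorff formula when the commutator commutes with both exponents. -/
lemma cexp_mul_cexp_of_commutator {x y c : Conv k C A} (hx : LocNil x) (hy : LocNil y)
    (hxy : LocNil (x + y)) (hcn : LocNil c) (hc : x * y - y * x = c) (hcx : Commute c x)
    (hcy : Commute c y) : cexp x * cexp y = cexp (x + y) * cexp ((2⁻¹ : k) • c) := by
  refine (sumsTo_cexp_mul_cexp hx hy).unique ?_
  convert (sumsTo_cexp hxy).mul (sumsTo_sqExpCoeff (hcn.smul (2⁻¹ : k))) using 2 with n
  exact dpow_mul_dpow_eq hc hcx hcy n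

end ExpLog

/-! ### Local nilpotence over a unipotent group -/

section Unipotent

variable {k : Type u} [Field k]
variable {H : Type v} [CommRing H] [HopfAlgebra k H]
variable {A : Type w} [Ring A] [Algebra k A]

/-- `a` is the matrix of coefficients of a finite-dimensional representation. -/
def IsCoeffMatrix {n : ℕ} (a : Matrix (Fin n) (Fin n) H) : Prop :=
  (∀ i j, comul (R := k) (a i j) = ∑ l, a i l ⊗ₜ[k] a l j) ∧
    ∀ i j, counit (R := k) (a i j) = (1 : Matrix (Fin n) (Fin n) k) i j

lemma pow_apply_one {x : Conv k H A} (hx : x 1 = 0) (n : ℕ) : (x ^ (n + 1)) 1 = 0 := by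
  have : ∀ y : Conv k H A, (x * y) 1 = 0 := by
    intro y
    rw [LinearMap.convMul_apply, Bialgebra.comul_one, Algebra.TensorProduct.one_def,
      TensorProduct.map_tmul, LinearMap.mul'_apply, hx, zero_mul]
  rw [pow_succ']
  exact this _

lemma conv_mul_coeffMatrix {n : ℕ} {a : Matrix (Fin n) (Fin n) H} (ha : IsCoeffMatrix (k := k) a)
    (x y : Conv k H A) (i j : Fin n) : (x * y) (a i j) = ∑ l, x (a i l) * y (a l j) := by
  rw [LinearMap.convMul_apply, ha.1, map_sum, map_sum]
  rfl

/-- On the coefficients of an `n`-dimensional representation of a unipotent group, all products of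
at least `n` copies of a form vanishing at `1` vanish. This follows by induction on `n` from the
existence of a fixed vector `c`, by passing to the quotient by the line spanned by `c`. -/
lemma pow_coeffMatrix_eq_zero (hU : IsUnipotent k H) {x : Conv k H A} (hx : x 1 = 0) (n : ℕ) :
    ∀ (a : Matrix (Fin n) (Fin n) H), IsCoeffMatrix (k := k) a → ∀ m ≥ n, ∀ i j,
      (x ^ m) (a i j) = 0 := by
  induction n with
  | zero => exact fun a _ m _ i => i.elim0
  | succ n ih =>
    intro a ha m hm
    obtain ⟨v, hv0, hv⟩ := hU (n + 1) a n.succ_pos ha.1 ha.2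
    obtain ⟨s, hs⟩ : ∃ s, v s ≠ 0 := by
      by_contra h
      push Not at h
      exact hv0 (funext h)
    -- the fixed vector, normalized at the coordinate `s`
    set c : Fin (n + 1) → k := fun i => v i / v s with hc
    have hcs : c s = 1 := div_self hs
    have hac : ∀ i, ∑ l, c l • a i l = algebraMap k H (c i) := by
      intro i
      have : ∑ l, c l • a i l = (v s)⁻¹ • ∑ l, v l • a i l := by
        rw [Finset.smul_sum]
        exact Finset.sum_congr rfl fun l _ => by rw [smul_smul, hc]; congr 1; ring
      rw [this, hv, Algebra.algebraMap_eq_smul_one, Algebra.algebraMap_eq_smul_one, smul_smul]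
      congr 1
      simp only [hc]; ring
    -- the coefficients of the quotient representation
    let b : Matrix (Fin n) (Fin n) H := fun i j =>
      a (s.succAbove i) (s.succAbove j) - c (s.succAbove i) • a s (s.succAbove j)
    have hb : IsCoeffMatrix (k := k) b := by
      constructor
      · intro i j
        have e : ∑ l, b i l ⊗ₜ[k] b l j =
            ∑ l, (a (s.succAbove i) l - c (s.succAbove i) • a s l) ⊗ₜ[k]
              (a l (s.succAbove j) - c l • a s (s.succAbove j)) := by
          rw [Fin.sum_univ_succAbove _ s, hcs, one_smul, sub_self, TensorProduct.tmul_zero,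
            zero_add]
        have e2 : ∀ i : Fin (n + 1), ∑ l, a i l ⊗ₜ[k] (c l • a s (s.succAbove j)) =
            algebraMap k H (c i) ⊗ₜ[k] a s (s.succAbove j) := by
          intro i
          rw [← hac, TensorProduct.sum_tmul]
          exact Finset.sum_congr rfl fun l _ => by
            rw [TensorProduct.tmul_smul, TensorProduct.smul_tmul']
        rw [e]
        simp only [TensorProduct.sub_tmul, TensorProduct.tmul_sub, Finset.sum_sub_distrib,
          ← TensorProduct.smul_tmul', ← Finset.smul_sum, e2, ← ha.1]
        simp only [b, map_sub, map_smul, TensorProduct.smul_tmul', hcs, map_one,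
          Algebra.algebraMap_eq_smul_one]
        abel
      · intro i j
        simp only [b, map_sub, map_smul, ha.2]
        rw [Matrix.one_apply_ne (Fin.succAbove_ne s j).symm, smul_zero, sub_zero,
          Matrix.one_apply, Matrix.one_apply]
        simp
    obtain ⟨m, rfl⟩ : ∃ m', m = m' + 1 := ⟨m - 1, by omega⟩
    have h1 : ∀ l j, (x ^ m) (a l (s.succAbove j)) = c l • (x ^ m) (a s (s.succAbove j)) := by
      intro l j
      rcases Fin.eq_self_or_eq_succAbove s l with rfl | ⟨i, rfl⟩
      · rw [hcs, one_smul]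
      · have := ih b hb m (by omega) i j
        simp only [b, map_sub, map_smul] at this
        exact sub_eq_zero.1 this
    have h2 : ∀ i j, (x ^ (m + 1)) (a i (s.succAbove j)) = 0 := by
      intro i j
      rw [pow_succ', conv_mul_coeffMatrix ha]
      have : ∑ l, x (a i l) * (x ^ m) (a l (s.succAbove j)) =
          x (∑ l, c l • a i l) * (x ^ m) (a s (s.succAbove j)) := by
        rw [map_sum, Finset.sum_mul]
        refine Finset.sum_congr rfl fun l _ => ?_
        rw [h1, map_smul, mul_smul_comm, smul_mul_assoc]
      rw [this, hac, Algebra.algebraMap_eq_smul_one, map_smul, hx, smul_zero, zero_mul]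
    intro i j
    rcases Fin.eq_self_or_eq_succAbove s j with rfl | ⟨j, rfl⟩
    · have h3 := congrArg (x ^ (m + 1)) (hac i)
      rw [Fin.sum_univ_succAbove _ j, hcs, one_smul, map_add, map_sum,
        Finset.sum_eq_zero (fun l _ => by rw [map_smul, h2, smul_zero]), add_zero,
        Algebra.algebraMap_eq_smul_one, map_smul, pow_apply_one hx, smul_zero] at h3
      exact h3
    · exact h2 i j

/-- `h ↦ ∑ h₁ φ(h₂)`, the right translation by the form `φ`. -/
def rightTrans (φ : H →ₗ[k] k) : H →ₗ[k] H :=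
  (TensorProduct.rid k H).toLinearMap ∘ₗ LinearMap.lTensor H φ ∘ₗ comul

lemma comul_rightTrans (φ : H →ₗ[k] k) (h : H) :
    comul (R := k) (rightTrans φ h) = LinearMap.lTensor H (rightTrans φ) (comul h) := by
  have e : (comul (R := k) (A := H)) ∘ₗ
        (TensorProduct.rid k H).toLinearMap ∘ₗ LinearMap.lTensor H φ =
      LinearMap.lTensor H ((TensorProduct.rid k H).toLinearMap ∘ₗ LinearMap.lTensor H φ) ∘ₗ
        (TensorProduct.assoc k H H H).toLinearMap ∘ₗ LinearMap.rTensor H comul := by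
    apply TensorProduct.ext'
    intro a b
    have : ∀ t : H ⊗[k] H, φ b • t = LinearMap.lTensor H ((TensorProduct.rid k H).toLinearMap ∘ₗ
        LinearMap.lTensor H φ) (TensorProduct.assoc k H H H (t ⊗ₜ b)) := by
      intro t
      induction t with
      | zero => simp
      | add s t hs ht => simp [TensorProduct.add_tmul, hs, ht]
      | tmul s t => simp
    simpa using this (comul a)
  have e2 := congrArg (fun f => f (comul h)) e
  simp only [LinearMap.comp_apply, LinearEquiv.coe_coe, Coalgebra.coassoc_apply] at e2
  refine e2.trans ?_
  rw [← LinearMap.comp_apply, ← LinearMap.lTensor_comp]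
  rfl

/-- The fundamental theorem of comodules: each element of `H` is a linear combination of the
coefficients of a finite-dimensional representation. -/
lemma exists_coeffMatrix (h : H) : ∃ (n : ℕ) (a : Matrix (Fin n) (Fin n) H),
    IsCoeffMatrix (k := k) a ∧
      h ∈ Submodule.span k (Set.range fun p : Fin n × Fin n => a p.1 p.2) := by
  classical
  let b := Module.Free.chooseBasis k H
  let f := TensorProduct.equivFinsuppOfBasisRight (M := H) b (comul (R := k) h)
  -- the subcomodule generated by `h`
  let V : Submodule k H := Submodule.span k (f.support.image f : Finset H)
  have hf : comul (R := k) h = ∑ i ∈ f.support, f i ⊗ₜ[k] b i := by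
    have := (TensorProduct.equivFinsuppOfBasisRight (M := H) b).symm_apply_apply (comul (R := k) h)
    rw [TensorProduct.equivFinsuppOfBasisRight_symm_apply] at this
    exact this.symm
  have hfi : ∀ i, f i = rightTrans (b.coord i) h := by
    intro i
    simp only [f, TensorProduct.equivFinsuppOfBasisRight_apply]
    rfl
  have hfV : ∀ i, f i ∈ V := by
    intro i
    by_cases hi : i ∈ f.support
    · exact Submodule.subset_span (Finset.mem_coe.2 (Finset.mem_image_of_mem f hi))
    · rw [Finsupp.notMem_support_iff.1 hi]
      exact V.zero_mem
  have hV : ∀ v ∈ V, ∃ y : V ⊗[k] H, LinearMap.rTensor H V.subtype y = comul (R := k) v := by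
    intro v hv
    change comul (R := k) v ∈ LinearMap.range (LinearMap.rTensor H V.subtype)
    refine Submodule.span_induction (p := fun v _ => comul (R := k) v ∈
      LinearMap.range (LinearMap.rTensor H V.subtype)) ?_ ?_ ?_ ?_ hv
    · intro v hv
      obtain ⟨i, _, rfl⟩ := Finset.mem_image.1 (Finset.mem_coe.1 hv)
      rw [hfi, comul_rightTrans, hf, map_sum]
      refine Submodule.sum_mem _ fun j _ => ?_
      exact ⟨(⟨f j, hfV j⟩ : V) ⊗ₜ rightTrans (b.coord i) (b j), by simp⟩
    · rw [map_zero]; exact Submodule.zero_mem _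
    · intro x y _ _ hx hy
      rw [map_add]; exact Submodule.add_mem _ hx hy
    · intro r x _ hx
      rw [map_smul]; exact Submodule.smul_mem _ _ hx
  have hhV : h ∈ V := by
    have h1 := congrArg (TensorProduct.rid k H) (Coalgebra.lTensor_counit_comul (R := k) h)
    rw [hf, map_sum, map_sum] at h1
    simp only [LinearMap.lTensor_tmul, TensorProduct.rid_tmul, one_smul] at h1
    rw [← h1]
    exact Submodule.sum_mem _ fun i _ => Submodule.smul_mem _ _ (hfV i)
  have : Module.Finite k V := Module.Finite.span_finset k _
  let v := Module.finBasis k V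
  -- the coaction in the coordinates of a basis of `V`
  have key : ∀ j, ∃ c : Fin (Module.finrank k V) → H,
      comul (R := k) (v j : H) = ∑ i, (v i : H) ⊗ₜ[k] c i := by
    intro j
    obtain ⟨y, hy⟩ := hV (v j) (v j).2
    refine ⟨fun i => TensorProduct.equivFinsuppOfBasisLeft v y i, ?_⟩
    rw [← hy]
    conv_lhs => rw [← (TensorProduct.equivFinsuppOfBasisLeft (N := H) v).symm_apply_apply y,
      TensorProduct.equivFinsuppOfBasisLeft_symm_apply]
    rw [Finsupp.sum_fintype _ _ (fun i => by simp), map_sum]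
    rfl
  choose c hc using key
  -- forms on `H` that restrict to the dual basis
  have hφ : ∀ l, ∃ φ : H →ₗ[k] k, ∀ j, φ (v j : H) =
      (1 : Matrix (Fin (Module.finrank k V)) (Fin (Module.finrank k V)) k) l j := by
    intro l
    obtain ⟨φ, hφ⟩ := LinearMap.exists_extend (v.coord l)
    refine ⟨φ, fun j => ?_⟩
    have := congrArg (fun g => g (v j)) hφ
    simp only [LinearMap.comp_apply, Submodule.subtype_apply] at this
    rw [this, Module.Basis.coord_apply, Module.Basis.repr_self, Finsupp.single_apply,
      Matrix.one_apply]
    simp only [eq_comm]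
  choose φ hφ using hφ
  refine ⟨_, fun i j => c j i, ⟨fun l j => ?_, fun l j => ?_⟩, ?_⟩
  · have h1 := Coalgebra.coassoc_apply (R := k) (v j : H)
    rw [hc, map_sum, map_sum, map_sum] at h1
    simp only [LinearMap.rTensor_tmul, LinearMap.lTensor_tmul, hc, TensorProduct.sum_tmul, map_sum,
      TensorProduct.assoc_tmul] at h1
    have h2 := congrArg (fun t => TensorProduct.lid k _ (LinearMap.rTensor (H ⊗[k] H) (φ l) t)) h1
    simp only [map_sum, LinearMap.rTensor_tmul, TensorProduct.lid_tmul, hφ] at h2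
    simp only [Matrix.one_apply, ite_smul, one_smul, zero_smul, Finset.sum_ite_eq,
      Finset.mem_univ, if_true] at h2
    exact h2.symm
  · have h1 := congrArg (TensorProduct.rid k H) (Coalgebra.lTensor_counit_comul (R := k) (v j : H))
    rw [hc, map_sum, map_sum] at h1
    simp only [LinearMap.lTensor_tmul, TensorProduct.rid_tmul, one_smul] at h1
    have h2 := congrArg (φ l) h1
    simp only [map_sum, map_smul, hφ, smul_eq_mul, Matrix.one_apply, mul_ite, mul_one, mul_zero,
      Finset.sum_ite_eq, Finset.mem_univ, if_true] at h2
    rw [h2, Matrix.one_apply]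
  · have h0 : ∀ w ∈ V, w ∈ Submodule.span k
        (Set.range fun p : Fin (Module.finrank k V) × Fin (Module.finrank k V) => c p.2 p.1) := by
      intro w hw
      have h1 := congrArg (fun z : V => (z : H)) (v.sum_repr ⟨w, hw⟩)
      simp only [Submodule.coe_sum, Submodule.coe_smul] at h1
      rw [← h1]
      refine Submodule.sum_mem _ fun j _ => Submodule.smul_mem _ _ ?_
      have h2 := congrArg (TensorProduct.lid k H)
        (Coalgebra.rTensor_counit_comul (R := k) (v j : H))
      rw [hc, map_sum, map_sum] at h2
      simp only [LinearMap.rTensor_tmul, TensorProduct.lid_tmul, one_smul] at h2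
      rw [← h2]
      exact Submodule.sum_mem _ fun i _ =>
        Submodule.smul_mem _ _ (Submodule.subset_span ⟨(i, j), rfl⟩)
    exact h0 h hhV

/-- Over a unipotent group, every form vanishing at `1` is locally nilpotent. -/
lemma locNil_of_apply_one (hU : IsUnipotent k H) {x : Conv k H A} (hx : x 1 = 0) : LocNil x := by
  intro h
  obtain ⟨n, a, ha, hh⟩ := exists_coeffMatrix (k := k) h
  filter_upwards [Filter.eventually_ge_atTop n] with m hm
  refine Submodule.span_induction (p := fun y _ => (x ^ m) y = 0) ?_ ?_ ?_ ?_ hh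
  · rintro _ ⟨p, rfl⟩
    exact pow_coeffMatrix_eq_zero hU hx n a ha m hm _ _
  · exact map_zero _
  · intro y z _ _ hy hz
    rw [map_add, hy, hz, add_zero]
  · intro r y _ hy
    rw [map_smul, hy, smul_zero]

/-- A bilinear form on `H`, as a form on `H` with values in the convolution algebra of `H`. -/
def curry (x : Conv k (H ⊗[k] H) A) : Conv k H (Conv k H A) :=
  toConv ((WithConv.linearEquiv k (H →ₗ[k] A)).symm.toLinearMap ∘ₗ TensorProduct.curry x.ofConv)

lemma curry_apply (x : Conv k (H ⊗[k] H) A) (a b : H) : curry x a b = x (a ⊗ₜ b) := rfl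

lemma curry_mul (x y : Conv k (H ⊗[k] H) A) : curry (x * y) = curry x * curry y := by
  refine conv_ext fun a => conv_ext fun b => ?_
  rw [curry_apply, (ℛ k a).convMul_apply, sum_conv_apply]
  simp only [((ℛ k a).tmul (ℛ k b)).convMul_apply, Coalgebra.Repr.tmul_index,
    Finset.sum_product]
  refine Finset.sum_congr rfl fun i _ => ?_
  rw [(ℛ k b).convMul_apply]
  rfl

lemma curry_one : curry (1 : Conv k (H ⊗[k] H) A) = 1 := by
  refine conv_ext fun a => conv_ext fun b => ?_
  rw [curry_apply, LinearMap.convOne_apply, LinearMap.convOne_apply, TensorProduct.counit_tmul,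
    LinearMap.convAlgebraMap_apply, smul_eq_mul, map_mul, Algebra.smul_def]
  exact Algebra.commutes _ _

lemma curry_pow (x : Conv k (H ⊗[k] H) A) (n : ℕ) : curry (x ^ n) = curry x ^ n := by
  induction n with
  | zero => exact curry_one
  | succ n ih => rw [pow_succ, curry_mul, ih, pow_succ]

/-- Over a unipotent group, a bilinear form `x` with `x(1, b) = 0` is locally nilpotent, since it
is a form on `H` vanishing at `1`, with values in the convolution algebra of `H`. -/
lemma locNil_of_one_tmul (hU : IsUnipotent k H) {x : Conv k (H ⊗[k] H) A}
    (hx : ∀ b, x (1 ⊗ₜ b) = 0) : LocNil x := by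
  have h1 : LocNil (curry x) := locNil_of_apply_one hU (conv_ext fun b => hx b)
  intro t
  induction t with
  | zero => exact Filter.Eventually.of_forall fun n => map_zero _
  | add s t hs ht =>
    filter_upwards [hs, ht] with n h2 h3
    rw [map_add, h2, h3, add_zero]
  | tmul a b =>
    filter_upwards [h1 a] with n hn
    rw [← curry_apply, curry_pow, hn]
    rfl

lemma LocNil.of_pre {C : Type v} [AddCommGroup C] [Module k C] [Coalgebra k C]
    {D : Type v} [AddCommGroup D] [Module k D] [Coalgebra k D] {g : D →ₗc[k] C}
    (hg : Function.Surjective g) {x : Conv k C A} (hx : LocNil (InvCoh.pre A g x)) : LocNil x := by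
  intro c
  obtain ⟨d, rfl⟩ := hg c
  filter_upwards [hx d] with n hn
  rwa [← map_pow] at hn

end Unipotent

/-! ### The logarithm of the identity, and invariance under the Lie algebra -/

section LogId

variable {k : Type u} [Field k] [CharZero k]
variable {H : Type v} [CommRing H] [HopfAlgebra k H]
variable {R : Type w} [CommRing R] [Algebra k R]

/-- The exponential of a primitive form is multiplicative. -/
lemma copr_cexp {x : Conv k H R} (hx : LocNil x)
    (h : copr x = pre R (fst k H) x + pre R (snd k H) x) :
    copr (cexp x) = tens (cexp x) (cexp x) := by
  rw [tens, pre_cexp hx, pre_cexp hx, pre_cexp hx, h,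
    cexp_add (hx.pre _) (hx.pre _) (commute_fst_snd x x)]

/-- The logarithm of a multiplicative form is primitive. -/
lemma copr_of_copr_cexp {x : Conv k H R} (hx : LocNil x)
    (h : copr (cexp x) = tens (cexp x) (cexp x)) :
    copr x = pre R (fst k H) x + pre R (snd k H) x := by
  refine cexp_injective (hx.pre _) ((hx.pre _).add (hx.pre _) (commute_fst_snd x x)) ?_
  rw [← pre_cexp hx, h, tens, cexp_add (hx.pre _) (hx.pre _) (commute_fst_snd x x),
    pre_cexp hx, pre_cexp hx]

variable (k H) in
/-- The identity of `H` as an element of the convolution algebra. -/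
def idC : Conv k H H := toConv LinearMap.id

variable (k H) in
/-- The convolution logarithm of the identity of `H`: the projection of `H = O(U)` onto a space
of generators given by the exponential coordinates of `U`. -/
def logId : Conv k H H := clog (idC k H)

lemma locNil_idC_sub_one (hU : IsUnipotent k H) : LocNil (idC k H - 1) := by
  refine locNil_of_apply_one hU ?_
  change (1 : H) - algebraMap k H (counit (1 : H)) = 0
  simp

lemma locNil_logId (hU : IsUnipotent k H) : LocNil (logId k H) :=
  locNil_clog (locNil_idC_sub_one hU)

lemma cexp_logId (hU : IsUnipotent k H) : cexp (logId k H) = idC k H :=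
  cexp_clog (locNil_idC_sub_one hU)

lemma copr_idC : copr (idC k H) = tens (idC k H) (idC k H) := by
  apply WithConv.ext
  apply TensorProduct.ext'
  intro a b
  exact (tens_tmul (idC k H) (idC k H) a b).symm

lemma copr_logId (hU : IsUnipotent k H) :
    copr (logId k H) = pre H (fst k H) (logId k H) + pre H (snd k H) (logId k H) := by
  refine copr_of_copr_cexp (locNil_logId hU) ?_
  rw [cexp_logId hU, copr_idC]

lemma logId_mul (hU : IsUnipotent k H) (a b : H) :
    logId k H (a * b) =
      counit (R := k) b • logId k H a + counit (R := k) a • logId k H b := by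
  have h := congrArg (fun f : Conv k (H ⊗[k] H) H => f (a ⊗ₜ b)) (copr_logId hU)
  change logId k H (a * b) =
    logId k H (counit (R := k) b • a) + logId k H (counit (R := k) a • b) at h
  rw [h, map_smul, map_smul]

lemma logId_one (hU : IsUnipotent k H) : logId k H 1 = 0 := by
  have h := logId_mul hU (1 : H) 1
  simpa using h

/-- Linear forms composed with `logId` are point derivations. -/
lemma comp_logId_mem (hU : IsUnipotent k H) (φ : H →ₗ[k] k) :
    (toConv (φ ∘ₗ (logId k H).ofConv) : Conv k H k) ∈ lieAlg k H := by
  intro a b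
  change φ (logId k H (a * b)) = counit (R := k) a * φ (logId k H b) +
    φ (logId k H a) * counit (R := k) b
  rw [logId_mul hU, map_add, map_smul, map_smul, smul_eq_mul, smul_eq_mul]
  ring

/-- A `k`-valued form, viewed with values in `R`. -/
abbrev scal {C : Type v} [AddCommGroup C] [Module k C] [Coalgebra k C]
    (R : Type w) [Ring R] [Algebra k R] (z : Conv k C k) : Conv k C R :=
  post C (Algebra.ofId k R) z

/-- The forms on `H` separate the elements of `R ⊗ H`. -/
lemma eq_of_evalR {t t' : R ⊗[k] H}
    (h : ∀ φ : H →ₗ[k] k, evalR (scal R (toConv φ)) t = evalR (scal R (toConv φ)) t') :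
    t = t' := by
  let b := Module.Free.chooseBasis k H
  apply (b.baseChange R).ext_elem
  intro i
  have key : ∀ t : R ⊗[k] H,
      (b.baseChange R).repr t i = evalR (scal R (toConv (b.coord i))) t := by
    intro t
    induction t with
    | zero => simp
    | add s t hs ht => simp [hs, ht]
    | tmul r h => simp [evalR, Algebra.smul_def, Algebra.ofId_apply, mul_comm]
  rw [key, key, h]

/-- A form that commutes with the pull-back of the Lie algebra along `g` commutes with the
universal form, the pull-back along `g` of the identity: the latter is an exponential, whose
exponent has its coefficients in the Lie algebra. -/
lemma commute_universal (hU : IsUnipotent k H) {C : Type v} [AddCommGroup C] [Module k C]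
    [Coalgebra k C] (g : C →ₗc[k] H) {F : Conv k C R}
    (hF : ∀ z ∈ lieAlg k H, Commute F (pre R g (scal R z))) :
    Commute (post C (Algebra.TensorProduct.includeLeft : R →ₐ[k] R ⊗[k] H) F)
      (pre (R ⊗[k] H) g
        (post H (Algebra.TensorProduct.includeRight : H →ₐ[k] R ⊗[k] H) (idC k H))) := by
  have hl := locNil_logId hU
  rw [← cexp_logId hU, post_cexp hl, pre_cexp (hl.post _)]
  refine cexp_commute ((hl.post _).pre _) ?_
  refine conv_ext fun c => eq_of_evalR fun φ => ?_
  have h := congrArg (fun f : Conv k C R => f c) (hF _ (comp_logId_mem hU φ)).eq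
  simp only [(ℛ k c).convMul_apply] at h
  simp only [(ℛ k c).convMul_apply, map_sum]
  simp only [post_apply, pre_apply, Algebra.TensorProduct.includeLeft_apply, evalR_mul_left,
    evalR_mul_right, Algebra.TensorProduct.includeRight_apply] at h ⊢
  simpa [evalR] using h

lemma commute_pre_of_lieAlg (hU : IsUnipotent k H) {C : Type v} [AddCommGroup C] [Module k C]
    [Coalgebra k C] (g : C →ₗc[k] H) {F : Conv k C R}
    (hF : ∀ z ∈ lieAlg k H, Commute F (pre R g (scal R z))) (y : Conv k H R) :
    Commute F (pre R g y) := by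
  refine conv_ext fun c => ?_
  have h := congrArg (fun f : Conv k C (R ⊗[k] H) => evalR y (f c)) (commute_universal hU g hF).eq
  simp only [(ℛ k c).convMul_apply, map_sum] at h
  simp only [(ℛ k c).convMul_apply]
  simp only [post_apply, Algebra.TensorProduct.includeLeft_apply, evalR_mul_left,
    evalR_mul_right] at h
  simpa [idC, evalR] using h

/-- Invariance under the Lie algebra implies invariance. -/
lemma isInvariant_of_lieAlg (hU : IsUnipotent k H) {F : Conv k (H ⊗[k] H) R}
    (hF : ∀ z ∈ lieAlg k H, Commute F (copr (scal R z))) : IsInvariant F :=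
  commute_universal hU (Bialgebra.mulCoalgHom k H) hF

/-- A form that commutes with the Lie algebra is central. -/
lemma central_of_lieAlg (hU : IsUnipotent k H) {f : Conv k H R}
    (hf : ∀ z ∈ lieAlg k H, Commute f (scal R z)) (y : Conv k H R) : Commute f y :=
  commute_pre_of_lieAlg hU (CoalgHom.id k H) hf y

lemma comp_scal_mul {C : Type v} [AddCommGroup C] [Module k C] [Coalgebra k C]
    {A : Type w} [Ring A] [Algebra k A] {B : Type w'} [Ring B] [Algebra k B] (ψ : A →ₗ[k] B)
    (z : Conv k C k) (y : Conv k C A) :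
    (toConv (ψ ∘ₗ (scal A z * y).ofConv) : Conv k C B) =
      scal B z * toConv (ψ ∘ₗ y.ofConv) := by
  refine conv_ext fun c => ?_
  change ψ ((scal A z * y) c) = _
  simp only [(ℛ k c).convMul_apply, map_sum]
  refine Finset.sum_congr rfl fun i _ => ?_
  simp [Algebra.ofId_apply, ← Algebra.smul_def]

lemma comp_mul_scal {C : Type v} [AddCommGroup C] [Module k C] [Coalgebra k C]
    {A : Type w} [Ring A] [Algebra k A] {B : Type w'} [Ring B] [Algebra k B] (ψ : A →ₗ[k] B)
    (z : Conv k C k) (y : Conv k C A) :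
    (toConv (ψ ∘ₗ (y * scal A z).ofConv) : Conv k C B) =
      toConv (ψ ∘ₗ y.ofConv) * scal B z := by
  refine conv_ext fun c => ?_
  change ψ ((y * scal A z) c) = _
  simp only [(ℛ k c).convMul_apply, map_sum]
  refine Finset.sum_congr rfl fun i _ => ?_
  simp [Algebra.ofId_apply, ← Algebra.commutes, ← Algebra.smul_def]

/-- The infinitesimal conjugation `h ↦ ∑ z(h₁) h₂ - h₁ z(h₂)` by `z`. -/
def adj (z : Conv k H k) : H →ₗ[k] H := (scal H z * idC k H - idC k H * scal H z).ofConv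

lemma comp_adj {B : Type w'} [Ring B] [Algebra k B] (z : Conv k H k) (ψ : H →ₗ[k] B) :
    (toConv (ψ ∘ₗ adj z) : Conv k H B) = scal B z * toConv ψ - toConv ψ * scal B z := by
  have h1 := comp_scal_mul ψ z (idC k H)
  have h2 := comp_mul_scal ψ z (idC k H)
  refine conv_ext fun c => ?_
  have h1' := congrArg (fun f : Conv k H B => f c) h1
  have h2' := congrArg (fun f : Conv k H B => f c) h2
  change ψ ((scal H z * idC k H) c - (idC k H * scal H z) c) = _
  rw [map_sub]
  exact congrArg₂ (· - ·) h1' h2'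

lemma copr_scal {z : Conv k H k} (hz : z ∈ lieAlg k H) (B : Type w') [Ring B] [Algebra k B] :
    pre B (Bialgebra.mulCoalgHom k H) (scal B z) =
      pre B (fst k H) (scal B z) + pre B (snd k H) (scal B z) := by
  have h := (leibniz_iff z).1 hz
  exact (congrArg (post _ (Algebra.ofId k B)) h).trans (map_add _ _ _)

/-- Infinitesimal conjugation is a derivation of the algebra `H`. -/
lemma adj_mul {z : Conv k H k} (hz : z ∈ lieAlg k H) (a b : H) :
    adj z (a * b) = adj z a * b + a * adj z b := by
  have h : copr (toConv (adj z) : Conv k H H) =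
      tens (toConv (adj z)) (idC k H) + tens (idC k H) (toConv (adj z)) := by
    have hA : (toConv (adj z) : Conv k H H) = scal H z * idC k H - idC k H * scal H z := rfl
    rw [hA, map_sub, map_mul, map_mul, copr_idC, copr_scal hz]
    simp only [tens, map_sub, map_mul]
    have c1 := (commute_fst_snd (scal H z) (idC k H)).eq
    have c2 := (commute_fst_snd (idC k H) (scal H z)).eq
    set z1 := pre H (fst k H) (scal H z)
    set z2 := pre H (snd k H) (scal H z)
    set i1 := pre H (fst k H) (idC k H)
    set i2 := pre H (snd k H) (idC k H)
    calc (z1 + z2) * (i1 * i2) - i1 * i2 * (z1 + z2)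
        = z1 * i1 * i2 + (z2 * i1) * i2 - i1 * (i2 * z1) - i1 * i2 * z2 := by noncomm_ring
      _ = z1 * i1 * i2 + (i1 * z2) * i2 - i1 * (z1 * i2) - i1 * i2 * z2 := by rw [c1, c2]
      _ = _ := by noncomm_ring
  have h' := congrArg (fun f : Conv k (H ⊗[k] H) H => f (a ⊗ₜ b)) h
  change adj z (a * b) = (tens (toConv (adj z)) (idC k H)) (a ⊗ₜ b) +
    (tens (idC k H) (toConv (adj z))) (a ⊗ₜ b) at h'
  rwa [tens_tmul, tens_tmul] at h'

lemma counit_adj (z : Conv k H k) (a : H) : counit (R := k) (adj z a) = 0 := by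
  have h := congrArg (fun f : Conv k H k => f a) (comp_adj z (counit (R := k) (A := H)))
  have h1 : (toConv (counit (R := k) (A := H)) : Conv k H k) = 1 := rfl
  rw [h1, one_mul, mul_one, sub_self] at h
  exact h

/-- The logarithm of the identity commutes with infinitesimal conjugation. -/
lemma adj_comp_logId (hU : IsUnipotent k H) {z : Conv k H k} (hz : z ∈ lieAlg k H) :
    (toConv (adj z ∘ₗ (logId k H).ofConv) : Conv k H H) =
      scal H z * logId k H - logId k H * scal H z := by
  refine comp_ev_of_leibniz (adj_mul hz) (locNil_idC_sub_one hU) ?_ _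
  have h1 : adj z (1 : H) = 0 := by simpa using adj_mul hz (1 : H) 1
  refine conv_ext fun c => ?_
  have h2 : adj z (c - algebraMap k H (counit c)) = adj z c := by
    rw [map_sub, Algebra.algebraMap_eq_smul_one, map_smul, h1, smul_zero, sub_zero]
  refine h2.trans ?_
  rw [mul_sub, sub_mul, mul_one, one_mul, sub_sub_sub_cancel_right]
  rfl

end LogId

/-! ### Additive cocycles -/

section Additive

variable {k : Type u} [Field k]
variable {H : Type v} [CommRing H] [HopfAlgebra k H]
variable {R : Type w} [CommRing R] [Algebra k R]

variable (k H) in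
/-- `b ↦ 1 ⊗ b` -/
def inr : H →ₗc[k] H ⊗[k] H where
  toLinearMap := TensorProduct.mk k H H 1
  counit_comp := by ext a; simp
  map_comp_comul := by
    ext a
    simp only [LinearMap.comp_apply, TensorProduct.mk_apply, TensorProduct.comul_tmul,
      Bialgebra.comul_one, ← (ℛ k a).eq, map_sum, TensorProduct.tmul_sum,
      Algebra.TensorProduct.one_def]
    simp

variable (k H) in
/-- `a ↦ a ⊗ 1` -/
def inl : H →ₗc[k] H ⊗[k] H where
  toLinearMap := (TensorProduct.mk k H H).flip 1
  counit_comp := by ext a; simp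
  map_comp_comul := by
    ext a
    simp only [LinearMap.comp_apply, TensorProduct.mk_apply, LinearMap.flip_apply,
      TensorProduct.comul_tmul, Bialgebra.comul_one, ← (ℛ k a).eq, map_sum,
      TensorProduct.sum_tmul, Algebra.TensorProduct.one_def]
    simp

/-- `j` is a Hochschild `2`-cocycle of the algebra `H` with trivial coefficients `R`:
`j(ab, c) + j(a, b) ε(c) = j(a, bc) + ε(a) j(b, c)`, normalized by `j(1, a) = 0 = j(a, 1)`. -/
structure IsAddCocycle (j : Conv k (H ⊗[k] H) R) : Prop where
  cocycle : pre R (mul12 k H) j + pre R (proj12 k H) j =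
    pre R (mul23 k H) j + pre R (proj23 k H) j
  one_left : pre R (inr k H) j = 0
  right_one : pre R (inl k H) j = 0

lemma IsAddCocycle.apply {j : Conv k (H ⊗[k] H) R} (hj : IsAddCocycle j) (a b c : H) :
    j ((a * b) ⊗ₜ c) + counit (R := k) c • j (a ⊗ₜ b) =
      j (a ⊗ₜ (b * c)) + counit (R := k) a • j (b ⊗ₜ c) := by
  have h := congrArg (fun f : Conv k (H ⊗[k] (H ⊗[k] H)) R => f (a ⊗ₜ (b ⊗ₜ c))) hj.cocycle
  change j (mul12 k H (a ⊗ₜ (b ⊗ₜ c))) + j (proj12 k H (a ⊗ₜ (b ⊗ₜ c))) =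
    j (mul23 k H (a ⊗ₜ (b ⊗ₜ c))) + j (proj23 k H (a ⊗ₜ (b ⊗ₜ c))) at h
  simpa using h

lemma isAddCocycle_of_apply {j : Conv k (H ⊗[k] H) R}
    (h : ∀ a b c : H, j ((a * b) ⊗ₜ c) + counit (R := k) c • j (a ⊗ₜ b) =
      j (a ⊗ₜ (b * c)) + counit (R := k) a • j (b ⊗ₜ c))
    (h1 : ∀ a, j (1 ⊗ₜ a) = 0) (h2 : ∀ a, j (a ⊗ₜ 1) = 0) : IsAddCocycle j where
  cocycle := by
    apply WithConv.ext
    apply TensorProduct.ext_threefold'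
    intro a b c
    change j (mul12 k H (a ⊗ₜ (b ⊗ₜ c))) + j (proj12 k H (a ⊗ₜ (b ⊗ₜ c))) =
      j (mul23 k H (a ⊗ₜ (b ⊗ₜ c))) + j (proj23 k H (a ⊗ₜ (b ⊗ₜ c)))
    simpa using h a b c
  one_left := conv_ext h1
  right_one := conv_ext h2

lemma IsAddCocycle.one_tmul {j : Conv k (H ⊗[k] H) R} (hj : IsAddCocycle j) (a : H) :
    j (1 ⊗ₜ a) = 0 := congrArg (fun f : Conv k H R => f a) hj.one_left

lemma IsAddCocycle.tmul_one {j : Conv k (H ⊗[k] H) R} (hj : IsAddCocycle j) (a : H) :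
    j (a ⊗ₜ 1) = 0 := congrArg (fun f : Conv k H R => f a) hj.right_one

lemma IsAddCocycle.add {j j' : Conv k (H ⊗[k] H) R} (hj : IsAddCocycle j)
    (hj' : IsAddCocycle j') : IsAddCocycle (j + j') where
  cocycle := by
    simp only [map_add]
    rw [add_add_add_comm, hj.cocycle, hj'.cocycle, add_add_add_comm]
  one_left := by rw [map_add, hj.one_left, hj'.one_left, add_zero]
  right_one := by rw [map_add, hj.right_one, hj'.right_one, add_zero]

lemma IsAddCocycle.smul {j : Conv k (H ⊗[k] H) R} (hj : IsAddCocycle j) (r : k) :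
    IsAddCocycle (r • j) := by
  refine isAddCocycle_of_apply (fun a b c => ?_) (fun a => ?_) (fun a => ?_)
  · have h := congrArg (fun x => r • x) (hj.apply a b c)
    simp only [smul_add] at h
    rw [smul_comm r (counit c), smul_comm r (counit a)] at h
    exact h
  · exact (congrArg (fun x => r • x) (hj.one_tmul a)).trans (smul_zero r)
  · exact (congrArg (fun x => r • x) (hj.tmul_one a)).trans (smul_zero r)

lemma IsAddCocycle.swap {j : Conv k (H ⊗[k] H) R} (hj : IsAddCocycle j) :
    IsAddCocycle (pre R (swap k H) j) := by
  refine isAddCocycle_of_apply (fun a b c => ?_) (fun a => hj.tmul_one a)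
    (fun a => hj.one_tmul a)
  change j (c ⊗ₜ (a * b)) + counit (R := k) c • j (b ⊗ₜ a) =
    j ((b * c) ⊗ₜ a) + counit (R := k) a • j (c ⊗ₜ b)
  rw [mul_comm a b, mul_comm b c, hj.apply]

lemma copr_swap (y : Conv k H R) : pre R (swap k H) (copr y) = copr y := by
  apply WithConv.ext
  apply TensorProduct.ext'
  intro a b
  change y (b * a) = y (a * b)
  rw [mul_comm]

lemma mulR_swap : pre (R ⊗[k] H) (swap k H) (mulR k H R) = mulR k H R := by
  apply WithConv.ext
  apply TensorProduct.ext'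
  intro a b
  change (1 : R) ⊗ₜ[k] (b * a) = 1 ⊗ₜ[k] (a * b)
  rw [mul_comm]

lemma IsInvariant.swap {j : Conv k (H ⊗[k] H) R} (hj : IsInvariant j) :
    IsInvariant (pre R (swap k H) j) := by
  have h := congrArg (pre (R ⊗[k] H) (InvCoh.swap k H)) hj
  rw [map_mul, map_mul, mulR_swap] at h
  exact h

lemma toR_smul (r : k) (j : Conv k (H ⊗[k] H) R) : toR (r • j) = r • toR j :=
  conv_ext fun _ => map_smul (Algebra.TensorProduct.includeLeft : R →ₐ[k] R ⊗[k] H) _ _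

lemma IsInvariant.smul {j : Conv k (H ⊗[k] H) R} (hj : IsInvariant j) (r : k) :
    IsInvariant (r • j) := by
  rw [IsInvariant, toR_smul, smul_mul_assoc, mul_smul_comm, hj]

lemma IsInvariant.add {j j' : Conv k (H ⊗[k] H) R} (hj : IsInvariant j) (hj' : IsInvariant j') :
    IsInvariant (j + j') := by
  rw [IsInvariant, toR, map_add, add_mul, mul_add]
  exact congrArg₂ (· + ·) hj hj'

lemma IsInvariant.sub {j j' : Conv k (H ⊗[k] H) R} (hj : IsInvariant j) (hj' : IsInvariant j') :
    IsInvariant (j - j') := by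
  rw [IsInvariant, toR, map_sub, sub_mul, mul_sub]
  exact congrArg₂ (· - ·) hj hj'

/-- Invariant additive cocycles are closed under the commutator. -/
lemma IsAddCocycle.commutator {j j' : Conv k (H ⊗[k] H) R} (hj : IsAddCocycle j)
    (hj' : IsAddCocycle j') (hi : IsInvariant j) (hi' : IsInvariant j') :
    IsAddCocycle (j * j' - j' * j) where
  cocycle := by
    have c1 := (proj12_commute hi j').eq
    have c2 := (proj12_commute hi' j).eq
    have c3 := (proj23_commute hi j').eq
    have c4 := (proj23_commute hi' j).eq
    have e := hj.cocycle
    have e' := hj'.cocycle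
    simp only [map_sub, map_mul]
    set a := pre R (mul12 k H) j
    set b := pre R (proj12 k H) j
    set c := pre R (mul23 k H) j
    set d := pre R (proj23 k H) j
    set a' := pre R (mul12 k H) j'
    set b' := pre R (proj12 k H) j'
    set c' := pre R (mul23 k H) j'
    set d' := pre R (proj23 k H) j'
    calc a * a' - a' * a + (b * b' - b' * b)
        = (a + b) * (a' + b') - (a' + b') * (a + b) - (b * a' - a' * b) + (b' * a - a * b') := by
          noncomm_ring
      _ = (c + d) * (c' + d') - (c' + d') * (c + d) - (d * c' - c' * d) + (d' * c - c * d') := by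
          rw [e, e', c1, c2, c3, c4]; simp only [sub_self]
      _ = _ := by noncomm_ring
  one_left := by
    rw [map_sub, map_mul, map_mul, hj.one_left, hj'.one_left, zero_mul, sub_zero]
  right_one := by
    rw [map_sub, map_mul, map_mul, hj.right_one, hj'.right_one, zero_mul, sub_zero]

lemma IsAddCocycle.locNil (hU : IsUnipotent k H) {j : Conv k (H ⊗[k] H) R}
    (hj : IsAddCocycle j) : LocNil j := locNil_of_one_tmul hU hj.one_tmul

variable [CharZero k]

/-- The exponential of an invariant additive cocycle is an invariant Hopf cocycle. -/
lemma isHopfCocycle_cexp (hU : IsUnipotent k H) {j : Conv k (H ⊗[k] H) R} (hj : IsAddCocycle j)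
    (hi : IsInvariant j) : IsHopfCocycle (cexp j) where
  isUnit := (cexpU j (hj.locNil hU)).isUnit
  cocycle := by
    have hl := hj.locNil hU
    rw [pre_cexp hl, pre_cexp hl, pre_cexp hl, pre_cexp hl,
      ← cexp_add (hl.pre _) (hl.pre _) (proj12_commute hi j).symm,
      ← cexp_add (hl.pre _) (hl.pre _) (proj23_commute hi j).symm, hj.cocycle]
  right_one a := by
    have h := pre_cexp (hj.locNil hU) (inl k H)
    rw [hj.right_one, cexp_zero] at h
    exact congrArg (fun f : Conv k H R => f a) h
  one_left a := by
    have h := pre_cexp (hj.locNil hU) (inr k H)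
    rw [hj.one_left, cexp_zero] at h
    exact congrArg (fun f : Conv k H R => f a) h

lemma isInvariant_cexp {j : Conv k (H ⊗[k] H) R} (hl : LocNil j)
    (hi : IsInvariant j) : IsInvariant (cexp j) := by
  rw [IsInvariant, toR, post_cexp hl]
  exact (cexp_commute (hl.post _) (Commute.symm hi)).symm.eq

lemma isInvariant_of_cexp {j : Conv k (H ⊗[k] H) R} (hl : LocNil j)
    (hi : IsInvariant (cexp j)) : IsInvariant j := by
  rw [IsInvariant, toR, post_cexp hl] at hi
  exact (commute_of_commute_cexp (hl.post _) (Commute.symm hi)).symm.eq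

lemma IsHopfCocycle.locNil_sub_one (hU : IsUnipotent k H) {J : Conv k (H ⊗[k] H) R}
    (hJ : IsHopfCocycle J) : LocNil (J - 1) := by
  refine locNil_of_one_tmul hU fun b => ?_
  change J (1 ⊗ₜ b) - algebraMap k R (counit (1 ⊗ₜ[k] b)) = 0
  rw [hJ.one_left]
  simp

/-- The logarithm of an invariant Hopf cocycle `J` is an additive cocycle: by invariance, the two
factors on each side of the cocycle equation of `J` commute. -/
lemma isAddCocycle_clog (hU : IsUnipotent k H) {J : Conv k (H ⊗[k] H) R} (hJ : IsHopfCocycle J)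
    (hi : IsInvariant J) : IsAddCocycle (clog J) ∧ IsInvariant (clog J) := by
  have h1 := hJ.locNil_sub_one hU
  have hl : LocNil (clog J) := locNil_clog h1
  have he : cexp (clog J) = J := cexp_clog h1
  have hij : IsInvariant (clog J) := isInvariant_of_cexp hl (by rw [he]; exact hi)
  refine ⟨⟨?_, ?_, ?_⟩, hij⟩
  · have c1 := (proj12_commute hij (clog J)).symm
    have c2 := (proj23_commute hij (clog J)).symm
    refine cexp_injective ((hl.pre _).add (hl.pre _) c1) ((hl.pre _).add (hl.pre _) c2) ?_
    rw [cexp_add (hl.pre _) (hl.pre _) c1, cexp_add (hl.pre _) (hl.pre _) c2, ← pre_cexp hl,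
      ← pre_cexp hl, ← pre_cexp hl, ← pre_cexp hl, he, hJ.cocycle]
  · refine cexp_injective (hl.pre _) locNil_zero ?_
    rw [← pre_cexp hl, he, cexp_zero]
    exact conv_ext hJ.one_left
  · refine cexp_injective (hl.pre _) locNil_zero ?_
    rw [← pre_cexp hl, he, cexp_zero]
    exact conv_ext hJ.right_one

/-! ### Symmetric additive cocycles are coboundaries -/

variable (k H R) in
/-- A symmetric normalized additive cocycle. -/
structure SymCocycle where
  form : Conv k (H ⊗[k] H) R
  isAddCocycle : IsAddCocycle form
  symm : pre R (swap k H) form = form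

/-- The commutative extension of `H` by the square-zero ideal `R` defined by a symmetric cocycle
`σ`: the space `H × R` with the product `(a, u)(b, v) = (ab, ε(a)v + ε(b)u + σ(a, b))`. -/
@[nolint unusedArguments]
def SqZeroExt (_ : SymCocycle k H R) : Type (max v w) := H × R

namespace SqZeroExt

variable (s : SymCocycle k H R)

instance : AddCommGroup (SqZeroExt s) := inferInstanceAs (AddCommGroup (H × R))

instance : Module k (SqZeroExt s) := inferInstanceAs (Module k (H × R))

instance : Mul (SqZeroExt s) where
  mul x y := (x.1 * y.1, counit (R := k) x.1 • y.2 + counit (R := k) y.1 • x.2 +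
    s.form (x.1 ⊗ₜ y.1))

instance : One (SqZeroExt s) where
  one := (1, 0)

variable {s} in
@[ext] lemma ext {x y : SqZeroExt s} (h1 : x.1 = y.1) (h2 : x.2 = y.2) : x = y := Prod.ext h1 h2

@[simp] lemma mul_fst (x y : SqZeroExt s) : (x * y).1 = x.1 * y.1 := rfl
@[simp] lemma mul_snd (x y : SqZeroExt s) : (x * y).2 = counit (R := k) x.1 • y.2 +
    counit (R := k) y.1 • x.2 + s.form (x.1 ⊗ₜ y.1) := rfl
@[simp] lemma one_fst : (1 : SqZeroExt s).1 = 1 := rfl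
@[simp] lemma one_snd : (1 : SqZeroExt s).2 = 0 := rfl
@[simp] lemma add_fst (x y : SqZeroExt s) : (x + y).1 = x.1 + y.1 := rfl
@[simp] lemma add_snd (x y : SqZeroExt s) : (x + y).2 = x.2 + y.2 := rfl
@[simp] lemma zero_fst : (0 : SqZeroExt s).1 = 0 := rfl
@[simp] lemma zero_snd : (0 : SqZeroExt s).2 = 0 := rfl
@[simp] lemma smul_fst (r : k) (x : SqZeroExt s) : (r • x).1 = r • x.1 := rfl
@[simp] lemma smul_snd (r : k) (x : SqZeroExt s) : (r • x).2 = r • x.2 := rfl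

lemma mul_comm' (x y : SqZeroExt s) : x * y = y * x := by
  refine ext (mul_comm _ _) ?_
  have h : s.form (x.1 ⊗ₜ y.1) = s.form (y.1 ⊗ₜ x.1) :=
    congrArg (fun f : Conv k (H ⊗[k] H) R => f (y.1 ⊗ₜ x.1)) s.symm
  rw [mul_snd, mul_snd, h, add_comm (counit (R := k) x.1 • y.2)]

lemma mul_add' (x y z : SqZeroExt s) : x * (y + z) = x * y + x * z := by
  refine ext (mul_add _ _ _) ?_
  simp only [mul_snd, add_snd, add_fst, map_add, TensorProduct.tmul_add, smul_add, add_smul]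
  abel

lemma one_mul' (x : SqZeroExt s) : 1 * x = x := by
  refine ext (one_mul _) ?_
  simp [s.isAddCocycle.one_tmul]

lemma zero_mul' (x : SqZeroExt s) : 0 * x = 0 := by
  refine ext (zero_mul _) ?_
  simp

lemma mul_assoc' (x y z : SqZeroExt s) : x * y * z = x * (y * z) := by
  refine ext (mul_assoc _ _ _) ?_
  have h := s.isAddCocycle.apply x.1 y.1 z.1
  simp only [mul_snd, mul_fst, Bialgebra.counit_mul, smul_add, mul_smul]
  rw [smul_comm (counit (R := k) z.1) (counit (R := k) x.1),
    smul_comm (counit (R := k) z.1) (counit (R := k) y.1)]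
  linear_combination (exp := 1) h

instance : CommRing (SqZeroExt s) :=
  { (inferInstance : AddCommGroup (SqZeroExt s)),
    (inferInstance : Mul (SqZeroExt s)),
    (inferInstance : One (SqZeroExt s)) with
    left_distrib := mul_add' s
    right_distrib := fun x y z => by
      rw [mul_comm' s, mul_add' s, mul_comm' s z, mul_comm' s z]
    zero_mul := zero_mul' s
    mul_zero := fun x => by rw [mul_comm' s, zero_mul' s]
    mul_assoc := mul_assoc' s
    one_mul := one_mul' s
    mul_one := fun x => by rw [mul_comm' s, one_mul' s]
    mul_comm := mul_comm' s }

lemma smul_mul' (r : k) (x y : SqZeroExt s) : r • x * y = r • (x * y) := by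
  refine ext (smul_mul_assoc _ _ _) ?_
  simp only [mul_snd, smul_fst, smul_snd, map_smul, ← TensorProduct.smul_tmul', smul_add,
    smul_eq_mul, mul_smul]
  rw [smul_comm r (counit (R := k) y.1)]

instance : Algebra k (SqZeroExt s) :=
  Algebra.ofModule (smul_mul' s) fun r x y => by rw [mul_comm, smul_mul' s, mul_comm]

/-- The projection onto `H`. -/
def proj : SqZeroExt s →ₐ[k] H :=
  AlgHom.ofLinearMap (LinearMap.fst k H R) rfl fun _ _ => rfl

/-- The linear projection onto `R`. -/
def snd : SqZeroExt s →ₗ[k] R := LinearMap.snd k H R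

/-- The linear inclusion of `H`. -/
def incl : H →ₗ[k] SqZeroExt s := LinearMap.inl k H R

end SqZeroExt

lemma comp_adj_apply (z : Conv k H k) (ψ : H →ₗ[k] R) (a : H) :
    ψ (adj z a) = (scal R z * toConv ψ) a - (toConv ψ * scal R z) a :=
  congrArg (fun f : Conv k H R => f a) (comp_adj z ψ)

/-- An invariant form is annihilated by infinitesimal conjugation. -/
lemma IsInvariant.adj_add {j : Conv k (H ⊗[k] H) R} (hj : IsInvariant j) {z : Conv k H k}
    (hz : z ∈ lieAlg k H) (a b : H) : j (adj z a ⊗ₜ b) + j (a ⊗ₜ adj z b) = 0 := by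
  have h := congrArg (fun f : Conv k (H ⊗[k] H) R => f (a ⊗ₜ b)) (hj.commute_copr (scal R z)).eq
  rw [copr_scal hz, mul_add, add_mul] at h
  change (j * pre R (fst k H) (scal R z)) (a ⊗ₜ b) + (j * pre R (snd k H) (scal R z)) (a ⊗ₜ b) =
    (pre R (fst k H) (scal R z) * j) (a ⊗ₜ b) + (pre R (snd k H) (scal R z) * j) (a ⊗ₜ b) at h
  rw [pre_fst_mul_apply, mul_pre_fst_apply, pre_snd_mul_apply, mul_pre_snd_apply] at h
  have h1 := comp_adj_apply z (j.ofConv ∘ₗ (TensorProduct.mk k H H).flip b) a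
  have h2 := comp_adj_apply z (j.ofConv ∘ₗ TensorProduct.mk k H H a) b
  change j (adj z a ⊗ₜ b) = _ at h1
  change j (a ⊗ₜ adj z b) = _ at h2
  rw [h1, h2]
  linear_combination -h

/-- A symmetric invariant additive cocycle is the coboundary of a central form. The exponential of
`incl ∘ logId` is an algebra section of the square-zero extension defined by the cocycle, and its
component in `R` is the required form; it is central because `logId` is conjugation invariant. -/
lemma exists_central_of_symm (hU : IsUnipotent k H) {j : Conv k (H ⊗[k] H) R}
    (hj : IsAddCocycle j) (hi : IsInvariant j) (hs : pre R (swap k H) j = j) :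
    ∃ f : Conv k H R, f 1 = 0 ∧ (∀ y, Commute f y) ∧
      j = copr f - pre R (fst k H) f - pre R (snd k H) f := by
  let s : SymCocycle k H R := ⟨j, hj, hs⟩
  let x : Conv k H (SqZeroExt s) := toConv (SqZeroExt.incl s ∘ₗ (logId k H).ofConv)
  have hx1 : x 1 = 0 := by
    change SqZeroExt.incl s (logId k H 1) = 0
    rw [logId_one hU, map_zero]
  have hx : LocNil x := locNil_of_apply_one hU hx1
  have hprim : copr x = pre _ (fst k H) x + pre _ (snd k H) x :=
    conv_ext fun t => (congrArg (fun f : Conv k (H ⊗[k] H) H => SqZeroExt.incl s (f t))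
      (copr_logId hU)).trans (map_add _ _ _)
  have hmul := copr_cexp hx hprim
  have hproj : post H (SqZeroExt.proj s) (cexp x) = idC k H := by
    rw [post_cexp hx, ← cexp_logId hU]
    rfl
  have hfst : ∀ a, (cexp x a).1 = a := fun a => congrArg (fun f : Conv k H H => f a) hproj
  let f : Conv k H R := toConv (SqZeroExt.snd s ∘ₗ (cexp x).ofConv)
  have hf : ∀ a b, f (a * b) = counit (R := k) a • f b + counit (R := k) b • f a + j (a ⊗ₜ b) := by
    intro a b
    have h := congrArg (fun g : Conv k (H ⊗[k] H) (SqZeroExt s) => g (a ⊗ₜ b)) hmul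
    have h' : cexp x (a * b) = cexp x a * cexp x b := h.trans (tens_tmul _ _ a b)
    have h2 : (cexp x (a * b)).2 = (cexp x a * cexp x b).2 := by rw [h']
    rw [SqZeroExt.mul_snd, hfst, hfst] at h2
    exact h2
  refine ⟨f, ?_, ?_, ?_⟩
  · have h := hf 1 1
    rw [mul_one, Bialgebra.counit_one, one_smul, hj.one_tmul, add_zero] at h
    simpa using h
  · refine central_of_lieAlg hU fun z hz => ?_
    let T : SqZeroExt s →ₗ[k] SqZeroExt s :=
      SqZeroExt.incl s ∘ₗ adj z ∘ₗ (SqZeroExt.proj s).toLinearMap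
    have hT1 : ∀ y, (T y).1 = adj z y.1 := fun y => rfl
    have hT2 : ∀ y, (T y).2 = 0 := fun y => rfl
    have hT : ∀ y y', T (y * y') = T y * y' + y * T y' := by
      intro y y'
      refine SqZeroExt.ext ?_ ?_
      · simp only [hT1, SqZeroExt.mul_fst, SqZeroExt.add_fst, adj_mul hz]
      · simp only [hT1, hT2, SqZeroExt.mul_snd, SqZeroExt.add_snd, counit_adj, zero_smul,
          smul_zero, zero_add, add_zero]
        exact (hi.adj_add hz _ _).symm
    have hTx : (toConv (T ∘ₗ x.ofConv) : Conv k H (SqZeroExt s)) =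
        scal _ z * x - x * scal _ z := by
      have h1 := congrArg (fun g : Conv k H H =>
        (toConv (SqZeroExt.incl s ∘ₗ g.ofConv) : Conv k H (SqZeroExt s))) (adj_comp_logId hU hz)
      refine h1.trans ?_
      rw [← comp_scal_mul, ← comp_mul_scal]
      exact conv_ext fun c => map_sub (SqZeroExt.incl s) _ _
    have h := comp_ev_of_leibniz hT hx hTx (PowerSeries.exp k)
    have h2 := congrArg (fun g : Conv k H (SqZeroExt s) =>
      (toConv (SqZeroExt.snd s ∘ₗ g.ofConv) : Conv k H R)) h
    have h3 : (0 : Conv k H R) = scal R z * f - f * scal R z := by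
      refine Eq.trans ?_ (h2.trans ?_)
      · rfl
      · rw [← comp_scal_mul, ← comp_mul_scal]
        exact conv_ext fun c => map_sub (SqZeroExt.snd s) _ _
    exact (sub_eq_zero.1 h3.symm).symm
  · apply WithConv.ext
    apply TensorProduct.ext'
    intro a b
    change j (a ⊗ₜ b) = f (a * b) - f (counit (R := k) b • a) - f (counit (R := k) a • b)
    rw [hf, map_smul, map_smul]
    abel

/-! ### Skew-symmetric additive cocycles are biderivations -/

/-- A skew-symmetric additive cocycle is a point derivation in its first argument. -/
lemma IsAddCocycle.mul_tmul {j : Conv k (H ⊗[k] H) R} (hj : IsAddCocycle j)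
    (hs : pre R (InvCoh.swap k H) j = -j) (a b c : H) :
    j ((a * b) ⊗ₜ c) = counit (R := k) a • j (b ⊗ₜ c) + counit (R := k) b • j (a ⊗ₜ c) := by
  have hsw : ∀ x y : H, j (y ⊗ₜ x) = -j (x ⊗ₜ y) := fun x y =>
    congrArg (fun f : Conv k (H ⊗[k] H) R => f (x ⊗ₜ y)) hs
  have h1 := hj.apply a b c
  have h2 := hj.apply b c a
  have h3 := hj.apply c a b
  rw [hsw (b * c) a] at h1
  rw [hsw (c * a) b] at h2
  rw [hsw (a * b) c] at h3
  rw [hsw a c] at h2 h3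
  have h4 : (2 : k) • j ((a * b) ⊗ₜ c) =
      (2 : k) • (counit (R := k) a • j (b ⊗ₜ c) + counit (R := k) b • j (a ⊗ₜ c)) := by
    rw [two_smul, two_smul]
    simp only [smul_neg] at h1 h2 h3
    linear_combination (exp := 1) h1 + h3 - h2
  exact smul_right_injective R (two_ne_zero (α := k)) h4

end Additive

/-! ### Invariant bivectors and skew-symmetric biderivations -/

section Bivectors

variable {k : Type u} [Field k]
variable {H : Type v} [CommRing H] [HopfAlgebra k H]
variable {R : Type w} [CommRing R] [Algebra k R]

lemma lieAlg_apply_mul {z : Conv k H k} (hz : z ∈ lieAlg k H) (a b : H) :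
    z (a * b) = counit (R := k) a * z b + z a * counit (R := k) b := hz a b

lemma lieAlg_sum_apply {ι : Type*} (s : Finset ι) (f : ι → lieAlg k H) (a : H) :
    (∑ i ∈ s, f i : lieAlg k H).1 a = ∑ i ∈ s, (f i).1 a := by
  have h : (∑ i ∈ s, f i : lieAlg k H).1 = ∑ i ∈ s, (f i).1 :=
    map_sum (lieAlg k H).toSubmodule.subtype f s
  rw [h, sum_conv_apply]

lemma lieAlg_apply_one {z : Conv k H k} (hz : z ∈ lieAlg k H) : z 1 = 0 := by
  have h := lieAlg_apply_mul hz (1 : H) 1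
  simpa using h

/-- A linear map with a Leibniz rule at the identity that vanishes on generators is zero. -/
lemma eq_zero_of_leibniz {M : Type*} [AddCommGroup M] [Module k M] {S : Set H}
    (hS : Algebra.adjoin k S = ⊤) (d : H →ₗ[k] M)
    (hd : ∀ a b, d (a * b) = counit (R := k) a • d b + counit (R := k) b • d a)
    (h : ∀ s ∈ S, d s = 0) : d = 0 := by
  have h1 : d 1 = 0 := by simpa using hd 1 1
  ext a
  have ha : a ∈ Algebra.adjoin k S := hS ▸ Algebra.mem_top
  induction ha using Algebra.adjoin_induction with
  | mem x hx => exact h x hx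
  | algebraMap r => rw [Algebra.algebraMap_eq_smul_one, map_smul, h1, smul_zero]; rfl
  | add x y _ _ hx hy => rw [map_add, hx, hy]; simp
  | mul x y _ _ hx hy => rw [hd, hx, hy]; simp

/-- The Lie algebra of an affine algebraic group is finite-dimensional. -/
instance [Algebra.FiniteType k H] : Module.Finite k (lieAlg k H) := by
  obtain ⟨S, hS⟩ := (Algebra.FiniteType.out : (⊤ : Subalgebra k H).FG)
  let e : lieAlg k H →ₗ[k] (S → k) :=
    { toFun := fun z s => z.1 s
      map_add' := fun _ _ => rfl
      map_smul' := fun _ _ => rfl }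
  refine Module.Finite.of_injective e ((injective_iff_map_eq_zero e).2 fun z hz => ?_)
  have h := eq_zero_of_leibniz hS z.1.ofConv
    (fun a b => (lieAlg_apply_mul z.2 a b).trans (by simp [mul_comm]))
    fun s hs => congrFun hz ⟨s, hs⟩
  exact Subtype.ext (conv_ext fun a => congrArg (fun g : H →ₗ[k] k => g a) h)

lemma toDual_tmul_apply (x y : lieAlg k H) (a b : H) :
    toDual k H (x ⊗ₜ y) (a ⊗ₜ b) = x.1 a * y.1 b := rfl

lemma toDual_tmul (x y : lieAlg k H) : toDual k H (x ⊗ₜ y) = tens x.1 y.1 := by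
  apply WithConv.ext
  apply TensorProduct.ext'
  intro a b
  exact (tens_tmul _ _ a b).symm

lemma toDual_injective : Function.Injective (toDual k H) := by
  refine (injective_iff_map_eq_zero (toDual k H)).2 fun t ht => ?_
  let d := Module.Free.chooseBasis k (lieAlg k H)
  have htt := (TensorProduct.equivFinsuppOfBasisLeft (N := lieAlg k H) d).symm_apply_apply t
  set c := TensorProduct.equivFinsuppOfBasisLeft (N := lieAlg k H) d t
  rw [TensorProduct.equivFinsuppOfBasisLeft_symm_apply] at htt
  have hc : c = 0 := by
    ext1 i
    refine Subtype.ext (conv_ext fun b => ?_)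
    have h0 : ∑ i ∈ c.support, (c i).1 b • d i = 0 := by
      refine Subtype.ext (conv_ext fun a => ?_)
      have h1 : toDual k H t (a ⊗ₜ b) = 0 := by rw [ht]; rfl
      rw [← htt, Finsupp.sum, map_sum, sum_conv_apply] at h1
      have h2 : ((∑ i ∈ c.support, (c i).1 b • d i : lieAlg k H) : Conv k H k) a =
          ∑ i ∈ c.support, (c i).1 b * (d i).1 a := by
        rw [lieAlg_sum_apply]
        rfl
      rw [h2]
      refine Eq.trans (Finset.sum_congr rfl fun i _ => ?_) h1
      rw [toDual_tmul_apply, mul_comm]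
    by_cases hi : i ∈ c.support
    · exact linearIndependent_iff'.1 d.linearIndependent _ _ h0 i hi
    · rw [Finsupp.notMem_support_iff.1 hi]
      rfl
  rw [← htt, hc, Finsupp.sum_zero_index]

lemma toDual_swap (t : lieAlg k H ⊗[k] lieAlg k H) :
    pre k (swap k H) (toDual k H t) = toDual k H (TensorProduct.comm k _ _ t) := by
  induction t with
  | zero => simp only [map_zero]
  | add s t hs ht => simp only [map_add, hs, ht]
  | tmul x y =>
    apply WithConv.ext
    apply TensorProduct.ext'
    intro a b
    exact mul_comm (x.1 b) (y.1 a)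

lemma toDual_lie (z : lieAlg k H) (t : lieAlg k H ⊗[k] lieAlg k H) :
    toDual k H ⁅z, t⁆ = copr z.1 * toDual k H t - toDual k H t * copr z.1 := by
  induction t with
  | zero => simp only [lie_zero, map_zero, mul_zero, zero_mul, sub_zero]
  | add s t hs ht => simp only [lie_add, map_add, hs, ht, mul_add, add_mul]; abel
  | tmul x y =>
    rw [TensorProduct.LieModule.lie_tmul_right, map_add, toDual_tmul, toDual_tmul, toDual_tmul,
      LieSubalgebra.coe_bracket, LieSubalgebra.coe_bracket, Ring.lie_def, Ring.lie_def,
      (leibniz_iff z.1).1 z.2]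
    simp only [tens, map_sub, map_mul]
    have c1 := (commute_fst_snd z.1 y.1).eq
    have c2 := (commute_fst_snd x.1 z.1).eq
    set z1 := pre k (fst k H) z.1
    set z2 := pre k (snd k H) z.1
    set x1 := pre k (fst k H) x.1
    set y2 := pre k (snd k H) y.1
    calc (z1 * x1 - x1 * z1) * y2 + x1 * (z2 * y2 - y2 * z2)
        = z1 * x1 * y2 + (x1 * z2) * y2 - x1 * (z1 * y2) - x1 * y2 * z2 := by noncomm_ring
      _ = z1 * x1 * y2 + (z2 * x1) * y2 - x1 * (y2 * z1) - x1 * y2 * z2 := by rw [c1, c2]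
      _ = _ := by noncomm_ring

lemma isAddCocycle_toDual (t : lieAlg k H ⊗[k] lieAlg k H) : IsAddCocycle (toDual k H t) := by
  induction t with
  | zero =>
    rw [map_zero]
    exact ⟨by simp only [map_zero], by simp only [map_zero], by simp only [map_zero]⟩
  | add s t hs ht => rw [map_add]; exact hs.add ht
  | tmul x y =>
    refine isAddCocycle_of_apply (fun a b c => ?_) (fun a => ?_) fun a => ?_
    · simp only [toDual_tmul_apply, smul_eq_mul, lieAlg_apply_mul x.2, lieAlg_apply_mul y.2]
      ring
    · rw [toDual_tmul_apply, lieAlg_apply_one x.2, zero_mul]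
    · rw [toDual_tmul_apply, lieAlg_apply_one y.2, mul_zero]

lemma mem_wedgeInv_iff (t : lieAlg k H ⊗[k] lieAlg k H) : t ∈ wedgeInv k H ↔
    pre k (swap k H) (toDual k H t) = -toDual k H t ∧
      ∀ z ∈ lieAlg k H, Commute (toDual k H t) (copr z) := by
  have h1 : t ∈ wedgeInv k H ↔ TensorProduct.comm k _ _ t + t = 0 ∧
      ∀ z : lieAlg k H, ⁅z, t⁆ = 0 := Iff.rfl
  rw [h1]
  refine and_congr ?_ ⟨fun h z hz => ?_, fun h z => ?_⟩
  · rw [toDual_swap, ← map_neg, toDual_injective.eq_iff, eq_neg_iff_add_eq_zero]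
  · have h2 := toDual_lie ⟨z, hz⟩ t
    rw [h, map_zero] at h2
    exact (sub_eq_zero.1 h2.symm).symm
  · refine toDual_injective ?_
    rw [toDual_lie, map_zero, sub_eq_zero]
    exact (h z.1 z.2).symm

/-- Every form that is a point derivation in both arguments is a tensor in `𝔲 ⊗ 𝔲`. -/
lemma exists_toDual_eq [Algebra.FiniteType k H] {j : Conv k (H ⊗[k] H) k}
    (hl : ∀ a b c : H, j ((a * b) ⊗ₜ c) =
      counit (R := k) a • j (b ⊗ₜ c) + counit (R := k) b • j (a ⊗ₜ c))
    (hr : ∀ a b c : H, j (c ⊗ₜ (a * b)) =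
      counit (R := k) a • j (c ⊗ₜ b) + counit (R := k) b • j (c ⊗ₜ a)) :
    ∃ t, toDual k H t = j := by
  let L : H →ₗ[k] lieAlg k H :=
    { toFun := fun b => ⟨toConv (j.ofConv ∘ₗ (TensorProduct.mk k H H).flip b), fun a a' =>
        (hl a a' b).trans (by simp [mul_comm])⟩
      map_add' := fun b b' => Subtype.ext (conv_ext fun a =>
        (congrArg j (TensorProduct.tmul_add a b b')).trans (map_add _ _ _))
      map_smul' := fun r b => Subtype.ext (conv_ext fun a =>
        (congrArg j (TensorProduct.tmul_smul r a b)).trans (map_smul _ _ _)) }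
  have hL : ∀ a b, (L b).1 a = j (a ⊗ₜ b) := fun a b => rfl
  let d := Module.finBasis k (lieAlg k H)
  let c : Fin (Module.finrank k (lieAlg k H)) → lieAlg k H := fun i =>
    ⟨toConv (d.coord i ∘ₗ L), fun a b => by
      have h : L (a * b) = counit (R := k) a • L b + counit (R := k) b • L a :=
        Subtype.ext (conv_ext fun x => hr a b x)
      change d.coord i (L (a * b)) = counit (R := k) a * d.coord i (L b) +
        d.coord i (L a) * counit (R := k) b
      rw [h, map_add, map_smul, map_smul, smul_eq_mul, smul_eq_mul, mul_comm (counit b)]⟩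
  refine ⟨∑ i, d i ⊗ₜ c i, ?_⟩
  apply WithConv.ext
  apply TensorProduct.ext'
  intro a b
  change (toDual k H (∑ i, d i ⊗ₜ c i)) (a ⊗ₜ b) = j (a ⊗ₜ b)
  rw [map_sum, sum_conv_apply, ← hL]
  conv_rhs => rw [← d.sum_repr (L b), lieAlg_sum_apply]
  exact Finset.sum_congr rfl fun i _ => mul_comm ((d i).1 a) _

lemma toDualR_tmul (c : R) (r : wedgeInv k H) :
    toDualR k H R (c ⊗ₜ r) = c • scal R (toDual k H r.1) := rfl

lemma toDualR_tmul_apply (c : R) (r : wedgeInv k H) (t : H ⊗[k] H) :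
    toDualR k H R (c ⊗ₜ r) t = toDual k H r.1 t • c := by
  change c * algebraMap k R (toDual k H r.1 t) = _
  rw [Algebra.smul_def, mul_comm]

lemma toDualR_map {S : Type w'} [CommRing S] [Algebra k S] (f : R →ₐ[k] S)
    (r : R ⊗[k] wedgeInv k H) :
    toDualR k H S (f.toLinearMap.rTensor (wedgeInv k H) r) = post _ f (toDualR k H R r) := by
  induction r with
  | zero => simp only [map_zero]
  | add s t hs ht => simp only [map_add, hs, ht]
  | tmul c w =>
    refine conv_ext fun t => ?_
    rw [LinearMap.rTensor_tmul, toDualR_tmul_apply, post_apply, toDualR_tmul_apply, map_smul]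
    rfl

lemma toDualR_injective [Algebra.FiniteType k H] : Function.Injective (toDualR k H R) := by
  refine (injective_iff_map_eq_zero (toDualR k H R)).2 fun r hr => ?_
  let d := Module.finBasis k (wedgeInv k H)
  have hrr := (TensorProduct.equivFinsuppOfBasisRight (M := R) d).symm_apply_apply r
  set c := TensorProduct.equivFinsuppOfBasisRight (M := R) d r
  rw [TensorProduct.equivFinsuppOfBasisRight_symm_apply, Finsupp.sum_fintype _ _ (by simp)] at hrr
  have hc : c = 0 := by
    ext1 i
    refine (Module.forall_dual_apply_eq_zero_iff k _).1 fun φ => ?_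
    have h0 : ∑ i, φ (c i) • d i = 0 := by
      refine Subtype.ext (toDual_injective (conv_ext fun t => ?_))
      have h1 : φ (toDualR k H R r t) = 0 := by rw [hr]; exact map_zero φ
      rw [← hrr, map_sum, sum_conv_apply, map_sum] at h1
      rw [Submodule.coe_sum, map_sum, sum_conv_apply]
      refine Eq.trans (Finset.sum_congr rfl fun i _ => ?_) (h1.trans ?_)
      · rw [toDualR_tmul_apply, map_smul, Submodule.coe_smul, map_smul, smul_eq_mul, mul_comm]
        rfl
      · rw [Submodule.coe_zero, map_zero]; rfl
    exact linearIndependent_iff'.1 d.linearIndependent _ _ h0 i (Finset.mem_univ i)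
  rw [← hrr, hc]
  simp

variable [CharZero k]

/-- The elements of `R ⊗ (∧²𝔲)^𝔲` are skew-symmetric invariant additive cocycles. -/
lemma toDualR_mem (hU : IsUnipotent k H) (r : R ⊗[k] wedgeInv k H) :
    IsAddCocycle (toDualR k H R r) ∧ IsInvariant (toDualR k H R r) ∧
      pre R (swap k H) (toDualR k H R r) = -toDualR k H R r := by
  induction r with
  | zero =>
    rw [map_zero]
    refine ⟨⟨by simp only [map_zero], by simp only [map_zero], by simp only [map_zero]⟩, ?_, ?_⟩
    · rw [IsInvariant, toR, map_zero, zero_mul, mul_zero]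
    · rw [map_zero, neg_zero]
  | add s t hs ht =>
    rw [map_add]
    refine ⟨hs.1.add ht.1, hs.2.1.add ht.2.1, ?_⟩
    rw [map_add, hs.2.2, ht.2.2, neg_add]
  | tmul c w =>
    have hw := (mem_wedgeInv_iff w.1).1 w.2
    have hc := isAddCocycle_toDual w.1
    refine ⟨isAddCocycle_of_apply (fun x y z => ?_) (fun x => ?_) (fun x => ?_), ?_, ?_⟩
    · have h := hc.apply x y z
      simp only [toDualR_tmul_apply, ← smul_assoc, ← add_smul, h]
    · rw [toDualR_tmul_apply, hc.one_tmul, zero_smul]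
    · rw [toDualR_tmul_apply, hc.tmul_one, zero_smul]
    · refine isInvariant_of_lieAlg hU fun z hz => ?_
      have h := (hw.2 z hz).map (post (H ⊗[k] H) (Algebra.ofId k R))
      rw [toDualR_tmul]
      exact Commute.smul_left h c
    · refine conv_ext fun t => ?_
      have h : (pre k (InvCoh.swap k H) (toDual k H w.1)) t = -(toDual k H w.1 t) := by
        rw [hw.1]; rfl
      change (toDualR k H R (c ⊗ₜ[k] w)) (InvCoh.swap k H t) = -(toDualR k H R (c ⊗ₜ[k] w)) t
      rw [toDualR_tmul_apply, toDualR_tmul_apply, ← neg_smul, ← h]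
      rfl

lemma IsAddCocycle.tmul_mul {j : Conv k (H ⊗[k] H) R} (hj : IsAddCocycle j)
    (hs : pre R (InvCoh.swap k H) j = -j) (a b c : H) :
    j (c ⊗ₜ (a * b)) = counit (R := k) a • j (c ⊗ₜ b) + counit (R := k) b • j (c ⊗ₜ a) := by
  have hsw : ∀ x y : H, j (y ⊗ₜ x) = -j (x ⊗ₜ y) := fun x y =>
    congrArg (fun f : Conv k (H ⊗[k] H) R => f (x ⊗ₜ y)) hs
  rw [hsw (a * b) c, hj.mul_tmul hs, hsw b c, hsw a c, smul_neg, smul_neg, neg_add]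

/-- Every skew-symmetric invariant additive cocycle comes from `R ⊗ (∧²𝔲)^𝔲`. -/
lemma exists_toDualR_eq [Algebra.FiniteType k H] {j : Conv k (H ⊗[k] H) R}
    (hj : IsAddCocycle j) (hi : IsInvariant j) (hs : pre R (swap k H) j = -j) :
    ∃ r, toDualR k H R r = j := by
  classical
  obtain ⟨S, hS⟩ := (Algebra.FiniteType.out : (⊤ : Subalgebra k H).FG)
  let b := Module.Free.chooseBasis k R
  -- the coordinates of `j`
  let c : Module.Free.ChooseBasisIndex k R → Conv k (H ⊗[k] H) k := fun β =>
    toConv (b.coord β ∘ₗ j.ofConv)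
  have hcl : ∀ β (x y z : H), c β ((x * y) ⊗ₜ z) =
      counit (R := k) x • c β (y ⊗ₜ z) + counit (R := k) y • c β (x ⊗ₜ z) := fun β x y z => by
    change b.coord β (j _) = _ • b.coord β (j _) + _ • b.coord β (j _)
    rw [hj.mul_tmul hs, map_add, map_smul, map_smul]
  have hcr : ∀ β (x y z : H), c β (z ⊗ₜ (x * y)) =
      counit (R := k) x • c β (z ⊗ₜ y) + counit (R := k) y • c β (z ⊗ₜ x) := fun β x y z => by
    change b.coord β (j _) = _ • b.coord β (j _) + _ • b.coord β (j _)
    rw [hj.tmul_mul hs, map_add, map_smul, map_smul]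
  have hex : ∀ β, ∃ w : wedgeInv k H, toDual k H w.1 = c β := by
    intro β
    obtain ⟨t, ht⟩ := exists_toDual_eq (hcl β) (hcr β)
    refine ⟨⟨t, (mem_wedgeInv_iff t).2 ⟨?_, fun z hz => ?_⟩⟩, ht⟩
    · rw [ht]
      refine conv_ext fun x => ?_
      have h := congrArg (fun f : Conv k (H ⊗[k] H) R => b.coord β (f x)) hs
      exact h.trans (map_neg (b.coord β) _)
    · rw [ht]
      have h := congrArg (fun f : Conv k (H ⊗[k] H) R =>
        (toConv (b.coord β ∘ₗ f.ofConv) : Conv k (H ⊗[k] H) k)) (hi.commute_copr (scal R z)).eq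
      have e1 := comp_mul_scal (b.coord β) (copr z) j
      have e2 := comp_scal_mul (b.coord β) (copr z) j
      have e3 : ∀ y : Conv k (H ⊗[k] H) k, scal k y = y := fun y => rfl
      rw [e3] at e1 e2
      exact e1.symm.trans (h.trans e2)
  choose w hw using hex
  -- almost all coordinates of `j` vanish on pairs of generators, hence everywhere
  let B : Finset (Module.Free.ChooseBasisIndex k R) :=
    (S ×ˢ S).biUnion fun p => (b.repr (j (p.1 ⊗ₜ p.2))).support
  have hB : ∀ β ∉ B, c β = 0 := by
    intro β hβ
    have h0 : ∀ s ∈ S, ∀ s' ∈ S, c β (s ⊗ₜ s') = 0 := by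
      intro s hs s' hs'
      by_contra hne
      refine hβ (Finset.mem_biUnion.2 ⟨(s, s'), Finset.mk_mem_product hs hs', ?_⟩)
      rw [Finsupp.mem_support_iff]
      exact hne
    have h1 : ∀ s ∈ S, ∀ y, c β (s ⊗ₜ y) = 0 := by
      intro s hs y
      have := eq_zero_of_leibniz hS ((c β).ofConv ∘ₗ TensorProduct.mk k H H s)
        (fun x y => hcr β x y s) fun s' hs' => h0 s hs s' hs'
      exact congrArg (fun g : H →ₗ[k] k => g y) this
    apply WithConv.ext
    apply TensorProduct.ext'
    intro x y
    have := eq_zero_of_leibniz hS ((c β).ofConv ∘ₗ (TensorProduct.mk k H H).flip y)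
      (fun x x' => hcl β x x' y) fun s hs => h1 s hs y
    exact congrArg (fun g : H →ₗ[k] k => g x) this
  refine ⟨∑ β ∈ B, b β ⊗ₜ w β, conv_ext fun t => ?_⟩
  rw [map_sum, sum_conv_apply]
  conv_rhs => rw [← b.linearCombination_repr (j t), Finsupp.linearCombination_apply, Finsupp.sum]
  have h1 : ∀ β, toDualR k H R (b β ⊗ₜ w β) t = b.repr (j t) β • b β := by
    intro β
    rw [toDualR_tmul_apply, hw]
    rfl
  rw [Finset.sum_congr rfl fun β _ => h1 β]
  refine (Finset.sum_subset ?_ ?_).symm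
  · intro β hβ
    by_contra hne
    refine Finsupp.mem_support_iff.1 hβ ?_
    exact congrArg (fun f : Conv k (H ⊗[k] H) k => f t) (hB β hne)
  · intro β _ hβ
    rw [Finsupp.notMem_support_iff.1 hβ, zero_smul]

end Bivectors

/-! ### The second invariant cohomology group -/

section Cohomology

variable {k : Type u} [Field k] [CharZero k]
variable {H : Type v} [CommRing H] [HopfAlgebra k H]
variable {R : Type w} [CommRing R] [Algebra k R]

/-- The coboundary of the exponential of a central form `f` is the exponential of the additive
coboundary of `f`. -/
lemma coboundary_cexpU {f : Conv k H R} (hf : LocNil f) (hc : ∀ y, Commute f y) :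
    coboundary (cexpU f hf) = cexp (copr f - pre R (fst k H) f - pre R (snd k H) f) := by
  have c1 := central_commute_fst hc (copr f)
  have c2 := central_commute_snd hc (copr f)
  have c3 := central_commute_snd hc (pre R (fst k H) f)
  have e : copr f - pre R (fst k H) f - pre R (snd k H) f =
      copr f + (pre R (fst k H) (-f) + pre R (snd k H) (-f)) := by
    rw [map_neg, map_neg]; abel
  have h1 : Commute (pre R (fst k H) (-f)) (pre R (snd k H) (-f)) := commute_fst_snd _ _
  have h2 : Commute (copr f) (pre R (fst k H) (-f) + pre R (snd k H) (-f)) := by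
    rw [map_neg, map_neg]
    exact (c1.symm.neg_right).add_right c2.symm.neg_right
  have hn := hf.neg
  rw [e, cexp_add (hf.pre _) ((hn.pre _).add (hn.pre _) h1) h2, cexp_add (hn.pre _) (hn.pre _) h1,
    ← pre_cexp hf, ← pre_cexp hn, ← pre_cexp hn]
  rfl

lemma cexpU_central {f : Conv k H R} (hf : LocNil f) (hc : ∀ y, Commute f y) (y : Conv k H R) :
    Commute (cexpU f hf).1 y := (cexp_commute hf (hc y).symm).symm

/-- A coboundary of an invertible central form is symmetric. -/
lemma coboundary_swap (x : (Conv k H R)ˣ) :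
    pre R (swap k H) (coboundary x) = coboundary x := by
  have h1 : pre R (swap k H) (pre R (fst k H) (x⁻¹).1) = pre R (snd k H) (x⁻¹).1 := by
    apply WithConv.ext
    apply TensorProduct.ext'
    intro a b
    rfl
  have h2 : pre R (swap k H) (pre R (snd k H) (x⁻¹).1) = pre R (fst k H) (x⁻¹).1 := by
    apply WithConv.ext
    apply TensorProduct.ext'
    intro a b
    rfl
  have c := (commute_fst_snd (x⁻¹).1 (x⁻¹).1).eq
  rw [coboundary, map_mul, copr_swap, tens, map_mul, h1, h2, c]

/-- The exponential of a symmetric invariant additive cocycle is the coboundary of an invertible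
central form. -/
lemma exists_coboundary_of_symm (hU : IsUnipotent k H) {j : Conv k (H ⊗[k] H) R}
    (hj : IsAddCocycle j) (hi : IsInvariant j) (hs : pre R (swap k H) j = j) :
    ∃ x : (Conv k H R)ˣ, (∀ y, Commute x.1 y) ∧ cexp j = coboundary x := by
  obtain ⟨f, hf1, hfc, hfj⟩ := exists_central_of_symm hU hj hi hs
  have hf : LocNil f := locNil_of_apply_one hU hf1
  exact ⟨cexpU f hf, cexpU_central hf hfc, by rw [coboundary_cexpU hf hfc, ← hfj]⟩

/-- Symmetric invariant additive cocycles commute with all invariant forms. -/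
lemma commute_of_symm (hU : IsUnipotent k H) {j F : Conv k (H ⊗[k] H) R}
    (hj : IsAddCocycle j) (hi : IsInvariant j) (hs : pre R (swap k H) j = j)
    (hF : IsInvariant F) : Commute j F := by
  obtain ⟨f, -, hfc, rfl⟩ := exists_central_of_symm hU hj hi hs
  exact (((hF.commute_copr f).symm.sub_left (central_commute_fst hfc F))).sub_left
    (central_commute_snd hfc F)

/-- The invariant Hopf `2`-cocycle `exp(r/2)` for an invariant bivector `r`. -/
def expCocycle (hU : IsUnipotent k H) (r : R ⊗[k] wedgeInv k H) : Z2inv k H R :=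
  ⟨cexpU ((2⁻¹ : k) • toDualR k H R r) (((toDualR_mem hU r).1.locNil hU).smul _),
    isHopfCocycle_cexp hU ((toDualR_mem hU r).1.smul _) ((toDualR_mem hU r).2.1.smul _),
    isInvariant_cexp (((toDualR_mem hU r).1.locNil hU).smul _) ((toDualR_mem hU r).2.1.smul _)⟩

lemma expCocycle_val (hU : IsUnipotent k H) (r : R ⊗[k] wedgeInv k H) :
    (expCocycle hU r).1.1 = cexp ((2⁻¹ : k) • toDualR k H R r) := rfl

/-- Every invariant Hopf cocycle is the product of some `exp(r/2)` and a coboundary. The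
logarithm of the cocycle is the sum of its skew-symmetric part, which is a biderivation, and its
symmetric part, which is an additive coboundary. -/
lemma exists_eq_expCocycle_mul (hU : IsUnipotent k H) [Algebra.FiniteType k H]
    (J : Z2inv k H R) : ∃ (r : R ⊗[k] wedgeInv k H) (x : (Conv k H R)ˣ),
      (∀ y, Commute x.1 y) ∧ J.1.1 = (expCocycle hU r).1.1 * coboundary x := by
  obtain ⟨hj, hi⟩ := isAddCocycle_clog hU J.2.1 J.2.2
  have hJ : cexp (clog J.1.1) = J.1.1 := cexp_clog (J.2.1.locNil_sub_one hU)
  set j := clog J.1.1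
  have hsw : pre R (swap k H) (pre R (swap k H) j) = j := by
    apply WithConv.ext
    apply TensorProduct.ext'
    intro a b
    rfl
  have hp : ∀ (c : k) (y : Conv k (H ⊗[k] H) R),
      pre R (swap k H) (c • y) = c • pre R (swap k H) y := fun c y => rfl
  have hneg : ((-1 : k)) • pre R (swap k H) j = -pre R (swap k H) j := by rw [neg_smul, one_smul]
  obtain ⟨r, hr⟩ := exists_toDualR_eq (j := j - pre R (swap k H) j)
    (by rw [sub_eq_add_neg, ← hneg]; exact hj.add (hj.swap.smul _)) (hi.sub hi.swap)
    (by rw [map_sub, hsw, neg_sub])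
  have hσ : IsAddCocycle ((2⁻¹ : k) • (j + pre R (swap k H) j)) := (hj.add hj.swap).smul _
  have hσi : IsInvariant ((2⁻¹ : k) • (j + pre R (swap k H) j)) := (hi.add hi.swap).smul _
  have hσs : pre R (swap k H) ((2⁻¹ : k) • (j + pre R (swap k H) j)) =
      (2⁻¹ : k) • (j + pre R (swap k H) j) := by rw [hp, map_add, hsw, add_comm]
  obtain ⟨x, hx, hxj⟩ := exists_coboundary_of_symm hU hσ hσi hσs
  have hr' := toDualR_mem hU r
  refine ⟨r, x, hx, ?_⟩
  have hc := commute_of_symm hU hσ hσi hσs (hr'.2.1.smul (2⁻¹ : k))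
  rw [expCocycle_val, ← hxj, ← cexp_add ((hr'.1.locNil hU).smul _) (hσ.locNil hU) hc.symm, hr,
    ← smul_add]
  have e : j - pre R (swap k H) j + (j + pre R (swap k H) j) = (2 : k) • j := by
    rw [two_smul]; abel
  rw [e, smul_smul, inv_mul_cancel₀ two_ne_zero, one_smul, hJ]

lemma cls_eq_of_val {J J' : Z2inv k H R} {x : (Conv k H R)ˣ} (hx : ∀ y, Commute x.1 y)
    (h : J.1.1 = J'.1.1 * coboundary x) : cls J' = cls J := by
  refine QuotientGroup.eq.2 ⟨x, hx, ?_⟩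
  change (J'.1⁻¹).1 * J.1.1 = coboundary x
  rw [h, ← mul_assoc, Units.inv_mul, one_mul]

/-- `r ↦ [exp(r/2)]` is additive: the commutator of two skew-symmetric invariant additive cocycles
is a symmetric one, hence a central coboundary. -/
lemma cls_expCocycle_add (hU : IsUnipotent k H) (r s : R ⊗[k] wedgeInv k H) :
    (cls (expCocycle hU (r + s)) : H2inv k H R) =
      cls (expCocycle hU r) * cls (expCocycle hU s) := by
  have hr := toDualR_mem hU r
  have hs := toDualR_mem hU s
  set ρ := (2⁻¹ : k) • toDualR k H R r with hρ
  set τ := (2⁻¹ : k) • toDualR k H R s with hτ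
  have hp : ∀ (c : k) (y : Conv k (H ⊗[k] H) R),
      pre R (swap k H) (c • y) = c • pre R (swap k H) y := fun c y => rfl
  have h1 : IsAddCocycle ρ := hr.1.smul _
  have h2 : IsAddCocycle τ := hs.1.smul _
  have i1 : IsInvariant ρ := hr.2.1.smul _
  have i2 : IsInvariant τ := hs.2.1.smul _
  have s1 : pre R (swap k H) ρ = -ρ := by rw [hρ, hp, hr.2.2, smul_neg]
  have s2 : pre R (swap k H) τ = -τ := by rw [hτ, hp, hs.2.2, smul_neg]
  have hc : IsAddCocycle (ρ * τ - τ * ρ) := h1.commutator h2 i1 i2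
  have ic : IsInvariant (ρ * τ - τ * ρ) := (i1.mul i2).sub (i2.mul i1)
  have sc : pre R (swap k H) (ρ * τ - τ * ρ) = ρ * τ - τ * ρ := by
    rw [map_sub, map_mul, map_mul, s1, s2, neg_mul_neg, neg_mul_neg]
  obtain ⟨x, hx, hxc⟩ := exists_coboundary_of_symm hU (hc.smul (2⁻¹ : k)) (ic.smul _)
    (by rw [hp, sc])
  refine cls_eq_of_val (J := expCocycle hU r * expCocycle hU s) hx ?_
  change cexp ρ * cexp τ = cexp ((2⁻¹ : k) • toDualR k H R (r + s)) * coboundary x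
  rw [← hxc, map_add, smul_add]
  exact cexp_mul_cexp_of_commutator (h1.locNil hU) (h2.locNil hU) ((h1.add h2).locNil hU)
    (hc.locNil hU) rfl (commute_of_symm hU hc ic sc i1) (commute_of_symm hU hc ic sc i2)

/-- The isomorphism `r ↦ [exp(r/2)]`. -/
def expHom (hU : IsUnipotent k H) : Multiplicative (R ⊗[k] wedgeInv k H) →* H2inv k H R :=
  MonoidHom.mk' (fun r => cls (expCocycle hU r.toAdd)) fun _ _ => cls_expCocycle_add hU _ _

lemma swap_expCocycle (hU : IsUnipotent k H) (r : R ⊗[k] wedgeInv k H) :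
    pre R (swap k H) (expCocycle hU r).1.1 = ((expCocycle hU r).1⁻¹).1 := by
  have hr := toDualR_mem hU r
  rw [expCocycle_val, pre_cexp ((hr.1.locNil hU).smul _)]
  change cexp ((2⁻¹ : k) • pre R (swap k H) (toDualR k H R r)) =
    cexp (-((2⁻¹ : k) • toDualR k H R r))
  rw [hr.2.2, smul_neg]

lemma expHom_injective (hU : IsUnipotent k H) [Algebra.FiniteType k H] :
    Function.Injective (expHom (R := R) hU) := by
  refine (injective_iff_map_eq_one _).2 fun r hr => ?_
  obtain ⟨x, -, hx⟩ := (QuotientGroup.eq_one_iff _).1 hr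
  change (expCocycle hU r.toAdd).1.1 = coboundary x at hx
  have h1 := swap_expCocycle hU r.toAdd
  rw [hx, coboundary_swap, ← hx] at h1
  have hr' := toDualR_mem hU r.toAdd
  have hl := (hr'.1.locNil hU).smul (2⁻¹ : k)
  have h2 : (2⁻¹ : k) • toDualR k H R r.toAdd = -((2⁻¹ : k) • toDualR k H R r.toAdd) :=
    cexp_injective hl hl.neg h1
  have h3 : toDualR k H R r.toAdd = 0 := by
    rw [eq_neg_iff_add_eq_zero, ← add_smul] at h2
    have h4 : ((2⁻¹ : k) + 2⁻¹) = 1 := by norm_num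
    rwa [h4, one_smul] at h2
  exact Multiplicative.toAdd.injective (toDualR_injective (h3.trans (map_zero _).symm))

lemma expHom_surjective (hU : IsUnipotent k H) [Algebra.FiniteType k H] :
    Function.Surjective (expHom (R := R) hU) := by
  intro c
  obtain ⟨J, rfl⟩ := QuotientGroup.mk_surjective c
  obtain ⟨r, x, hx, h⟩ := exists_eq_expCocycle_mul hU J
  exact ⟨Multiplicative.ofAdd r, cls_eq_of_val hx h⟩

end Cohomology

/-! ### The bicharacter defined by an invariant bivector -/

section Bicharacter

variable {k : Type u} [Field k]
variable {H : Type v} [CommRing H] [HopfAlgebra k H]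

variable (k H) in
/-- `a ⊗ b ⊗ c ↦ a ⊗ c ⊗ b` -/
def swap23 : H ⊗[k] (H ⊗[k] H) →ₗc[k] H ⊗[k] (H ⊗[k] H) :=
  Coalgebra.TensorProduct.map (CoalgHom.id k H) (swap k H)

variable (k H) in
/-- `a ⊗ b ⊗ c ↦ ε(b) (a ⊗ c)` -/
def proj13 : H ⊗[k] (H ⊗[k] H) →ₗc[k] H ⊗[k] H := (proj12 k H).comp (swap23 k H)

lemma proj13_tmul (a b c : H) : proj13 k H (a ⊗ₜ (b ⊗ₜ c)) = a ⊗ₜ (counit (R := k) b • c) := rfl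

/-- The linear form `h ↦ F(h, g)`. -/
def slotL (F : Conv k (H ⊗[k] H) k) (g : H) : Conv k H k :=
  toConv (F.ofConv ∘ₗ (TensorProduct.mk k H H).flip g)

/-- The linear form `h ↦ F(g, h)`. -/
def slotR (F : Conv k (H ⊗[k] H) k) (g : H) : Conv k H k :=
  toConv (F.ofConv ∘ₗ TensorProduct.mk k H H g)

lemma slotL_swap (F : Conv k (H ⊗[k] H) k) (g : H) : slotL (pre k (swap k H) F) g = slotR F g := rfl

lemma proj12_mul_proj13_apply (F G : Conv k (H ⊗[k] H) k) (h g l : H) :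
    (pre k (proj12 k H) F * pre k (proj13 k H) G) (h ⊗ₜ (g ⊗ₜ l)) = (slotL F g * slotL G l) h := by
  rw [(ℛ k h).convMul_apply]
  simp only [((ℛ k h).tmul ((ℛ k g).tmul (ℛ k l))).convMul_apply,
    Coalgebra.Repr.tmul_index, Finset.sum_product]
  refine Finset.sum_congr rfl fun i _ => ?_
  have e1 : slotL F g ((ℛ k h).left i) = ∑ j ∈ (ℛ k g).index,
      counit (R := k) ((ℛ k g).right j) • F ((ℛ k h).left i ⊗ₜ (ℛ k g).left j) := by
    conv_lhs => rw [← sum_smul_counit (k := k) g]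
    simp [slotL]
  have e2 : slotL G l ((ℛ k h).right i) = ∑ j ∈ (ℛ k l).index,
      counit (R := k) ((ℛ k l).left j) • G ((ℛ k h).right i ⊗ₜ (ℛ k l).right j) := by
    conv_lhs => rw [← sum_counit_smul (ℛ k l)]
    simp [slotL]
  rw [e1, e2, Finset.sum_mul_sum]
  refine Finset.sum_congr rfl fun j _ => Finset.sum_congr rfl fun j' _ => ?_
  simp only [Coalgebra.Repr.tmul_left, Coalgebra.Repr.tmul_right, pre_apply, proj12_tmul,
    proj13_tmul, TensorProduct.tmul_smul, map_smul, smul_eq_mul]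
  ring

/-- An invariant skew-symmetric biderivation. -/
structure IsInvBivector (ρ : Conv k (H ⊗[k] H) k) : Prop where
  isAddCocycle : IsAddCocycle ρ
  invariant : IsInvariant ρ
  skew : pre k (swap k H) ρ = -ρ

lemma IsInvBivector.neg {ρ : Conv k (H ⊗[k] H) k} (h : IsInvBivector ρ) : IsInvBivector (-ρ) where
  isAddCocycle := by simpa using h.isAddCocycle.smul (-1)
  invariant := by simpa using h.invariant.smul (-1)
  skew := by rw [map_neg, h.skew]

variable [CharZero k]

lemma IsInvBivector.pre_mul23 {ρ : Conv k (H ⊗[k] H) k} (h : IsInvBivector ρ) :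
    pre k (mul23 k H) ρ = pre k (proj12 k H) ρ + pre k (proj13 k H) ρ := by
  apply WithConv.ext
  apply TensorProduct.ext_threefold'
  intro a b c
  change ρ (a ⊗ₜ (b * c)) = ρ (a ⊗ₜ (counit (R := k) c • b)) + ρ (a ⊗ₜ (counit (R := k) b • c))
  rw [h.isAddCocycle.tmul_mul h.skew, TensorProduct.tmul_smul, TensorProduct.tmul_smul, map_smul,
    map_smul, add_comm]

lemma IsInvBivector.pre_mul12 {ρ : Conv k (H ⊗[k] H) k} (h : IsInvBivector ρ) :
    pre k (mul12 k H) ρ = pre k (proj13 k H) ρ + pre k (proj23 k H) ρ := by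
  have h1 := h.isAddCocycle.cocycle
  rw [h.pre_mul23] at h1
  refine add_right_cancel (h1.trans ?_)
  abel

/-- The forms `ρ₁₂` and `ρ₁₃` commute. The invariance of `ρ` only gives that `ρ₁₂` commutes with
`ρ₁₃ + ρ₂₃`, together with the analogues for the other indices, but these suffice by
skew-symmetry. -/
lemma IsInvBivector.commute {ρ : Conv k (H ⊗[k] H) k} (h : IsInvBivector ρ) :
    Commute (pre k (proj12 k H) ρ) (pre k (proj13 k H) ρ) := by
  have h1 := proj12_commute h.invariant ρ
  have h2 := proj23_commute h.invariant ρ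
  have h3 := h1.map (pre k (swap23 k H))
  rw [h.pre_mul12] at h1 h3
  rw [h.pre_mul23] at h2
  have e1 : pre k (swap23 k H) (pre k (proj12 k H) ρ) = pre k (proj13 k H) ρ := rfl
  have e2 : pre k (swap23 k H) (pre k (proj13 k H) ρ) = pre k (proj12 k H) ρ := by
    apply WithConv.ext
    apply TensorProduct.ext_threefold'
    intro a b c
    rfl
  have e3 : pre k (swap23 k H) (pre k (proj23 k H) ρ) = -pre k (proj23 k H) ρ := by
    rw [← map_neg, ← h.skew]
    apply WithConv.ext
    apply TensorProduct.ext_threefold'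
    intro a b c
    change ρ (counit (R := k) a • (c ⊗ₜ b)) = ρ (swap k H (counit (R := k) a • (b ⊗ₜ c)))
    rw [map_smul (swap k H), swap_tmul]
  rw [map_add, e1, e2, e3] at h3
  set x := pre k (proj12 k H) ρ
  set y := pre k (proj13 k H) ρ
  set z := pre k (proj23 k H) ρ
  have h1' : x * (y + z) = (y + z) * x := h1
  have h2' : z * (x + y) = (x + y) * z := h2
  have h3' : y * (x + -z) = (x + -z) * y := h3
  have h4 : (2 : k) • (x * y - y * x) = 0 := by
    have e : (2 : k) • (x * y - y * x) =
        (x * (y + z) - (y + z) * x) + (z * (x + y) - (x + y) * z) -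
          (y * (x + -z) - (x + -z) * y) := by
      rw [two_smul]; noncomm_ring
    rw [e, h1', h2', h3']
    simp
  have h5 := (smul_eq_zero.1 h4).resolve_left two_ne_zero
  exact sub_eq_zero.1 h5

section

variable (hU : IsUnipotent k H) {ρ : Conv k (H ⊗[k] H) k} (h : IsInvBivector ρ)

include hU h

lemma IsInvBivector.locNil : LocNil ρ := h.isAddCocycle.locNil hU

lemma IsInvBivector.swap_cexp : pre k (InvCoh.swap k H) (cexp ρ) = cexp (-ρ) := by
  rw [pre_cexp (h.locNil hU), h.skew]

lemma IsInvBivector.slotR_eq (a : H) : slotR (cexp ρ) a = slotL (cexp (-ρ)) a := by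
  rw [← slotL_swap, h.swap_cexp hU]

lemma IsInvBivector.slotL_mul (g l : H) :
    slotL (cexp ρ) (g * l) = slotL (cexp ρ) g * slotL (cexp ρ) l := by
  refine conv_ext fun a => ?_
  have hl := h.locNil hU
  rw [← proj12_mul_proj13_apply, pre_cexp hl, pre_cexp hl,
    ← cexp_add (hl.pre _) (hl.pre _) h.commute, ← h.pre_mul23, ← pre_cexp hl]
  rfl

lemma IsInvBivector.slotR_mul (g l : H) :
    slotR (cexp ρ) (g * l) = slotR (cexp ρ) g * slotR (cexp ρ) l := by
  rw [h.slotR_eq hU, h.slotR_eq hU, h.slotR_eq hU, h.neg.slotL_mul hU]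

lemma IsInvBivector.slotL_one : slotL (cexp ρ) 1 = 1 :=
  conv_ext fun a => (isHopfCocycle_cexp hU h.isAddCocycle h.invariant).right_one a

lemma IsInvBivector.apply_swap (a b : H) : cexp (-ρ) (a ⊗ₜ b) = cexp ρ (b ⊗ₜ a) := by
  rw [← h.swap_cexp hU]
  rfl

/-- The algebra homomorphism `g ↦ exp(ρ)(·, g)` from `H` to the dual algebra of `H`. -/
def IsInvBivector.slotHom : H →ₐ[k] Conv k H k :=
  AlgHom.ofLinearMap
    { toFun := slotL (cexp ρ)
      map_add' := fun a b => conv_ext fun c =>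
        (congrArg (cexp ρ) (TensorProduct.tmul_add c a b)).trans (map_add _ _ _)
      map_smul' := fun r a => conv_ext fun c =>
        (congrArg (cexp ρ) (TensorProduct.tmul_smul r c a)).trans (map_smul _ _ _) }
    (h.slotL_one hU) (h.slotL_mul hU)

/-- The composite of an algebra homomorphism with the antipode is its convolution inverse. Applied
to `g ↦ exp(ρ)(·, g)`, this gives `exp(ρ)(b, S(a)) = exp(-ρ)(b, a)`. -/
lemma IsInvBivector.apply_antipode (a b : H) :
    cexp ρ (b ⊗ₜ HopfAlgebra.antipode k a) = cexp ρ (a ⊗ₜ b) := by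
  have hl := h.locNil hU
  let χ := h.slotHom hU
  let X : Conv k H (Conv k H k) := toConv χ.toLinearMap
  let A : Conv k H (Conv k H k) := toConv (χ.toLinearMap ∘ₗ HopfAlgebra.antipode k)
  have h1 : A * X = 1 := by
    have := congrArg (post H χ) (LinearMap.antipode_mul_id (R := k) (C := H))
    rw [map_mul, map_one] at this
    exact this
  have h2 : X = curry (cexp (-ρ)) := conv_ext fun a => conv_ext fun b => (h.apply_swap hU a b).symm
  have h3 : X * curry (cexp ρ) = 1 := by
    rw [h2, ← curry_mul, cexp_neg_mul_cexp hl, curry_one]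
  have h4 : A = curry (cexp ρ) := left_inv_eq_right_inv h1 h3
  exact congrArg (fun f : Conv k H (Conv k H k) => f a b) h4

end

lemma antipode_antipode (a : H) :
    HopfAlgebra.antipode k (HopfAlgebra.antipode k a) = a := by
  have h := inv_inv (toConv (AlgHom.id k H) : WithConv (H →ₐ[k] H))
  exact congrArg (fun f : WithConv (H →ₐ[k] H) => f.ofConv a) h

end Bicharacter

section Separating

variable {k : Type u} [Field k] {V : Type*} [AddCommGroup V] [Module k V]

/-- If linear forms `ψ i` separate the points of `V`, then the forms `ψ i ⊗ ψ j` separate the points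
of `V ⊗ V`. -/
lemma eq_zero_of_separating {ι : Type*} {ψ : ι → V →ₗ[k] k}
    (hψ : ∀ v, (∀ i, ψ i v = 0) → v = 0) {t : V ⊗[k] V}
    (ht : ∀ i j, LinearMap.mul' k k (TensorProduct.map (ψ i) (ψ j) t) = 0) : t = 0 := by
  let d := Module.Free.chooseBasis k V
  have htt := (TensorProduct.equivFinsuppOfBasisLeft (N := V) d).symm_apply_apply t
  set c := TensorProduct.equivFinsuppOfBasisLeft (N := V) d t
  rw [TensorProduct.equivFinsuppOfBasisLeft_symm_apply] at htt
  have hc : c = 0 := by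
    ext1 α
    refine hψ _ fun j => ?_
    have h0 : ∑ α ∈ c.support, ψ j (c α) • d α = 0 := by
      refine hψ _ fun i => ?_
      have h1 := ht i j
      rw [← htt, Finsupp.sum, map_sum, map_sum] at h1
      rw [map_sum]
      refine Eq.trans (Finset.sum_congr rfl fun α _ => ?_) h1
      rw [TensorProduct.map_tmul, LinearMap.mul'_apply, map_smul, smul_eq_mul, mul_comm]
    by_cases hα : α ∈ c.support
    · exact linearIndependent_iff'.1 d.linearIndependent _ _ h0 α hα
    · rw [Finsupp.notMem_support_iff.1 hα, map_zero]
  rw [← htt, hc, Finsupp.sum_zero_index]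

end Separating

/-! ### Forms on quotient Hopf algebras -/

section Quotient

variable {k : Type u} [Field k]
variable {H : Type v} [CommRing H] [HopfAlgebra k H]
variable (I : Ideal H) [I.IsHopfIdeal k]

lemma quot2_surjective : Function.Surjective (quot2 (k := k) I) :=
  TensorProduct.map_surjective (Ideal.Quotient.mk_surjective (I := I))
    (Ideal.Quotient.mk_surjective (I := I))

lemma lif_injective : Function.Injective (lif (k := k) I) := by
  intro F G h
  refine conv_ext fun t => ?_
  obtain ⟨s, rfl⟩ := quot2_surjective (k := k) I t
  exact congrArg (fun f : Conv k (H ⊗[k] H) k => f s) h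

lemma lif_tmul (F : Conv k ((H ⧸ I) ⊗[k] (H ⧸ I)) k) (a b : H) :
    lif I F (a ⊗ₜ b) = F (Ideal.Quotient.mk I a ⊗ₜ Ideal.Quotient.mk I b) := rfl

lemma lif_swap (F : Conv k ((H ⧸ I) ⊗[k] (H ⧸ I)) k) :
    lif I (pre k (swap k (H ⧸ I)) F) = pre k (swap k H) (lif I F) := by
  apply WithConv.ext
  apply TensorProduct.ext'
  intro a b
  rfl

lemma exists_lif_eq {F : Conv k (H ⊗[k] H) k} (hl : ∀ a ∈ I, ∀ b, F (a ⊗ₜ b) = 0)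
    (hr : ∀ a ∈ I, ∀ b, F (b ⊗ₜ a) = 0) :
    ∃ G : Conv k ((H ⧸ I) ⊗[k] (H ⧸ I)) k, lif I G = F := by
  let p : H →ₗ[k] H ⧸ I := (Ideal.Quotient.mkₐ k I).toLinearMap
  have hp : Function.Surjective p := Ideal.Quotient.mk_surjective
  obtain ⟨s, hs⟩ := p.exists_rightInverse_of_surjective (LinearMap.range_eq_top.2 hp)
  have hs' : ∀ a, s (p a) - a ∈ I := fun a => by
    rw [← Ideal.Quotient.eq_zero_iff_mem, map_sub, sub_eq_zero]
    exact congrArg (fun f : H ⧸ I →ₗ[k] H ⧸ I => f (p a)) hs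
  refine ⟨toConv (F.ofConv ∘ₗ TensorProduct.map s s), ?_⟩
  apply WithConv.ext
  apply TensorProduct.ext'
  intro a b
  change F (s (p a) ⊗ₜ s (p b)) = F (a ⊗ₜ b)
  have h1 := hl _ (hs' a) (s (p b))
  have h2 := hr _ (hs' b) a
  rw [TensorProduct.sub_tmul, map_sub, sub_eq_zero] at h1
  rw [TensorProduct.tmul_sub, map_sub, sub_eq_zero] at h2
  exact h1.trans h2

variable (k) in
/-- The projection `O(G) → O(A)` applied to all three tensor factors. -/
def quot3 : H ⊗[k] (H ⊗[k] H) →ₗc[k] (H ⧸ I) ⊗[k] ((H ⧸ I) ⊗[k] (H ⧸ I)) :=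
  Coalgebra.TensorProduct.map (Bialgebra.Quotient.mkBialgHom (R := k) I).toCoalgHom
    (quot2 (k := k) I)

lemma pre_quot3_injective : Function.Injective (pre k (quot3 k I)) := by
  have h3 : Function.Surjective (quot3 k I) :=
    TensorProduct.map_surjective (Ideal.Quotient.mk_surjective (I := I)) (quot2_surjective I)
  intro F G h
  refine conv_ext fun t => ?_
  obtain ⟨s, rfl⟩ := h3 t
  exact congrArg (fun f : Conv k (H ⊗[k] (H ⊗[k] H)) k => f s) h

lemma IsHopfCocycle.of_lif {L : Conv k ((H ⧸ I) ⊗[k] (H ⧸ I)) k} (hL : IsUnit L)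
    (h : IsHopfCocycle (lif I L)) : IsHopfCocycle L where
  isUnit := hL
  cocycle := by
    refine pre_quot3_injective I ?_
    have h1 : pre k (quot3 k I) (pre k (mul12 k (H ⧸ I)) L) = pre k (mul12 k H) (lif I L) := by
      apply WithConv.ext
      apply TensorProduct.ext_threefold'
      intro a b c
      rfl
    have h2 : pre k (quot3 k I) (pre k (mul23 k (H ⧸ I)) L) = pre k (mul23 k H) (lif I L) := by
      apply WithConv.ext
      apply TensorProduct.ext_threefold'
      intro a b c
      rfl
    have h3 : pre k (quot3 k I) (pre k (proj12 k (H ⧸ I)) L) = pre k (proj12 k H) (lif I L) := by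
      apply WithConv.ext
      apply TensorProduct.ext_threefold'
      intro a b c
      rfl
    have h4 : pre k (quot3 k I) (pre k (proj23 k (H ⧸ I)) L) = pre k (proj23 k H) (lif I L) := by
      apply WithConv.ext
      apply TensorProduct.ext_threefold'
      intro a b c
      rfl
    rw [map_mul, map_mul, h1, h2, h3, h4]
    exact h.cocycle
  right_one a := by
    obtain ⟨a, rfl⟩ := Ideal.Quotient.mk_surjective a
    exact h.right_one a
  one_left a := by
    obtain ⟨a, rfl⟩ := Ideal.Quotient.mk_surjective a
    exact h.one_left a

/-- The lifting to `O(G)` of a linear form on `O(A)`. -/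
abbrev lif1 : Conv k (H ⧸ I) k →+* Conv k H k :=
  pre k (Bialgebra.Quotient.mkBialgHom (R := k) I).toCoalgHom

lemma lif1_slotL (F : Conv k ((H ⧸ I) ⊗[k] (H ⧸ I)) k) (a : H) :
    lif1 I (slotL F (Ideal.Quotient.mk I a)) = slotL (lif I F) a := rfl

lemma lif1_slotR (F : Conv k ((H ⧸ I) ⊗[k] (H ⧸ I)) k) (a : H) :
    lif1 I (slotR F (Ideal.Quotient.mk I a)) = slotR (lif I F) a := rfl

/-- An element of `𝓑(G)` is determined by the lift of its form: the subgroup is given by the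
radical of the lift. -/
lemma bset_ext {B B' : BSet k H} (h : lif B.I B.R = lif B'.I B'.R) : B = B' := by
  -- by nondegeneracy of `R`, the ideal of the subgroup is the radical of the lift
  have mem : ∀ (B : BSet k H) (a : H), a ∈ B.I ↔ ∀ b, lif B.I B.R (b ⊗ₜ a) = 0 := by
    intro B a
    rw [← Ideal.Quotient.eq_zero_iff_mem]
    constructor
    · intro ha b
      rw [lif_tmul, ha, TensorProduct.tmul_zero, map_zero]
    · intro ha
      refine B.minimal _ fun b => ?_
      obtain ⟨b, rfl⟩ := Ideal.Quotient.mk_surjective b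
      exact ha b
  have hI : B.I = B'.I := by
    ext a
    rw [mem, mem, h]
  obtain ⟨I, R, _, _, _, _, _, _⟩ := B
  obtain ⟨I', R', _, _, _, _, _, _⟩ := B'
  obtain rfl : I = I' := hI
  obtain rfl : R = R' := lif_injective I h
  rfl

end Quotient

/-! ### The support of the exponential of an invariant bivector -/

section Support

variable {k : Type u} [Field k] [CharZero k]
variable {H : Type v} [CommRing H] [HopfAlgebra k H]

section

variable (hU : IsUnipotent k H) {ρ : Conv k (H ⊗[k] H) k} (h : IsInvBivector ρ)

/-- The right radical of the form `exp(ρ)`. -/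
def IsInvBivector.radical : Ideal H := RingHom.ker (h.slotHom hU)

lemma IsInvBivector.mem_radical (a : H) :
    a ∈ h.radical hU ↔ ∀ b, cexp ρ (b ⊗ₜ a) = 0 := by
  have h1 : a ∈ h.radical hU ↔ slotL (cexp ρ) a = 0 := Iff.rfl
  rw [h1]
  exact ⟨fun ha b => congrArg (fun f : Conv k H k => f b) ha, fun ha => conv_ext ha⟩

lemma IsInvBivector.apply_radical {a : H} (ha : a ∈ h.radical hU) (b : H) :
    cexp ρ (a ⊗ₜ b) = 0 := by
  rw [← antipode_antipode (k := k) b, h.apply_antipode hU]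
  exact (h.mem_radical hU a).1 ha _

/-- The form `exp(ρ)(b, ·)` on the quotient by the radical. -/
def IsInvBivector.radForm (b : H) : (H ⧸ (h.radical hU).restrictScalars k) →ₗ[k] k :=
  ((h.radical hU).restrictScalars k).liftQ (slotR (cexp ρ) b).ofConv fun a ha =>
    (h.mem_radical hU a).1 ha b

lemma IsInvBivector.radForm_separating (v : H ⧸ (h.radical hU).restrictScalars k)
    (hv : ∀ b, h.radForm hU b v = 0) : v = 0 := by
  obtain ⟨a, rfl⟩ := Submodule.mkQ_surjective _ v
  exact (Submodule.Quotient.mk_eq_zero _).2 ((h.mem_radical hU a).2 hv)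

lemma IsInvBivector.radForm_comul (b b' a : H) :
    LinearMap.mul' k k (TensorProduct.map (h.radForm hU b) (h.radForm hU b')
      (TensorProduct.map ((h.radical hU).restrictScalars k).mkQ
        ((h.radical hU).restrictScalars k).mkQ (comul a))) = cexp ρ ((b * b') ⊗ₜ a) := by
  rw [← LinearMap.comp_apply (TensorProduct.map _ _), ← TensorProduct.map_comp]
  have h1 := congrArg (fun f : Conv k H k => f a) (h.slotR_mul hU b b')
  exact h1.symm

lemma IsInvBivector.isHopfIdeal : (h.radical hU).IsHopfIdeal k where
  counit_eq_zero a ha := by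
    have h1 := (isHopfCocycle_cexp hU h.isAddCocycle h.invariant).one_left a
    exact h1.symm.trans ((h.mem_radical hU a).1 ha 1)
  map_mkQ_comul_eq_zero a ha := eq_zero_of_separating (h.radForm_separating hU) fun b b' => by
    rw [h.radForm_comul hU]
    exact (h.mem_radical hU a).1 ha _
  antipode_mem a ha := (h.mem_radical hU _).2 fun b => by
    rw [h.apply_antipode hU]
    exact h.apply_radical hU ha b

lemma IsInvBivector.comm_comul_radical (a : H) :
    TensorProduct.comm k _ _ (TensorProduct.map ((h.radical hU).restrictScalars k).mkQ
      ((h.radical hU).restrictScalars k).mkQ (comul a)) =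
    TensorProduct.map ((h.radical hU).restrictScalars k).mkQ
      ((h.radical hU).restrictScalars k).mkQ (comul (R := k) a) := by
  refine sub_eq_zero.1 (eq_zero_of_separating (h.radForm_separating hU) fun b b' => ?_)
  have e : ∀ t : (H ⧸ (h.radical hU).restrictScalars k) ⊗[k] (H ⧸ (h.radical hU).restrictScalars k),
      LinearMap.mul' k k (TensorProduct.map (h.radForm hU b) (h.radForm hU b')
        (TensorProduct.comm k _ _ t)) =
      LinearMap.mul' k k (TensorProduct.map (h.radForm hU b') (h.radForm hU b) t) := by
    intro t
    induction t with
    | zero => simp only [map_zero]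
    | add s t hs ht => simp only [map_add, hs, ht]
    | tmul x y => exact mul_comm _ _
  rw [map_sub, map_sub, e, h.radForm_comul hU, h.radForm_comul hU, mul_comm, sub_self]

/-- The support of `exp(ρ)` is commutative, as `exp(ρ)(bb', ·) = exp(ρ)(b'b, ·)`. -/
lemma IsInvBivector.isCocomm [(h.radical hU).IsHopfIdeal k] :
    Coalgebra.IsCocomm k (H ⧸ h.radical hU) where
  comm_comp_comul := by
    refine LinearMap.ext fun x => ?_
    obtain ⟨a, rfl⟩ := Ideal.Quotient.mk_surjective x
    exact h.comm_comul_radical hU a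

end

lemma pt_mul_ptInv (g : H →ₐ[k] k) : pt g * ptInv g = 1 := by
  have h := congrArg (post H g) (LinearMap.id_mul_antipode (R := k) (C := H))
  rw [map_mul, map_one] at h
  exact h

lemma ptInv_mul_pt (g : H →ₐ[k] k) : ptInv g * pt g = 1 := by
  have h := congrArg (post H g) (LinearMap.antipode_mul_id (R := k) (C := H))
  rw [map_mul, map_one] at h
  exact h

lemma tens_mul_tens (x y x' y' : Conv k H k) :
    tens x y * tens x' y' = tens (x * x') (y * y') := by
  have c := (commute_fst_snd x' y).eq
  rw [tens, tens, tens, mul_assoc, ← mul_assoc (pre k (snd k H) y), ← c, mul_assoc, ← mul_assoc,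
    map_mul, map_mul]

lemma tens_one : tens (1 : Conv k H k) 1 = 1 := by
  rw [tens, map_one, map_one, one_mul]

lemma copr_pt (g : H →ₐ[k] k) : copr (pt g) = tens (pt g) (pt g) := by
  apply WithConv.ext
  apply TensorProduct.ext'
  intro a b
  exact (map_mul g a b).trans (tens_tmul (pt g) (pt g) a b).symm

lemma comp_conj (g : H →ₐ[k] k) (ψ : Conv k H k) (a : H) :
    ψ (conj g a) = (pt g * ψ * ptInv g) a := by
  have h1 := comp_mul_scal ψ.ofConv (ptInv g) (scal H (pt g) * idC k H)
  have h2 := comp_scal_mul ψ.ofConv (pt g) (idC k H)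
  rw [h2] at h1
  exact congrArg (fun f : Conv k H k => f a) h1

variable (hU : IsUnipotent k H) {ρ : Conv k (H ⊗[k] H) k} (h : IsInvBivector ρ)

include hU h in
lemma IsInvBivector.commute_tens (g : H →ₐ[k] k) : Commute (cexp ρ) (tens (pt g) (pt g)) := by
  rw [← copr_pt]
  exact (isInvariant_cexp (h.locNil hU) h.invariant).commute_copr _

/-- The support of `exp(ρ)` is normal. As `exp(ρ)` commutes with `g ⊗ g`, conjugating its second
argument by `g` amounts to conjugating its first argument by `g⁻¹`. -/
lemma IsInvBivector.isNormal : IsNormal k (h.radical hU) := by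
  intro g a ha
  refine (h.mem_radical hU _).2 fun b => ?_
  change slotR (cexp ρ) b (conj g a) = 0
  rw [comp_conj]
  have hc := (h.commute_tens hU g).eq
  have c1 := (commute_fst_snd (ptInv g) (pt g)).eq
  have c2 := (commute_fst_snd (pt g) (ptInv g)).eq
  have e1 : pre k (fst k H) (ptInv g) * pre k (fst k H) (pt g) = 1 := by
    rw [← map_mul, ptInv_mul_pt, map_one]
  have e2 : pre k (snd k H) (pt g) * pre k (snd k H) (ptInv g) = 1 := by
    rw [← map_mul, pt_mul_ptInv, map_one]
  have key : pre k (snd k H) (pt g) * cexp ρ * pre k (snd k H) (ptInv g) =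
      pre k (fst k H) (ptInv g) * cexp ρ * pre k (fst k H) (pt g) := by
    rw [tens] at hc
    set p1 := pre k (fst k H) (pt g)
    set p2 := pre k (snd k H) (pt g)
    set q1 := pre k (fst k H) (ptInv g)
    set q2 := pre k (snd k H) (ptInv g)
    calc p2 * cexp ρ * q2 = (q1 * p1) * p2 * cexp ρ * q2 := by rw [e1, one_mul]
      _ = q1 * (p1 * p2 * cexp ρ) * q2 := by simp only [mul_assoc]
      _ = q1 * (cexp ρ * (p1 * p2)) * q2 := by rw [hc]
      _ = q1 * cexp ρ * p1 * (p2 * q2) := by simp only [mul_assoc]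
      _ = _ := by rw [e2, mul_one]
  have h0 : slotL (cexp ρ) a = 0 := conv_ext ((h.mem_radical hU a).1 ha)
  have h1 : slotR (pre k (snd k H) (pt g) * cexp ρ) b = pt g * slotR (cexp ρ) b :=
    conv_ext fun c => pre_snd_mul_apply _ _ b c
  have h2 : slotL (pre k (fst k H) (ptInv g) * cexp ρ) a = ptInv g * slotL (cexp ρ) a :=
    conv_ext fun c => pre_fst_mul_apply _ _ c a
  have h3 := mul_pre_snd_apply (ptInv g) (pre k (snd k H) (pt g) * cexp ρ) b a
  have h4 := mul_pre_fst_apply (pt g) (pre k (fst k H) (ptInv g) * cexp ρ) b a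
  rw [← h1]
  refine h3.symm.trans ?_
  rw [key]
  refine h4.trans ?_
  change (slotL (pre k (fst k H) (ptInv g) * cexp ρ) a * pt g) b = 0
  rw [h2, h0, mul_zero, zero_mul]
  rfl

section Descent

variable {I : Ideal H} [I.IsHopfIdeal k]
variable {j : Conv k ((H ⧸ I) ⊗[k] (H ⧸ I)) k} (hj : lif I j = ρ)

include hU h hj

lemma IsInvBivector.locNil_descent : LocNil j :=
  LocNil.of_pre (quot2_surjective I) (by rw [hj]; exact h.locNil hU)

lemma IsInvBivector.lif_cexp_descent : lif I (cexp j) = cexp ρ := by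
  rw [pre_cexp (h.locNil_descent hU hj), hj]

lemma IsInvBivector.skew_descent : pre k (InvCoh.swap k (H ⧸ I)) j = -j := by
  refine lif_injective I ?_
  rw [lif_swap, hj, h.skew, map_neg, hj]

lemma IsInvBivector.isCotriangular [Coalgebra.IsCocomm k (H ⧸ I)] : IsCotriangular (cexp j) where
  isUnit := (cexpU j (h.locNil_descent hU hj)).isUnit
  mul_swap := by
    have hl := h.locNil_descent hU hj
    rw [pre_cexp hl, h.skew_descent hU hj, cexp_mul_cexp_neg hl]
  map_mul_right a g l := by
    obtain ⟨a, rfl⟩ := Ideal.Quotient.mk_surjective a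
    obtain ⟨g, rfl⟩ := Ideal.Quotient.mk_surjective g
    obtain ⟨l, rfl⟩ := Ideal.Quotient.mk_surjective l
    change lif I (cexp j) (a ⊗ₜ (g * l)) = (lif1 I (slotL (cexp j) (Ideal.Quotient.mk I g) *
      slotL (cexp j) (Ideal.Quotient.mk I l))) a
    rw [map_mul, lif1_slotL, lif1_slotL, h.lif_cexp_descent hU hj, ← h.slotL_mul hU]
    rfl
  map_mul_left a g l := by
    obtain ⟨a, rfl⟩ := Ideal.Quotient.mk_surjective a
    obtain ⟨g, rfl⟩ := Ideal.Quotient.mk_surjective g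
    obtain ⟨l, rfl⟩ := Ideal.Quotient.mk_surjective l
    change lif I (cexp j) ((a * g) ⊗ₜ l) = (lif1 I (slotR (cexp j) (Ideal.Quotient.mk I g) *
      slotR (cexp j) (Ideal.Quotient.mk I a))) l
    rw [map_mul, lif1_slotR, lif1_slotR, h.lif_cexp_descent hU hj, ← h.slotR_mul hU, mul_comm a g]
    rfl
  comm := by
    have e : pre (H ⧸ I) (InvCoh.swap k (H ⧸ I)) (toConv (LinearMap.mul' k (H ⧸ I))) =
        toConv (LinearMap.mul' k (H ⧸ I)) := by
      apply WithConv.ext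
      apply TensorProduct.ext'
      intro a b
      exact mul_comm b a
    rw [e]
    exact mul_comm _ _

/-- The Drinfeld element of `exp(j)` is the exponential of the restriction of `j` along the
comultiplication, which vanishes as `j` is skew-symmetric and the comultiplication symmetric. -/
lemma IsInvBivector.drinfeld_eq [Coalgebra.IsCocomm k (H ⧸ I)] : drinfeld (cexp j) = 1 := by
  have hl := h.locNil_descent hU hj
  let δ : H ⧸ I →ₗc[k] (H ⧸ I) ⊗[k] (H ⧸ I) := comulCoalgHom k (H ⧸ I)
  have h0 : pre k δ j = 0 := by
    have h1 : pre k δ j = -pre k δ j := by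
      rw [← map_neg, ← h.skew_descent hU hj]
      refine conv_ext fun a => ?_
      exact congrArg j (comm_comul k a).symm
    have h2 : (2 : k) • pre k δ j = 0 := by
      rw [two_smul]
      nth_rewrite 1 [h1]
      exact neg_add_cancel _
    exact (smul_eq_zero.1 h2).resolve_left two_ne_zero
  have h1 : pre k δ (cexp j) = 1 := by rw [pre_cexp hl, h0, cexp_zero]
  have hS : ∀ a b : H ⧸ I, cexp j (HopfAlgebra.antipode k b ⊗ₜ a) = cexp j (a ⊗ₜ b) := by
    intro a b
    obtain ⟨a, rfl⟩ := Ideal.Quotient.mk_surjective a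
    obtain ⟨b, rfl⟩ := Ideal.Quotient.mk_surjective b
    change lif I (cexp j) (HopfAlgebra.antipode k b ⊗ₜ a) = lif I (cexp j) (a ⊗ₜ b)
    rw [h.lif_cexp_descent hU hj, ← antipode_antipode (k := k) a, h.apply_antipode hU,
      h.apply_antipode hU, antipode_antipode, h.apply_antipode hU]
  rw [← h1]
  refine conv_ext fun a => ?_
  change cexp j (TensorProduct.map (HopfAlgebra.antipode k) LinearMap.id
    (TensorProduct.comm k _ _ (comul a))) = cexp j (comul a)
  generalize comul (R := k) a = t
  induction t with
  | zero => simp only [map_zero]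
  | add s t hs ht => simp only [map_add, hs, ht]
  | tmul x y => exact hS x y

lemma IsInvBivector.tens_mul_lif_mul_tens (g : H →ₐ[k] k) :
    tens (pt g) (pt g) * lif I (cexp j) * tens (ptInv g) (ptInv g) = lif I (cexp j) := by
  rw [h.lif_cexp_descent hU hj, ← (h.commute_tens hU g).eq, mul_assoc]
  rw [tens_mul_tens, pt_mul_ptInv, tens_one, mul_one]

/-- The form `exp(j/2)` is a Hopf cocycle with `R`-matrix `exp(j)`. -/
lemma IsInvBivector.exists_halfCocycle : ∃ L : (Conv k ((H ⧸ I) ⊗[k] (H ⧸ I)) k)ˣ,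
    IsHopfCocycle L.1 ∧ rMatrix L = cexp j ∧ lif I L.1 = cexp ((2⁻¹ : k) • ρ) := by
  have hl := h.locNil_descent hU hj
  have hlif : lif I (cexp ((2⁻¹ : k) • j)) = cexp ((2⁻¹ : k) • ρ) := by
    rw [pre_cexp (hl.smul _), ← hj]
    rfl
  have hs : pre k (InvCoh.swap k (H ⧸ I)) ((2⁻¹ : k) • j) = -((2⁻¹ : k) • j) := by
    have e : pre k (InvCoh.swap k (H ⧸ I)) ((2⁻¹ : k) • j) =
      (2⁻¹ : k) • pre k (InvCoh.swap k (H ⧸ I)) j := rfl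
    rw [e, h.skew_descent hU hj, smul_neg]
  refine ⟨cexpU _ (hl.smul (2⁻¹ : k)), IsHopfCocycle.of_lif I (Units.isUnit _) ?_, ?_, hlif⟩
  · change IsHopfCocycle (lif I (cexp ((2⁻¹ : k) • j)))
    rw [hlif]
    exact isHopfCocycle_cexp hU (h.isAddCocycle.smul _) (h.invariant.smul _)
  · have h1 : preU k (InvCoh.swap k (H ⧸ I)) (cexpU _ (hl.smul (2⁻¹ : k))) =
        (cexpU _ (hl.smul (2⁻¹ : k)))⁻¹ := by
      refine Units.ext ?_
      change pre k (InvCoh.swap k (H ⧸ I)) (cexp ((2⁻¹ : k) • j)) = cexp (-((2⁻¹ : k) • j))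
      rw [pre_cexp (hl.smul _), hs]
    rw [rMatrix, h1, inv_inv]
    change cexp ((2⁻¹ : k) • j) * cexp ((2⁻¹ : k) • j) = cexp j
    rw [← cexp_add (hl.smul _) (hl.smul _) (Commute.refl _), ← add_smul]
    have h4 : ((2⁻¹ : k) + 2⁻¹) = 1 := by norm_num
    rw [h4, one_smul]

end Descent

include hU h in
/-- The element of `𝓑(G)` defined by an invariant bivector. -/
lemma IsInvBivector.exists_bset : ∃ B : BSet k H, lif B.I B.R = cexp ρ ∧
    ∃ L : (Conv k ((H ⧸ B.I) ⊗[k] (H ⧸ B.I)) k)ˣ, IsMinimalCocycle L ∧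
      lif B.I L.1 = cexp ((2⁻¹ : k) • ρ) := by
  have : (h.radical hU).IsHopfIdeal k := h.isHopfIdeal hU
  have := h.isCocomm hU
  have hl := h.locNil hU
  obtain ⟨F, hF⟩ := exists_lif_eq (h.radical hU) (fun a ha b => h.apply_radical hU ha b)
    fun a ha b => (h.mem_radical hU a).1 ha b
  have hF1 : LocNil (F - 1) := LocNil.of_pre (quot2_surjective (h.radical hU)) (by
    have e : pre k (quot2 (h.radical hU)) (F - 1) = cexp ρ - 1 := by
      rw [map_sub, map_one]
      exact congrArg (· - 1) hF
    rw [e]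
    exact locNil_cexp_sub_one hl)
  have hlog := locNil_clog hF1
  have hj : lif (h.radical hU) (clog F) = ρ := by
    refine cexp_injective (hlog.pre _) hl ?_
    rw [← pre_cexp hlog, cexp_clog hF1, hF]
  have hmin : IsNondegenerate (cexp (clog F)) := by
    intro a ha
    obtain ⟨a, rfl⟩ := Ideal.Quotient.mk_surjective a
    refine Ideal.Quotient.eq_zero_iff_mem.2 ((h.mem_radical hU a).2 fun b => ?_)
    rw [← h.lif_cexp_descent hU hj]
    exact ha _
  obtain ⟨L, h1, h2, h3⟩ := h.exists_halfCocycle hU hj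
  exact ⟨⟨h.radical hU, cexp (clog F), h.isNormal hU, h.isCocomm hU, h.isCotriangular hU hj, hmin,
    h.drinfeld_eq hU hj, h.tens_mul_lif_mul_tens hU hj⟩, h.lif_cexp_descent hU hj,
    L, ⟨h1, by rw [h2]; exact hmin⟩, h3⟩

end Support

/-! ### The map `Θ` -/

section Theta

variable {k : Type u} [Field k] [CharZero k]
variable {H : Type v} [CommRing H] [HopfAlgebra k H]

lemma isInvBivector_toDualR (hU : IsUnipotent k H) (r : k ⊗[k] wedgeInv k H) :
    IsInvBivector (toDualR k H k r) :=
  ⟨(toDualR_mem hU r).1, (toDualR_mem hU r).2.1, (toDualR_mem hU r).2.2⟩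

/-- The `R`-matrix of a cocycle in the class of `exp(r/2)` is `exp(r)`. -/
lemma rMatrix_eq (hU : IsUnipotent k H) (J : Z2inv k H k) (r : k ⊗[k] wedgeInv k H)
    {x : (Conv k H k)ˣ} (hx : ∀ y, Commute x.1 y)
    (hJ : J.1.1 = (expCocycle hU r).1.1 * coboundary x) :
    rMatrix J.1 = cexp (toDualR k H k r) := by
  have hl : LocNil ((2⁻¹ : k) • toDualR k H k r) := ((toDualR_mem hU r).1.locNil hU).smul _
  have e1 : (expCocycle hU r).1.1 * (expCocycle hU r).1.1 = cexp (toDualR k H k r) := by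
    rw [expCocycle_val, ← cexp_add hl hl (Commute.refl _), ← add_smul]
    have h4 : ((2⁻¹ : k) + 2⁻¹) = 1 := by norm_num
    rw [h4, one_smul]
  have hc := (coboundary_commute hx (expCocycle hU r).2.2).eq
  rw [rMatrix, Units.inv_mul_eq_iff_eq_mul]
  change J.1.1 = pre k (swap k H) J.1.1 * _
  rw [hJ, map_mul, coboundary_swap, swap_expCocycle, ← e1]
  set E := (expCocycle hU r).1
  rw [mul_assoc, ← mul_assoc (coboundary x), hc, mul_assoc, hc, ← mul_assoc, ← mul_assoc,
    Units.inv_mul, one_mul]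

/-- A class in the second invariant cohomology determines an element of `𝓑(G)`. -/
lemma exists_bset_of_class (hU : IsUnipotent k H) [Algebra.FiniteType k H]
    (r : k ⊗[k] wedgeInv k H) :
    ∃ B : BSet k H, lif B.I B.R = cexp (toDualR k H k r) ∧
      ∀ J : Z2inv k H k, cls J = expHom hU (Multiplicative.ofAdd r) →
        IsSupport B.I J.1.1 ∧ rMatrix J.1 = cexp (toDualR k H k r) := by
  obtain ⟨B, hB, L, hL, hLr⟩ := (isInvBivector_toDualR hU r).exists_bset hU
  refine ⟨B, hB, fun J hJ => ?_⟩
  obtain ⟨x, hx, hxJ⟩ := QuotientGroup.eq.1 hJ.symm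
  have hJ' : J.1.1 = (expCocycle hU r).1.1 * coboundary x := by
    rw [← hxJ]
    change J.1.1 = (expCocycle hU r).1.1 * (((expCocycle hU r).1⁻¹).1 * J.1.1)
    rw [← mul_assoc, Units.mul_inv, one_mul]
  refine ⟨⟨L, hL, x, ?_⟩, rMatrix_eq hU J r hx hJ'⟩
  rw [hJ', coboundary, gauge, hLr, ← mul_assoc,
    ((expCocycle hU r).2.2.commute_copr x.1).eq]
  rfl

/-- The exponential of an element of the Lie algebra of a unipotent group, as a `k`-point. -/
def expPt (hU : IsUnipotent k H) {z : Conv k H k} (hz : z ∈ lieAlg k H) : H →ₐ[k] k :=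
  have hl : LocNil z := locNil_of_apply_one hU (lieAlg_apply_one hz)
  have hm : ∀ a b, cexp z (a * b) = cexp z a * cexp z b := fun a b =>
    (congrArg (fun f : Conv k (H ⊗[k] H) k => f (a ⊗ₜ b))
      (copr_cexp hl ((leibniz_iff z).1 hz))).trans (tens_tmul _ _ a b)
  AlgHom.ofLinearMap (cexp z).ofConv (by
    have h1 : cexp z 1 * cexp z 1 = cexp z 1 := by rw [← hm, mul_one]
    have h2 : cexp z 1 * cexp (-z) 1 = 1 := by
      have h := congrArg (fun f : Conv k H k => f 1) (cexp_mul_cexp_neg hl)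
      have e : (cexp z * cexp (-z)) 1 = cexp z 1 * cexp (-z) 1 := by
        rw [LinearMap.convMul_apply, Bialgebra.comul_one, Algebra.TensorProduct.one_def,
          TensorProduct.map_tmul, LinearMap.mul'_apply]
      rw [← e]
      refine h.trans ?_
      change algebraMap k k (counit (1 : H)) = 1
      simp
    exact mul_left_cancel₀ (left_ne_zero_of_mul_eq_one h2) (h1.trans (mul_one _).symm)) hm

lemma pt_expPt (hU : IsUnipotent k H) {z : Conv k H k} (hz : z ∈ lieAlg k H) :
    pt (expPt hU hz) = cexp z := rfl

lemma BSet.slotL_mul (B : BSet k H) (g l : H) :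
    slotL (lif B.I B.R) (g * l) = slotL (lif B.I B.R) g * slotL (lif B.I B.R) l := by
  refine conv_ext fun a => ?_
  have h := B.cotriangular.map_mul_right (Ideal.Quotient.mk B.I a) (Ideal.Quotient.mk B.I g)
    (Ideal.Quotient.mk B.I l)
  rw [← lif1_slotL, ← lif1_slotL, ← lif1_slotL, ← map_mul]
  exact h

lemma BSet.mul_swap (B : BSet k H) :
    lif B.I B.R * pre k (InvCoh.swap k H) (lif B.I B.R) = 1 := by
  rw [← lif_swap, ← map_mul, B.cotriangular.mul_swap, map_one]

lemma BSet.swap_mul (B : BSet k H) :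
    pre k (InvCoh.swap k H) (lif B.I B.R) * lif B.I B.R = 1 := by
  have h := congrArg (pre k (InvCoh.swap k H)) B.mul_swap
  rw [map_mul, map_one] at h
  have e : pre k (InvCoh.swap k H) (pre k (InvCoh.swap k H) (lif B.I B.R)) = lif B.I B.R := by
    apply WithConv.ext
    apply TensorProduct.ext'
    intro a b
    rfl
  rwa [e] at h

lemma slotL_mul_one {F G : Conv k (H ⊗[k] H) k} (h : F * G = 1) : slotL F 1 * slotL G 1 = 1 := by
  refine conv_ext fun a => ?_
  refine (conv_mul_tmul_one (J := F) (F := G) a).symm.trans ?_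
  rw [h, LinearMap.convOne_apply, LinearMap.convOne_apply]
  simp

lemma slotR_mul_one {F G : Conv k (H ⊗[k] H) k} (h : F * G = 1) : slotR F 1 * slotR G 1 = 1 := by
  refine conv_ext fun a => ?_
  refine (conv_mul_one_tmul (J := F) (F := G) a).symm.trans ?_
  rw [h, LinearMap.convOne_apply, LinearMap.convOne_apply]
  simp

/-- The form of an element of `𝓑(G)` is normalized: the linear form `R(·, 1)` is an idempotent
with a right inverse. -/
lemma BSet.slotL_one (B : BSet k H) : slotL (lif B.I B.R) 1 = 1 := by
  have h1 := B.slotL_mul 1 1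
  have h2 := slotL_mul_one B.mul_swap
  rw [one_mul] at h1
  calc slotL (lif B.I B.R) 1
      = slotL (lif B.I B.R) 1 * (slotL (lif B.I B.R) 1 *
          slotL (pre k (InvCoh.swap k H) (lif B.I B.R)) 1) := by rw [h2, mul_one]
    _ = 1 := by rw [← mul_assoc, ← h1, h2]

lemma BSet.slotR_one (B : BSet k H) : slotR (lif B.I B.R) 1 = 1 := by
  have h := slotR_mul_one B.mul_swap
  have e : slotR (pre k (InvCoh.swap k H) (lif B.I B.R)) 1 = slotL (lif B.I B.R) 1 := rfl
  rwa [e, B.slotL_one, mul_one] at h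

lemma BSet.locNil_lif_sub_one (hU : IsUnipotent k H) (B : BSet k H) :
    LocNil (lif B.I B.R - 1) := by
  refine locNil_of_one_tmul hU fun b => ?_
  have h : lif B.I B.R (1 ⊗ₜ b) = (1 : Conv k H k) b :=
    congrArg (fun f : Conv k H k => f b) B.slotR_one
  have e : (lif B.I B.R - 1) (1 ⊗ₜ b) =
      lif B.I B.R (1 ⊗ₜ b) - (1 : Conv k (H ⊗[k] H) k) (1 ⊗ₜ b) := rfl
  rw [e, h, LinearMap.convOne_apply, LinearMap.convOne_apply]
  simp

lemma BSet.locNil_sub_one (hU : IsUnipotent k H) (B : BSet k H) : LocNil (B.R - 1) := by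
  refine LocNil.of_pre (quot2_surjective B.I) ?_
  rw [map_sub, map_one]
  exact B.locNil_lif_sub_one hU

/-- As the subgroup is commutative, all convolution products on it commute, so that the logarithm
of the bicharacter `R` is a biderivation. -/
lemma BSet.clog_tmul_mul (hU : IsUnipotent k H) (B : BSet k H) (a b c : H) :
    lif B.I (clog B.R) (c ⊗ₜ (a * b)) = counit (R := k) a • lif B.I (clog B.R) (c ⊗ₜ b) +
      counit (R := k) b • lif B.I (clog B.R) (c ⊗ₜ a) := by
  have := B.comm
  have hl := locNil_clog (B.locNil_sub_one hU)
  have he := cexp_clog (B.locNil_sub_one hU)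
  set j := clog B.R
  have hmul : pre k (mul23 k (H ⧸ B.I)) j =
      pre k (proj12 k (H ⧸ B.I)) j + pre k (proj13 k (H ⧸ B.I)) j := by
    have hc : Commute (pre k (proj12 k (H ⧸ B.I)) j) (pre k (proj13 k (H ⧸ B.I)) j) :=
      mul_comm _ _
    refine cexp_injective (hl.pre _) ((hl.pre _).add (hl.pre _) hc) ?_
    rw [cexp_add (hl.pre _) (hl.pre _) hc, ← pre_cexp hl, ← pre_cexp hl, ← pre_cexp hl, he]
    apply WithConv.ext
    apply TensorProduct.ext_threefold'
    intro a b c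
    exact (B.cotriangular.map_mul_right a b c).trans (proj12_mul_proj13_apply B.R B.R a b c).symm
  have h := congrArg (fun f : Conv k ((H ⧸ B.I) ⊗[k] ((H ⧸ B.I) ⊗[k] (H ⧸ B.I))) k =>
    pre k (quot3 k B.I) f (c ⊗ₜ (a ⊗ₜ b))) hmul
  change lif B.I j (c ⊗ₜ (a * b)) = lif B.I j (c ⊗ₜ (counit (R := k) b • a)) +
    lif B.I j (c ⊗ₜ (counit (R := k) a • b)) at h
  rw [h, TensorProduct.tmul_smul, TensorProduct.tmul_smul, map_smul, map_smul, add_comm]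

/-- Invariance of the form of an element of `𝓑(G)` under the `k`-points `exp(z)`. -/
lemma BSet.commute_copr_cexp (hU : IsUnipotent k H) (B : BSet k H) {z : Conv k H k}
    (hz : z ∈ lieAlg k H) : Commute (lif B.I B.R) (copr (cexp z)) := by
  have h := B.invariant (expPt hU hz)
  have e : tens (ptInv (expPt hU hz)) (ptInv (expPt hU hz)) *
      tens (pt (expPt hU hz)) (pt (expPt hU hz)) = 1 := by
    rw [tens_mul_tens, ptInv_mul_pt, tens_one]
  rw [← pt_expPt hU hz, copr_pt]
  generalize lif B.I B.R = F at *
  generalize tens (pt (expPt hU hz)) (pt (expPt hU hz)) = T at *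
  generalize tens (ptInv (expPt hU hz)) (ptInv (expPt hU hz)) = T' at *
  change F * T = T * F
  conv_lhs => rw [← h]
  rw [mul_assoc, e, mul_one]

/-- Every element of `𝓑(G)` comes from an invariant bivector, namely the logarithm of its form. -/
lemma BSet.exists_bivector (hU : IsUnipotent k H) [Algebra.FiniteType k H] (B : BSet k H) :
    ∃ r : k ⊗[k] wedgeInv k H, cexp (toDualR k H k r) = lif B.I B.R := by
  have hlj := locNil_clog (B.locNil_sub_one hU)
  have hr := B.clog_tmul_mul hU
  have hlρ : LocNil (lif B.I (clog B.R)) := hlj.pre _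
  have heρ : cexp (lif B.I (clog B.R)) = lif B.I B.R := by
    rw [← pre_cexp hlj, cexp_clog (B.locNil_sub_one hU)]
  generalize lif B.I (clog B.R) = ρ at *
  have hskew : pre k (InvCoh.swap k H) ρ = -ρ := by
    refine cexp_injective (hlρ.pre _) hlρ.neg ?_
    rw [← pre_cexp hlρ, heρ]
    have h1 : lif B.I B.R * cexp (-ρ) = 1 := by rw [← heρ, cexp_mul_cexp_neg hlρ]
    exact left_inv_eq_right_inv B.swap_mul h1
  have hs : ∀ a b : H, ρ (b ⊗ₜ a) = -ρ (a ⊗ₜ b) := fun a b =>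
    congrArg (fun f : Conv k (H ⊗[k] H) k => f (a ⊗ₜ b)) hskew
  have hll : ∀ a b c : H, ρ ((a * b) ⊗ₜ c) =
      counit (R := k) a • ρ (b ⊗ₜ c) + counit (R := k) b • ρ (a ⊗ₜ c) := by
    intro a b c
    rw [hs c (a * b), hr, hs c b, hs c a, smul_neg, smul_neg, neg_add]
  obtain ⟨t, ht⟩ := exists_toDual_eq hll hr
  have htw : t ∈ wedgeInv k H := by
    refine (mem_wedgeInv_iff t).2 ⟨by rw [ht, hskew], fun z hz => ?_⟩
    have hlz : LocNil z := locNil_of_apply_one hU (lieAlg_apply_one hz)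
    have hc := B.commute_copr_cexp hU hz
    rw [pre_cexp hlz] at hc
    have h1 := commute_of_commute_cexp (hlz.pre _) hc
    rw [← heρ] at h1
    rw [ht]
    exact (commute_of_commute_cexp hlρ h1.symm).symm
  refine ⟨1 ⊗ₜ ⟨t, htw⟩, ?_⟩
  rw [← heρ, ← ht]
  refine congrArg cexp (conv_ext fun s => ?_)
  rw [toDualR_tmul_apply, smul_eq_mul, mul_one]

/-- The element of `𝓑(G)` assigned to the class of `exp(r/2)`. -/
def thetaAux (hU : IsUnipotent k H) [Algebra.FiniteType k H] (r : k ⊗[k] wedgeInv k H) : BSet k H :=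
  (exists_bset_of_class hU r).choose

section

variable (hU : IsUnipotent k H) [Algebra.FiniteType k H]

lemma lif_thetaAux (r : k ⊗[k] wedgeInv k H) :
    lif (thetaAux hU r).I (thetaAux hU r).R = cexp (toDualR k H k r) :=
  (exists_bset_of_class hU r).choose_spec.1

lemma thetaAux_spec (r : k ⊗[k] wedgeInv k H) (J : Z2inv k H k)
    (hJ : cls J = expHom hU (Multiplicative.ofAdd r)) :
    IsSupport (thetaAux hU r).I J.1.1 ∧ rMatrix J.1 = cexp (toDualR k H k r) :=
  (exists_bset_of_class hU r).choose_spec.2 J hJ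

lemma expHom_apply {R : Type w} [CommRing R] [Algebra k R]
    (c : Multiplicative (R ⊗[k] wedgeInv k H)) : expHom hU c = cls (expCocycle hU c.toAdd) := rfl

lemma IsTheta.apply_expHom {Θ : H2inv k H k → BSet k H} (hΘ : IsTheta Θ)
    (c : Multiplicative (k ⊗[k] wedgeInv k H)) : Θ (expHom hU c) = thetaAux hU c.toAdd := by
  have h1 := (hΘ (expCocycle hU c.toAdd)).2
  have h2 := (thetaAux_spec hU c.toAdd (expCocycle hU c.toAdd) (expHom_apply hU c).symm).2
  rw [expHom_apply]
  exact bset_ext (h1.trans (h2.trans (lif_thetaAux hU c.toAdd).symm))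

include hU

lemma exists_isTheta : ∃ Θ : H2inv k H k → BSet k H, IsTheta Θ := by
  choose s hs using expHom_surjective (R := k) hU
  refine ⟨fun c => thetaAux hU (s c).toAdd, fun J => ?_⟩
  have h := thetaAux_spec hU (s (cls J)).toAdd J (hs (cls J)).symm
  exact ⟨h.1, (lif_thetaAux hU _).trans h.2.symm⟩

lemma IsTheta.eq {Θ Θ' : H2inv k H k → BSet k H} (h : IsTheta Θ) (h' : IsTheta Θ') : Θ = Θ' := by
  funext c
  obtain ⟨c, rfl⟩ := expHom_surjective hU c
  rw [h.apply_expHom, h'.apply_expHom]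

lemma IsTheta.bijective {Θ : H2inv k H k → BSet k H} (h : IsTheta Θ) : Function.Bijective Θ := by
  constructor
  · intro c c' hc
    obtain ⟨c, rfl⟩ := expHom_surjective hU c
    obtain ⟨c', rfl⟩ := expHom_surjective hU c'
    rw [h.apply_expHom, h.apply_expHom] at hc
    have h2 := lif_thetaAux hU c.toAdd
    rw [hc, lif_thetaAux] at h2
    have h3 := cexp_injective ((toDualR_mem hU c'.toAdd).1.locNil hU)
      ((toDualR_mem hU c.toAdd).1.locNil hU) h2
    exact congrArg (expHom hU) (Multiplicative.toAdd.injective (toDualR_injective h3)).symm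
  · intro B
    obtain ⟨r, hr⟩ := B.exists_bivector hU
    refine ⟨expHom hU (Multiplicative.ofAdd r), (h.apply_expHom hU _).trans (bset_ext ?_)⟩
    exact (lif_thetaAux hU r).trans hr

end

end Theta

end InvCoh

end

theorem mainTheorem5 {k : Type u} [Field k] [IsAlgClosed k] [CharZero k]
    {H : Type v} [CommRing H] [HopfAlgebra k H] [Algebra.FiniteType k H]
    (hU : InvCoh.IsUnipotent k H) :
    (∃! Θ : InvCoh.H2inv k H k → InvCoh.BSet k H, InvCoh.IsTheta Θ) ∧
    (∀ Θ : InvCoh.H2inv k H k → InvCoh.BSet k H, InvCoh.IsTheta Θ → Function.Bijective Θ) ∧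
    Module.Finite k (InvCoh.wedgeInv k H) ∧
    (∃ Φ : ∀ (R : Type w) [CommRing R] [Algebra k R],
        Multiplicative (R ⊗[k] InvCoh.wedgeInv k H) ≃* InvCoh.H2inv k H R,
      (∀ (R : Type w) [CommRing R] [Algebra k R] (r : R ⊗[k] InvCoh.wedgeInv k H),
        ∃ J : InvCoh.Z2inv k H R,
          InvCoh.IsExp ((2⁻¹ : k) • InvCoh.toDualR k H R r) J.1.1 ∧
          Φ R (Multiplicative.ofAdd r) = InvCoh.cls J) ∧
      (∀ (R S : Type w) [CommRing R] [Algebra k R] [CommRing S] [Algebra k S] (f : R →ₐ[k] S)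
        (r : R ⊗[k] InvCoh.wedgeInv k H),
        Φ S (Multiplicative.ofAdd (f.toLinearMap.rTensor (InvCoh.wedgeInv k H) r)) =
          InvCoh.H2inv.map f (Φ R (Multiplicative.ofAdd r)))) ∧
    (∀ x y : InvCoh.H2inv k H k, x * y = y * x) := by
  refine ⟨?_, fun Θ hΘ => hΘ.bijective hU, inferInstance,
    ⟨fun R _ _ => MulEquiv.ofBijective (InvCoh.expHom hU)
      ⟨InvCoh.expHom_injective hU, InvCoh.expHom_surjective hU⟩, ?_, ?_⟩, ?_⟩
  · obtain ⟨Θ, hΘ⟩ := InvCoh.exists_isTheta hU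
    exact ⟨Θ, hΘ, fun Θ' hΘ' => hΘ'.eq hU hΘ⟩
  · intro R _ _ r
    exact ⟨InvCoh.expCocycle hU r,
      InvCoh.isExp_cexp (((InvCoh.toDualR_mem hU r).1.locNil hU).smul _), rfl⟩
  · intro R S _ _ _ _ f r
    have h : InvCoh.expCocycle hU (f.toLinearMap.rTensor (InvCoh.wedgeInv k H) r) =
        InvCoh.Z2inv.map f (InvCoh.expCocycle hU r) := by
      refine Subtype.ext (Units.ext ?_)
      change InvCoh.cexp ((2⁻¹ : k) • InvCoh.toDualR k H S _) =
        InvCoh.post _ f (InvCoh.cexp ((2⁻¹ : k) • InvCoh.toDualR k H R r))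
      rw [InvCoh.post_cexp (((InvCoh.toDualR_mem hU r).1.locNil hU).smul _), InvCoh.toDualR_map]
      exact congrArg InvCoh.cexp (InvCoh.conv_ext fun t => (map_smul f _ _).symm)
    exact congrArg InvCoh.cls h
  · intro x y
    obtain ⟨x, rfl⟩ := InvCoh.expHom_surjective hU x
    obtain ⟨y, rfl⟩ := InvCoh.expHom_surjective hU y
    rw [← map_mul, ← map_mul, mul_comm]
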